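/- Let $C=(a_{ij})_{i,j\in I}$ be a Cartan matrix of finite type, with $I$ a finite totally ordered index set, let $\mathfrak g$ be the associated semisimple Lie algebra, and let $(d_i)_{i\in I}$ be relatively prime positive integers with $d_ia_{ij}=d_ja_{ji}$. Let $Q=\bigoplus_{i\in I}\mathbb Z\alpha_i$ be the root lattice, with the bilinear (Euler) form determined by $\langle i,j\rangle=\langle\alpha_i,\alpha_j\rangle=d_ia_{ij}$ for $i<j$, $\langle i,i\rangle=d_i$, and $\langle i,j\rangle=0$ for $i>j$. Put $r_i=r^{d_i}$, $s_i=s^{d_i}$ in $\mathbb Q(r,s)$. Let $U=U_{r,s}(\mathfrak g)$ be the unital associative $\mathbb Q(r,s)$-algebra with generators $e_i,f_i,\omega_i^{\pm1},\omega_i'^{\pm1}$ ($i\in I$) and relations: the $\omega_i^{\pm1},\omega_j'^{\pm1}$ commute with one another and $\omega_i\omega_i^{-1}=\omega_i^{-1}\omega_i=\omega_i'\omega_i'^{-1}=\omega_i'^{-1}\omega_i'=1$; $$\omega_ie_j\omega_i^{-1}=r^{\langle j,i\rangle}s^{-\langle i,j\rangle}e_j,\qquad \omega_i'e_j\omega_i'^{-1}=r^{-\langle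 i,j\rangle}s^{\langle j,i\rangle}e_j,$$ $$\omega_if_j\omega_i^{-1}=r^{-\langle j,i\rangle}s^{\langle i,j\rangle}f_j,\qquad \omega_i'f_j\omega_i'^{-1}=r^{\langle i,j\rangle}s^{-\langle j,i\rangle}f_j,$$ $$e_if_j-f_je_i=\delta_{ij}\frac{\omega_i-\omega_i'}{r_i-s_i},$$ and, for $i\ne j$ and $m=1-a_{ij}$, $$\sum_{k=0}^{m}(-1)^k\binom mk_{r_is_i^{-1}}c^{(k)}_{ij}\,e_i^{m-k}e_je_i^k=0,\qquad \sum_{k=0}^{m}(-1)^k\binom mk_{r_is_i^{-1}}c^{(k)}_{ij}\,f_i^{k}f_jf_i^{m-k}=0,$$ where $c^{(k)}_{ij}=(r_is_i^{-1})^{k(k-1)/2}r^{k\langle j,i\rangle}s^{-k\langle i,j\rangle}$, and $\binom nk_v=\frac{(n)_v!}{(k)_v!(n-k)_v!}$ with $(n)_v=\frac{v^n-1}{v-1}$, $(n)_v!=(1)_v\cdots(n)_v$, $(0)_v!=1$. It is a Hopf algebra with $\omega_i^{\pm1},\omega_i'^{\pm1}$ group-like, $\Delta(e_i)=e_i\otimes1+\omega_i\otimes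 e_i$, $\Delta(f_i)=1\otimes f_i+f_i\otimes\omega_i'$, $\varepsilon(e_i)=\varepsilon(f_i)=0$, $S(e_i)=-\omega_i^{-1}e_i$, $S(f_i)=-f_i\omega_i'^{-1}$. Let $U^{\ge0}$ (resp. $U^{\le0}$) be the Hopf subalgebra generated by all $e_i,\omega_i^{\pm1}$ (resp. $f_i,\omega_i'^{\pm1}$). For $\mu=\sum_i\mu_i\alpha_i\in Q$ put $\omega_\mu=\prod_i\omega_i^{\mu_i}$ and $\omega'_\mu=\prod_i\omega_i'^{\mu_i}$. A bilinear form $(\,,)\colon U^{\le0}\times U^{\ge0}\to\mathbb Q(r,s)$ is a skew pairing if for all $x,x'\in U^{\ge0}$ and $y,y'\in U^{\le0}$ $$(y,xx')=(\Delta(y),x'\otimes x),\quad (yy',x)=(y\otimes y',\Delta(x)),\quad (y,1)=\varepsilon(y),\quad (1,x)=\varepsilon(x),$$ where $(y\otimes y',x\otimes x')=(y,x)(y',x')$. The Drinfeld double $\mathcal D(U^{\ge0},U^{\le0})$ with respect to $(\,,)$ is the tensor product coalgebra $U^{\ge0}\otimes U^{\le0}$ with unit $1\otimes1$, product $$(x\otimes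 y)(x'\otimes y')=\sum\,(S(y_{(1)}),x'_{(1)})\,(y_{(3)},x'_{(3)})\;xx'_{(2)}\otimes y_{(2)}y',$$ and antipode $S(x\otimes y)=(1\otimes S(y))(S(x)\otimes1)$. **Corollary 2.5.** There is a unique skew pairing $(\,,)\colon U^{\le0}\times U^{\ge0}\to\mathbb Q(r,s)$ such that, for all $i,j\in I$ and $\mu,\nu\in Q$, $$(f_i,e_j)=\frac{\delta_{ij}}{s_i-r_i},\qquad (\omega'_\mu,\omega_\nu)=r^{\langle\mu,\nu\rangle}s^{-\langle\nu,\mu\rangle},\qquad (\omega'_\mu,e_i)=0,\qquad (f_i,\omega_\mu)=0,$$ and $U_{r,s}(\mathfrak g)$ is isomorphic to the Drinfeld double of its Borel Hopf subalgebras with respect to this pairing: the multiplication map $$\mathcal D(U^{\ge0},U^{\le0})\longrightarrow U_{r,s}(\mathfrak g),\qquad x\otimes y\longmapsto xy,$$ is an isomorphism of Hopf algebras. -/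

import Mathlib

open scoped TensorProduct

noncomputable section

namespace TwoParam


section QNumbers

variable {k : Type*} [Field k]

/-- The quantum integer `(n)_v = (v ^ n - 1) / (v - 1)`. -/
def qInt (v : k) (n : ℕ) : k := (v ^ n - 1) / (v - 1)

/-- The quantum factorial `(n)_v! = (1)_v (2)_v ⋯ (n)_v`, with `(0)_v! = 1`. -/
def qFact (v : k) (n : ℕ) : k := ∏ i ∈ Finset.range n, qInt v (i + 1)

/-- The Gaussian binomial coefficient `(n)_v! / ((k)_v! (n-k)_v!)` for `n ≥ k ≥ 0`. -/
def qBinom (v : k) (n j : ℕ) : k := qFact v n / (qFact v j * qFact v (n - j))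

/-- Auxiliary: Gaussian binomials by the Pascal recursion. -/
def qPascal (v : k) : ℕ → ℕ → k
  | _, 0 => 1
  | 0, _ + 1 => 0
  | n + 1, j + 1 => qPascal v n (j + 1) + v ^ (n - j) * qPascal v n j

theorem qPascal_of_lt (v : k) : ∀ {n j : ℕ}, n < j → qPascal v n j = 0
  | 0, _ + 1, _ => rfl
  | n + 1, j + 1, h => by
    rw [qPascal, qPascal_of_lt v (show n < j + 1 by omega),
      qPascal_of_lt v (show n < j by omega)]; simp

theorem qInt_ne_zero {v : k} (hv : ∀ n : ℕ, v ^ (n + 1) ≠ 1) (n : ℕ) : qInt v (n + 1) ≠ 0 :=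
  div_ne_zero (sub_ne_zero.2 (hv n)) (sub_ne_zero.2 (by simpa using hv 0))

theorem qFact_ne_zero {v : k} (hv : ∀ n : ℕ, v ^ (n + 1) ≠ 1) (n : ℕ) : qFact v n ≠ 0 :=
  Finset.prod_ne_zero_iff.2 fun _ _ => qInt_ne_zero hv _

theorem qFact_succ (v : k) (n : ℕ) : qFact v (n + 1) = qFact v n * qInt v (n + 1) :=
  Finset.prod_range_succ _ _

theorem qPascal_mul {v : k} (hv : ∀ n : ℕ, v ^ (n + 1) ≠ 1) (n : ℕ) :
    ∀ {j : ℕ}, j ≤ n → qPascal v n j * (qFact v j * qFact v (n - j)) = qFact v n := by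
  induction n with
  | zero => intro j hj; obtain rfl : j = 0 := by omega
            simp [qPascal, qFact]
  | succ n IH =>
    intro j h
    rcases j with _ | j
    · simp [qPascal, qFact]
    have hj : j ≤ n := by omega
    have ih := IH hj
    obtain ⟨t, rfl⟩ := Nat.exists_eq_add_of_le hj
    have h1 : v - 1 ≠ 0 := sub_ne_zero.2 (by simpa using hv 0)
    have e1 : j + t + 1 - (j + 1) = t := by omega
    have e2 : j + t - j = t := by omega
    rw [e2] at ih
    rw [qPascal, e1, e2, qFact_succ v (j + t), ← ih, qFact_succ v j]
    have key : qPascal v (j + t) (j + 1) * (qFact v j * qInt v (j + 1)) * qFact v t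
        = qInt v t * qPascal v (j + t) j * qFact v j * qFact v t := by
      rcases t with _ | t
      · rw [qPascal_of_lt v (by omega)]; simp [qInt]
      · have ih2 := IH (show j + 1 ≤ j + (t + 1) by omega)
        have e3 : j + (t + 1) - (j + 1) = t := by omega
        rw [e3, ← ih, qFact_succ v j] at ih2
        rw [qFact_succ v t] at ih2 ⊢
        linear_combination qInt v (t + 1) * ih2
    have hI : qInt v (j + t + 1) = qInt v t + v ^ t * qInt v (j + 1) := by
      simp only [qInt]; field_simp; ring
    rw [hI]
    linear_combination key

theorem qBinom_eq {v : k} (hv : ∀ n : ℕ, v ^ (n + 1) ≠ 1) {n j : ℕ} (h : j ≤ n) :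
    qBinom v n j = qPascal v n j := by
  rw [qBinom, div_eq_iff (mul_ne_zero (qFact_ne_zero hv _) (qFact_ne_zero hv _)),
    qPascal_mul hv n h]

end QNumbers

section Serre

variable {k : Type*} [Field k] {A : Type*} [Ring A] [Algebra k A]

/-- Iterated twisted commutators `y ↦ x y - c₀ y x ↦ ⋯`. -/
def adIter (c : ℕ → k) (x y : A) : ℕ → A
  | 0 => y
  | n + 1 => x * adIter c x y n - c n • (adIter c x y n * x)

theorem adIter_congr {c c' : ℕ → k} (x y : A) :
    ∀ {n : ℕ}, (∀ t < n, c t = c' t) → adIter c x y n = adIter c' x y n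
  | 0, _ => rfl
  | n + 1, h => by
    rw [adIter, adIter, adIter_congr x y (fun t ht => h t (by omega)), h n (by omega)]

theorem adIter_succ' (c : ℕ → k) (x y : A) :
    ∀ n : ℕ, adIter c x y (n + 1) = x * adIter (fun t => c (t + 1)) x y n
      - c 0 • (adIter (fun t => c (t + 1)) x y n * x)
  | 0 => rfl
  | n + 1 => by
    rw [adIter, adIter_succ' c x y n, adIter]
    simp only [mul_sub, sub_mul, smul_sub, smul_mul_assoc, mul_smul_comm, mul_assoc]
    rw [smul_comm (c 0)]
    abel

theorem adIter_reverse (c : ℕ → k) (x y : A) :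
    ∀ n : ℕ, adIter c x y n = adIter (fun t => c (n - 1 - t)) x y n
  | 0 => rfl
  | n + 1 => by
    rw [adIter_succ', adIter_reverse _ x y n, adIter]
    have : ∀ t < n, c (n - 1 - t + 1) = c (n + 1 - 1 - t) := fun t ht => by congr 1; omega
    rw [adIter_congr x y this]
    simp

theorem adIter_eq_sum (q χ : k) (x y : A) (n : ℕ) :
    adIter (fun t => χ * q ^ t) x y n = ∑ j ∈ Finset.range (n + 1),
      ((-1) ^ j * qPascal q n j * (q ^ (j * (j - 1) / 2) * χ ^ j)) •
        (x ^ (n - j) * y * x ^ j) := by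
  induction n with
  | zero => simp [adIter, qPascal]
  | succ n ih =>
    rw [adIter, ih, Finset.sum_range_succ' _ (n + 1), Finset.sum_range_succ' _ n, mul_add,
      Finset.mul_sum]
    rw [← Finset.sum_range_succ' (fun j => ((-1) ^ j * qPascal q n j *
      (q ^ (j * (j - 1) / 2) * χ ^ j)) • (x ^ (n - j) * y * x ^ j)) n, Finset.sum_mul,
      Finset.smul_sum]
    have h1 : ∑ j ∈ Finset.range (n + 1), ((-1) ^ (j + 1) * qPascal q (n + 1) (j + 1) *
          (q ^ ((j + 1) * (j + 1 - 1) / 2) * χ ^ (j + 1))) •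
          (x ^ (n + 1 - (j + 1)) * y * x ^ (j + 1))
        = ∑ j ∈ Finset.range n, x * (((-1) ^ (j + 1) * qPascal q n (j + 1) *
            (q ^ ((j + 1) * (j + 1 - 1) / 2) * χ ^ (j + 1))) •
            (x ^ (n - (j + 1)) * y * x ^ (j + 1)))
          - ∑ j ∈ Finset.range (n + 1), (χ * q ^ n) • (((-1) ^ j * qPascal q n j *
            (q ^ (j * (j - 1) / 2) * χ ^ j)) • (x ^ (n - j) * y * x ^ j) * x) := by
      have h2 : ∑ j ∈ Finset.range n, x * (((-1) ^ (j + 1) * qPascal q n (j + 1) *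
            (q ^ ((j + 1) * (j + 1 - 1) / 2) * χ ^ (j + 1))) •
            (x ^ (n - (j + 1)) * y * x ^ (j + 1)))
          = ∑ j ∈ Finset.range (n + 1), ((-1) ^ (j + 1) * qPascal q n (j + 1) *
            (q ^ ((j + 1) * (j + 1 - 1) / 2) * χ ^ (j + 1))) •
            (x ^ (n - j) * y * x ^ (j + 1)) := by
        rw [Finset.sum_range_succ _ n, qPascal_of_lt q (show n < n + 1 by omega)]
        simp only [mul_zero, zero_mul, zero_smul, add_zero]
        refine Finset.sum_congr rfl fun j hj => ?_
        have hj' : n - j = n - (j + 1) + 1 := by have := Finset.mem_range.1 hj; omega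
        rw [hj', pow_succ' x (n - (j + 1)), mul_smul_comm]
        simp only [mul_assoc]
      rw [h2, ← Finset.sum_sub_distrib]
      refine Finset.sum_congr rfl fun j hj => ?_
      have hj' : j ≤ n := by have := Finset.mem_range.1 hj; omega
      have e : n + 1 - (j + 1) = n - j := by omega
      have e2 : (j + 1) * (j + 1 - 1) / 2 = j * (j - 1) / 2 + j := by
        rw [Nat.add_sub_cancel, mul_comm]
        have h3 : j * (j + 1) = j * (j - 1) + j * 2 := by
          cases j with
          | zero => rfl
          | succ j => simp; ring
        rw [h3, Nat.add_mul_div_right _ _ (by norm_num)]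
      rw [e, e2, smul_mul_assoc, smul_smul, mul_assoc _ (x ^ j) x, ← pow_succ, ← sub_smul]
      congr 1
      have e3 : q ^ n = q ^ (n - j) * q ^ j := by rw [← pow_add]; congr 1; omega
      rw [qPascal, e3]
      ring
    rw [h1]
    simp only [qPascal, Nat.sub_zero, pow_zero, mul_one, zero_mul, Nat.zero_div,
      one_smul, pow_succ']
    rw [← mul_assoc]
    abel

/-- The quantum Serre expression
`∑ⱼ (-1)ʲ (m choose j)_q q^(j(j-1)/2) χʲ x^(m-j) y xʲ`. -/
def serreL (q χ : k) (m : ℕ) (x y : A) : A :=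
  ∑ j ∈ Finset.range (m + 1), ((-1) ^ j * qBinom q m j * (q ^ (j * (j - 1) / 2) * χ ^ j)) •
    (x ^ (m - j) * y * x ^ j)

/-- The same expression with the order of multiplication reversed. -/
def serreR (q χ : k) (m : ℕ) (x y : A) : A :=
  ∑ j ∈ Finset.range (m + 1), ((-1) ^ j * qBinom q m j * (q ^ (j * (j - 1) / 2) * χ ^ j)) •
    (x ^ j * y * x ^ (m - j))

theorem op_serreR (q χ : k) (m : ℕ) (x y : A) :
    MulOpposite.op (serreR q χ m x y) = serreL q χ m (MulOpposite.op x) (MulOpposite.op y) := by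
  simp only [serreR, serreL, Finset.op_sum, MulOpposite.op_smul, MulOpposite.op_mul,
    MulOpposite.op_pow, mul_assoc]

theorem map_serreL {B : Type*} [Ring B] [Algebra k B] (g : A →ₐ[k] B) (q χ : k) (m : ℕ)
    (x y : A) : g (serreL q χ m x y) = serreL q χ m (g x) (g y) := by
  simp [serreL, map_sum]

theorem map_serreR {B : Type*} [Ring B] [Algebra k B] (g : A →ₐ[k] B) (q χ : k) (m : ℕ)
    (x y : A) : g (serreR q χ m x y) = serreR q χ m (g x) (g y) := by
  simp [serreR, map_sum]

variable {q χ : k}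

theorem serreL_eq (hq : ∀ n : ℕ, q ^ (n + 1) ≠ 1) (m : ℕ) (x y : A) :
    serreL q χ m x y = adIter (fun t => χ * q ^ t) x y m := by
  rw [adIter_eq_sum, serreL]
  refine Finset.sum_congr rfl fun j hj => ?_
  rw [qBinom_eq hq (by have := Finset.mem_range.1 hj; omega)]

theorem serreL_eq' (hq : ∀ n : ℕ, q ^ (n + 1) ≠ 1) (m : ℕ) (x y : A) :
    serreL q χ m x y = adIter (fun t => χ * q ^ (m - 1 - t)) x y m := by
  rw [serreL_eq hq, adIter_reverse]

theorem serreL_add (m : ℕ) (x y z : A) :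
    serreL q χ m x (y + z) = serreL q χ m x y + serreL q χ m x z := by
  simp [serreL, mul_add, add_mul, Finset.sum_add_distrib]

theorem serreL_left (hq : ∀ n : ℕ, q ^ (n + 1) ≠ 1) (m : ℕ) {a b c : A}
    (hba : b * a = q • (a * b)) (hbc : b * c = χ • (c * b)) :
    serreL q χ m (a + b) c = serreL q χ m a c := by
  rw [serreL_eq hq, serreL_eq hq]
  have comm : ∀ n : ℕ, b * adIter (fun t => χ * q ^ t) a c n
      = (χ * q ^ n) • (adIter (fun t => χ * q ^ t) a c n * b) := by
    intro n
    induction n with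
    | zero => simpa [adIter] using hbc
    | succ n ih =>
      set N := adIter (fun t => χ * q ^ t) a c n
      have h1 : b * (a * N) = (χ * q ^ (n + 1)) • (a * N * b) := by
        rw [← mul_assoc, hba, smul_mul_assoc, mul_assoc, ih, mul_smul_comm, smul_smul, ← mul_assoc a]
        congr 1; ring
      have h2 : b * (N * a) = (χ * q ^ (n + 1)) • (N * a * b) := by
        rw [← mul_assoc, ih, smul_mul_assoc, mul_assoc, hba, mul_smul_comm, smul_smul, ← mul_assoc N]
        congr 1; ring
      rw [adIter, mul_sub, mul_smul_comm, h1, h2, sub_mul, smul_mul_assoc, smul_sub, smul_comm]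
  induction m with
  | zero => rfl
  | succ n ih =>
    rw [adIter, ih, adIter, add_mul, mul_add, comm n, smul_add]
    abel

theorem serreL_right (hq : ∀ n : ℕ, q ^ (n + 1) ≠ 1) (m : ℕ) {χ' : k} {a b d : A}
    (hχ : q ^ (m - 1) * χ * χ' = 1)
    (hba : b * a = q • (a * b)) (hda : d * a = χ' • (a * d)) :
    serreL q χ m (a + b) d = serreL q χ m b d := by
  rw [serreL_eq' hq, serreL_eq' hq]
  have comm : ∀ n : ℕ, adIter (fun t => χ * q ^ (m - 1 - t)) b d n * a
      = (χ' * q ^ n) • (a * adIter (fun t => χ * q ^ (m - 1 - t)) b d n) := by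
    intro n
    induction n with
    | zero => simpa [adIter] using hda
    | succ n ih =>
      set N := adIter (fun t => χ * q ^ (m - 1 - t)) b d n
      have h1 : b * N * a = (χ' * q ^ (n + 1)) • (a * (b * N)) := by
        rw [mul_assoc, ih, mul_smul_comm, ← mul_assoc, hba, smul_mul_assoc, smul_smul, mul_assoc a]
        congr 1; ring
      have h2 : N * b * a = (χ' * q ^ (n + 1)) • (a * (N * b)) := by
        rw [mul_assoc, hba, mul_smul_comm, ← mul_assoc, ih, smul_mul_assoc, smul_smul, mul_assoc a]
        congr 1; ring
      rw [adIter, sub_mul, smul_mul_assoc, h1, h2, mul_sub, mul_smul_comm, smul_sub, smul_comm]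
  have key : ∀ n ≤ m, adIter (fun t => χ * q ^ (m - 1 - t)) (a + b) d n
      = adIter (fun t => χ * q ^ (m - 1 - t)) b d n := by
    intro n hn
    induction n with
    | zero => rfl
    | succ n ih =>
      rw [adIter, ih (by omega), adIter, add_mul, mul_add, comm n, smul_add, smul_smul]
      have : χ * q ^ (m - 1 - n) * (χ' * q ^ n) = 1 := by
        rw [← hχ, show m - 1 = (m - 1 - n) + n by omega, pow_add]
        simp only [Nat.add_sub_cancel]; ring
      rw [this, one_smul]
      abel
  exact key m le_rfl

/-- The quantum Serre expression vanishes on sums of suitably skew-commuting elements. -/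
theorem serreL_add_eq_zero (hq : ∀ n : ℕ, q ^ (n + 1) ≠ 1) (m : ℕ) {χ' : k} {a b c d : A}
    (hχ : q ^ (m - 1) * χ * χ' = 1)
    (hba : b * a = q • (a * b)) (hbc : b * c = χ • (c * b)) (hda : d * a = χ' • (a * d))
    (h1 : serreL q χ m a c = 0) (h2 : serreL q χ m b d = 0) :
    serreL q χ m (a + b) (c + d) = 0 := by
  rw [serreL_add, serreL_left hq m hba hbc, serreL_right hq m hχ hba hda, h1, h2, add_zero]

/-- The quantum Serre expression under the substitution underlying the antipode. -/
theorem serreR_antipode (hq : ∀ n : ℕ, q ^ (n + 1) ≠ 1) (m : ℕ) {α β γ : k} {x y u v : A}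
    (hγ : γ = β * χ ^ 2 * q ^ (m - 1)) (huv : u * v = v * u)
    (hxu : x * u = α • (u * x)) (hxv : x * v = β • (v * x)) (hyu : y * u = γ • (u * y))
    (h : serreL q χ m x y = 0) : serreR q χ m (-(u * x)) (-(v * y)) = 0 := by
  apply MulOpposite.op_injective
  rw [op_serreR, serreL_eq hq, MulOpposite.op_zero]
  rw [serreL_eq' hq] at h
  have comm : ∀ n : ℕ, adIter (fun t => χ * q ^ (m - 1 - t)) x y n * u
      = (γ * α ^ n) • (u * adIter (fun t => χ * q ^ (m - 1 - t)) x y n) := by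
    intro n
    induction n with
    | zero => simpa [adIter] using hyu
    | succ n ih =>
      set N := adIter (fun t => χ * q ^ (m - 1 - t)) x y n
      have h1 : x * N * u = (γ * α ^ (n + 1)) • (u * (x * N)) := by
        rw [mul_assoc, ih, mul_smul_comm, ← mul_assoc, hxu, smul_mul_assoc, smul_smul, mul_assoc u]
        congr 1; ring
      have h2 : N * x * u = (γ * α ^ (n + 1)) • (u * (N * x)) := by
        rw [mul_assoc, hxu, mul_smul_comm, ← mul_assoc, ih, smul_mul_assoc, smul_smul, mul_assoc u]
        congr 1; ring
      rw [adIter, sub_mul, smul_mul_assoc, h1, h2, mul_sub, mul_smul_comm, smul_sub, smul_comm]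
  have hxun : ∀ n : ℕ, x * (u ^ n * v) = (α ^ n * β) • (u ^ n * v * x) := by
    intro n
    induction n with
    | zero => simpa using hxv
    | succ n ih =>
      rw [pow_succ', mul_assoc, ← mul_assoc, hxu, smul_mul_assoc, mul_assoc, ih, mul_smul_comm,
        smul_smul]
      simp only [mul_assoc]
      congr 1; ring
  have huvn : ∀ n : ℕ, u ^ n * v * u = u ^ (n + 1) * v := fun n => by
    rw [mul_assoc, ← huv, ← mul_assoc, pow_succ]
  have key : ∀ n ≤ m, ∃ c : k, adIter (fun t => χ * q ^ t)
      (MulOpposite.op (-(u * x))) (MulOpposite.op (-(v * y))) n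
      = MulOpposite.op (c • (u ^ n * v * adIter (fun t => χ * q ^ (m - 1 - t)) x y n)) := by
    intro n hn
    induction n with
    | zero => exact ⟨-1, by simp [adIter]⟩
    | succ n ih =>
      obtain ⟨c, hc⟩ := ih (by omega)
      rw [adIter, hc]
      set N := adIter (fun t => χ * q ^ (m - 1 - t)) x y n with hN
      have h1 : u ^ n * v * N * (u * x) = (γ * α ^ n) • (u ^ (n + 1) * v * (N * x)) := by
        rw [mul_assoc, ← mul_assoc N, comm n, ← hN, smul_mul_assoc, mul_smul_comm, ← huvn n]
        simp only [mul_assoc]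
      have h2 : u * x * (u ^ n * v * N) = (α ^ n * β) • (u ^ (n + 1) * v * (x * N)) := by
        rw [← mul_assoc, mul_assoc u x, hxun, mul_smul_comm, smul_mul_assoc, pow_succ']
        simp only [mul_assoc]
      refine ⟨c * (α ^ n * β) * (χ * q ^ n), ?_⟩
      apply MulOpposite.unop_injective
      simp only [MulOpposite.unop_sub, MulOpposite.unop_mul, MulOpposite.unop_op,
        MulOpposite.unop_smul, smul_mul_assoc, mul_smul_comm, mul_neg, neg_mul, h1, h2]
      rw [adIter, ← hN, mul_sub, mul_smul_comm]
      have e : c * (γ * α ^ n)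
          = c * (α ^ n * β) * (χ * q ^ n) * (χ * q ^ (m - 1 - n)) := by
        rw [hγ, show m - 1 = n + (m - 1 - n) by omega, pow_add]
        simp only [Nat.add_sub_cancel_left]; ring
      simp only [smul_sub, smul_neg, smul_smul, e]
      rw [show χ * q ^ n * (c * (α ^ n * β)) = c * (α ^ n * β) * (χ * q ^ n) by ring]
      abel
  obtain ⟨c, hc⟩ := key m le_rfl
  rw [hc, h]; simp

end Serre



section HopfGenerators

variable {k : Type*} [Field k] {A : Type*} [Ring A] [Bialgebra k A]

/-- The linear map underlying an algebra homomorphism to the opposite algebra. -/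
def unopLin {A : Type*} [Ring A] [Algebra k A] (S : A →ₐ[k] Aᵐᵒᵖ) : A →ₗ[k] A :=
  (MulOpposite.opLinearEquiv k).symm.toLinearMap ∘ₗ S.toLinearMap

@[simp] theorem unopLin_apply {A : Type*} [Ring A] [Algebra k A] (S : A →ₐ[k] Aᵐᵒᵖ) (a : A) :
    unopLin S a = (S a).unop := rfl

theorem antipode_left_mul (S : A →ₐ[k] Aᵐᵒᵖ) (a b : A)
    (ha : LinearMap.mul' k A ((unopLin S).rTensor A (Coalgebra.comul a)) =
      algebraMap k A (Coalgebra.counit a))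
    (hb : LinearMap.mul' k A ((unopLin S).rTensor A (Coalgebra.comul b)) =
      algebraMap k A (Coalgebra.counit b)) :
    LinearMap.mul' k A ((unopLin S).rTensor A (Coalgebra.comul (a * b))) =
      algebraMap k A (Coalgebra.counit (a * b)) := by
  have h1 : ∀ (b₁ b₂ : A) (z : A ⊗[k] A),
      LinearMap.mul' k A ((unopLin S).rTensor A (z * b₁ ⊗ₜ b₂)) =
        (S b₁).unop * LinearMap.mul' k A ((unopLin S).rTensor A z) * b₂ := by
    intro b₁ b₂ z
    induction z with
    | zero => simp
    | tmul x y => simp [mul_assoc]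
    | add x y hx hy => rw [add_mul, map_add, map_add, hx, hy, map_add, map_add, mul_add, add_mul]
  have h2 : ∀ w : A ⊗[k] A,
      LinearMap.mul' k A ((unopLin S).rTensor A (Coalgebra.comul a * w)) =
        algebraMap k A (Coalgebra.counit a) *
          LinearMap.mul' k A ((unopLin S).rTensor A w) := by
    intro w
    induction w with
    | zero => simp
    | tmul x y => rw [h1, ha, ← Algebra.commutes, mul_assoc]; simp
    | add x y hx hy => rw [mul_add, map_add, map_add, hx, hy, map_add, map_add, mul_add]
  rw [Bialgebra.comul_mul, h2, hb, Bialgebra.counit_mul, map_mul]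

theorem antipode_right_mul (S : A →ₐ[k] Aᵐᵒᵖ) (a b : A)
    (ha : LinearMap.mul' k A ((unopLin S).lTensor A (Coalgebra.comul a)) =
      algebraMap k A (Coalgebra.counit a))
    (hb : LinearMap.mul' k A ((unopLin S).lTensor A (Coalgebra.comul b)) =
      algebraMap k A (Coalgebra.counit b)) :
    LinearMap.mul' k A ((unopLin S).lTensor A (Coalgebra.comul (a * b))) =
      algebraMap k A (Coalgebra.counit (a * b)) := by
  have h1 : ∀ (a₁ a₂ : A) (z : A ⊗[k] A),
      LinearMap.mul' k A ((unopLin S).lTensor A (a₁ ⊗ₜ a₂ * z)) =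
        a₁ * LinearMap.mul' k A ((unopLin S).lTensor A z) * (S a₂).unop := by
    intro b₁ b₂ z
    induction z with
    | zero => simp
    | tmul x y => simp [mul_assoc]
    | add x y hx hy => rw [mul_add, map_add, map_add, hx, hy, map_add, map_add, mul_add, add_mul]
  have h2 : ∀ w : A ⊗[k] A,
      LinearMap.mul' k A ((unopLin S).lTensor A (w * Coalgebra.comul b)) =
        LinearMap.mul' k A ((unopLin S).lTensor A w) *
          algebraMap k A (Coalgebra.counit b) := by
    intro w
    induction w with
    | zero => simp
    | tmul x y =>
      rw [h1, hb, mul_assoc, Algebra.commutes, ← mul_assoc]; simp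
    | add x y hx hy => rw [add_mul, map_add, map_add, hx, hy, map_add, map_add, add_mul]
  rw [Bialgebra.comul_mul, h2, ha, Bialgebra.counit_mul, map_mul]

/-- A bialgebra is a Hopf algebra as soon as an anti-endomorphism satisfies the antipode axioms
on a set of algebra generators. -/
@[reducible] def hopfOfGenerators (S : A →ₐ[k] Aᵐᵒᵖ) (s : Set A) (hs : Algebra.adjoin k s = ⊤)
    (hl : ∀ a ∈ s, LinearMap.mul' k A ((unopLin S).rTensor A (Coalgebra.comul a)) =
      algebraMap k A (Coalgebra.counit a))
    (hr : ∀ a ∈ s, LinearMap.mul' k A ((unopLin S).lTensor A (Coalgebra.comul a)) =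
      algebraMap k A (Coalgebra.counit a)) : HopfAlgebra k A where
  antipode := unopLin S
  mul_antipode_rTensor_comul := by
    ext a
    have ha : a ∈ Algebra.adjoin k s := hs ▸ Algebra.mem_top
    change LinearMap.mul' k A ((unopLin S).rTensor A (Coalgebra.comul a)) =
      algebraMap k A (Coalgebra.counit a)
    induction ha using Algebra.adjoin_induction with
    | mem x hx => exact hl x hx
    | algebraMap c => simp [Algebra.TensorProduct.algebraMap_apply]
    | add x y _ _ hx hy => simp only [map_add, hx, hy]
    | mul x y _ _ hx hy => exact antipode_left_mul S x y hx hy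
  mul_antipode_lTensor_comul := by
    ext a
    have ha : a ∈ Algebra.adjoin k s := hs ▸ Algebra.mem_top
    change LinearMap.mul' k A ((unopLin S).lTensor A (Coalgebra.comul a)) =
      algebraMap k A (Coalgebra.counit a)
    induction ha using Algebra.adjoin_induction with
    | mem x hx => exact hr x hx
    | algebraMap c => simp [Algebra.TensorProduct.algebraMap_apply]
    | add x y _ _ hx hy => simp only [map_add, hx, hy]
    | mul x y _ _ hx hy => exact antipode_right_mul S x y hx hy

end HopfGenerators

section HopfSubalgebra

variable {k : Type*} [Field k] {H : Type*} [Ring H] [HopfAlgebra k H]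

/-- The inclusion `B ⊗ B → H ⊗ H` for a subalgebra `B` of `H`. -/
def inclTensor (B : Subalgebra k H) : B ⊗[k] B →ₐ[k] H ⊗[k] H :=
  Algebra.TensorProduct.map B.val B.val

theorem inclTensor_injective (B : Subalgebra k H) : Function.Injective (inclTensor B) :=
  TensorProduct.map_injective_of_flat_flat B.val.toLinearMap B.val.toLinearMap
    Subtype.val_injective Subtype.val_injective

/-- `B` is a Hopf subalgebra: `Δ(B) ⊆ B ⊗ B` and `S(B) ⊆ B`. -/
structure IsHopfSubalgebra (B : Subalgebra k H) : Prop where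
  comul_mem : ∀ b ∈ B, (Coalgebra.comul b : H ⊗[k] H) ∈ (inclTensor B).range
  antipode_mem : ∀ b ∈ B, HopfAlgebra.antipode k b ∈ B

namespace IsHopfSubalgebra

variable {B : Subalgebra k H} (hB : IsHopfSubalgebra B)

/-- The restricted comultiplication `B → B ⊗ B`. -/
def comulHom : B →ₐ[k] B ⊗[k] B :=
  (AlgEquiv.ofInjective (inclTensor B) (inclTensor_injective B)).symm.toAlgHom.comp
    (((Bialgebra.comulAlgHom k H).comp B.val).codRestrict _ fun b => hB.comul_mem b b.2)

theorem inclTensor_comulHom (b : B) :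
    inclTensor B (hB.comulHom b) = Coalgebra.comul (b : H) := by
  have := AlgEquiv.apply_symm_apply (AlgEquiv.ofInjective (inclTensor B) (inclTensor_injective B))
    ((((Bialgebra.comulAlgHom k H).comp B.val).codRestrict _ fun b => hB.comul_mem b b.2) b)
  exact congrArg Subtype.val this

/-- The restricted counit. -/
def counitHom : B →ₐ[k] k := (Bialgebra.counitAlgHom k H).comp B.val

/-- The restricted bialgebra structure. -/
@[reducible] def bialgebra : Bialgebra k B :=
  Bialgebra.ofAlgHom hB.comulHom (counitHom (B := B))
    (by
      have inj : Function.Injective (TensorProduct.map B.val.toLinearMap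
          (TensorProduct.map B.val.toLinearMap B.val.toLinearMap)) :=
        TensorProduct.map_injective_of_flat_flat _ _ Subtype.val_injective
          (inclTensor_injective B)
      apply AlgHom.ext
      intro b
      apply inj
      have e1 : ∀ z : B ⊗[k] B, TensorProduct.map B.val.toLinearMap
          (TensorProduct.map B.val.toLinearMap B.val.toLinearMap)
          (Algebra.TensorProduct.assoc k k k B B B
            (Algebra.TensorProduct.map hB.comulHom (.id k B) z))
          = TensorProduct.assoc k H H H
              ((Coalgebra.comul (R := k) (A := H)).rTensor H (inclTensor B z)) := by
        intro z
        induction z with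
        | zero => simp
        | add x y hx hy => simp only [map_add, hx, hy]
        | tmul x y =>
          have : (Coalgebra.comul (R := k) (A := H)).rTensor H (inclTensor B (x ⊗ₜ y))
              = inclTensor B (hB.comulHom x) ⊗ₜ (y : H) := by
            rw [inclTensor_comulHom]; simp [inclTensor]
          rw [this]
          simp only [Algebra.TensorProduct.map_tmul, AlgHom.coe_id, id_eq]
          generalize hB.comulHom x = w
          induction w with
          | zero => simp
          | add p q hp hq => simp only [TensorProduct.add_tmul, map_add, hp, hq]
          | tmul p q => simp [inclTensor]
      have e2 : ∀ z : B ⊗[k] B, TensorProduct.map B.val.toLinearMap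
          (TensorProduct.map B.val.toLinearMap B.val.toLinearMap)
            (Algebra.TensorProduct.map (.id k B) hB.comulHom z)
          = (Coalgebra.comul (R := k) (A := H)).lTensor H (inclTensor B z) := by
        intro z
        induction z with
        | zero => simp
        | add x y hx hy => simp only [map_add, hx, hy]
        | tmul x y =>
          have : (Coalgebra.comul (R := k) (A := H)).lTensor H (inclTensor B (x ⊗ₜ y))
              = (x : H) ⊗ₜ inclTensor B (hB.comulHom y) := by
            rw [inclTensor_comulHom]; simp [inclTensor]
          rw [this]
          simp only [Algebra.TensorProduct.map_tmul, AlgHom.coe_id, id_eq]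
          rfl
      refine (e1 (hB.comulHom b)).trans (Eq.trans ?_ (e2 (hB.comulHom b)).symm)
      rw [inclTensor_comulHom]
      exact Coalgebra.coassoc_apply (R := k) (b : H))
    (by
      apply AlgHom.ext
      intro b
      have inj : Function.Injective (TensorProduct.map (LinearMap.id (R := k) (M := k))
          B.val.toLinearMap) :=
        TensorProduct.map_injective_of_flat_flat _ _ Function.injective_id Subtype.val_injective
      apply inj
      have e1 : ∀ z : B ⊗[k] B, TensorProduct.map (LinearMap.id (R := k) (M := k))
          B.val.toLinearMap (Algebra.TensorProduct.map (counitHom (B := B)) (.id k B) z)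
          = (Coalgebra.counit (R := k) (A := H)).rTensor H (inclTensor B z) := by
        intro z
        induction z with
        | zero => simp
        | add x y hx hy => simp only [map_add, hx, hy]
        | tmul x y => simp [inclTensor, counitHom]
      refine (e1 (hB.comulHom b)).trans ?_
      rw [inclTensor_comulHom]
      simp)
    (by
      apply AlgHom.ext
      intro b
      have inj : Function.Injective (TensorProduct.map B.val.toLinearMap
          (LinearMap.id (R := k) (M := k))) :=
        TensorProduct.map_injective_of_flat_flat _ _ Subtype.val_injective Function.injective_id
      apply inj
      have e1 : ∀ z : B ⊗[k] B, TensorProduct.map B.val.toLinearMap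
          (LinearMap.id (R := k) (M := k))
            (Algebra.TensorProduct.map (.id k B) (counitHom (B := B)) z)
          = (Coalgebra.counit (R := k) (A := H)).lTensor H (inclTensor B z) := by
        intro z
        induction z with
        | zero => simp
        | add x y hx hy => simp only [map_add, hx, hy]
        | tmul x y => simp [inclTensor, counitHom]
      refine (e1 (hB.comulHom b)).trans ?_
      rw [inclTensor_comulHom]
      simp)

/-- The restricted antipode. -/
def antipodeLin : B →ₗ[k] B :=
  LinearMap.restrict (HopfAlgebra.antipode k (A := H)) (p := Subalgebra.toSubmodule B)
    (q := Subalgebra.toSubmodule B) hB.antipode_mem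

/-- The Hopf algebra structure of a Hopf subalgebra, by restriction. -/
@[reducible] def hopfAlgebra : HopfAlgebra k B :=
  { hB.bialgebra with
    antipode := hB.antipodeLin
    mul_antipode_rTensor_comul := by
      let _ := hB.bialgebra
      ext b
      have e1 : ∀ z : B ⊗[k] B, ((LinearMap.mul' k B (hB.antipodeLin.rTensor B z) : B) : H)
          = LinearMap.mul' k H ((HopfAlgebra.antipode k (A := H)).rTensor H (inclTensor B z)) := by
        intro z
        induction z with
        | zero => simp
        | add x y hx hy => simp only [map_add, Subalgebra.coe_add, hx, hy]
        | tmul x y => simp [inclTensor]; rfl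
      refine (e1 (hB.comulHom b)).trans ?_
      rw [inclTensor_comulHom]
      exact HopfAlgebra.mul_antipode_rTensor_comul_apply (R := k) (b : H)
    mul_antipode_lTensor_comul := by
      let _ := hB.bialgebra
      ext b
      have e1 : ∀ z : B ⊗[k] B, ((LinearMap.mul' k B (hB.antipodeLin.lTensor B z) : B) : H)
          = LinearMap.mul' k H ((HopfAlgebra.antipode k (A := H)).lTensor H (inclTensor B z)) := by
        intro z
        induction z with
        | zero => simp
        | add x y hx hy => simp only [map_add, Subalgebra.coe_add, hx, hy]
        | tmul x y => simp [inclTensor]; rfl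
      refine (e1 (hB.comulHom b)).trans ?_
      rw [inclTensor_comulHom]
      exact HopfAlgebra.mul_antipode_lTensor_comul_apply (R := k) (b : H) }

end IsHopfSubalgebra

end HopfSubalgebra


section Double

variable {k : Type*} [Field k] {Y X : Type*} [Ring Y] [HopfAlgebra k Y] [Ring X] [HopfAlgebra k X]

/-- The pairing `(y ⊗ y', x ⊗ x') = (y, x) (y', x')` induced on tensor squares. -/
def tensorPairing (φ : Y →ₗ[k] X →ₗ[k] k) : Y ⊗[k] Y →ₗ[k] X ⊗[k] X →ₗ[k] k :=
  TensorProduct.curry ((TensorProduct.lid k k).toLinearMap ∘ₗ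
    TensorProduct.map (TensorProduct.lift φ) (TensorProduct.lift φ) ∘ₗ
      (TensorProduct.tensorTensorTensorComm k Y Y X X).toLinearMap)

@[simp] theorem tensorPairing_tmul (φ : Y →ₗ[k] X →ₗ[k] k) (y y' : Y) (x x' : X) :
    tensorPairing φ (y ⊗ₜ y') (x ⊗ₜ x') = φ y x * φ y' x' := by
  simp [tensorPairing]

/-- A bilinear form `(,) : Y × X → k` is a skew pairing of Hopf algebras if
`(y, x x') = (Δ y, x' ⊗ x)`, `(y y', x) = (y ⊗ y', Δ x)`, `(y, 1) = ε y` and `(1, x) = ε x`. -/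
structure IsSkewPairing (φ : Y →ₗ[k] X →ₗ[k] k) : Prop where
  mul_right : ∀ (y : Y) (x x' : X),
    φ y (x * x') = tensorPairing φ (Coalgebra.comul y) (x' ⊗ₜ x)
  mul_left : ∀ (y y' : Y) (x : X),
    φ (y * y') x = tensorPairing φ (y ⊗ₜ y') (Coalgebra.comul x)
  one_right : ∀ y : Y, φ y 1 = Coalgebra.counit y
  one_left : ∀ x : X, φ 1 x = Coalgebra.counit x

/-- The underlying space `X ⊗ Y` of the Drinfeld double `𝒟(X, Y)` of two Hopf algebras with
respect to a pairing `φ : Y × X → k`. It carries the tensor product coalgebra structure; its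
product, unit and antipode are given below, by the standard formulas. (For a skew pairing these
operations make it a Hopf algebra.) -/
def DrinfeldDouble (_φ : Y →ₗ[k] X →ₗ[k] k) : Type _ := X ⊗[k] Y

namespace DrinfeldDouble

variable (φ : Y →ₗ[k] X →ₗ[k] k)

instance : AddCommGroup (DrinfeldDouble φ) := inferInstanceAs (AddCommGroup (X ⊗[k] Y))
instance : Module k (DrinfeldDouble φ) := inferInstanceAs (Module k (X ⊗[k] Y))
instance : Coalgebra k (DrinfeldDouble φ) := inferInstanceAs (Coalgebra k (X ⊗[k] Y))

/-- The pure tensor `x ⊗ y` as an element of the double. -/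
def tmul (x : X) (y : Y) : DrinfeldDouble φ := x ⊗ₜ[k] y

/-- `(y₁ ⊗ y₂ ⊗ y₃) ⊗ (x₁ ⊗ x₂ ⊗ x₃) ↦ (S y₁, x₁) (y₃, x₃) x₂ ⊗ y₂`. -/
def crossAux : (Y ⊗[k] (Y ⊗[k] Y)) ⊗[k] (X ⊗[k] (X ⊗[k] X)) →ₗ[k] X ⊗[k] Y :=
  (TensorProduct.lid k (X ⊗[k] Y)).toLinearMap ∘ₗ
    TensorProduct.map (TensorProduct.lift (φ ∘ₗ HopfAlgebra.antipode k))
      ((TensorProduct.rid k (X ⊗[k] Y)).toLinearMap ∘ₗ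
        TensorProduct.map (TensorProduct.comm k Y X).toLinearMap (TensorProduct.lift φ) ∘ₗ
          (TensorProduct.tensorTensorTensorComm k Y Y X X).toLinearMap) ∘ₗ
    (TensorProduct.tensorTensorTensorComm k Y (Y ⊗[k] Y) X (X ⊗[k] X)).toLinearMap

@[simp] theorem crossAux_tmul (y₁ y₂ y₃ : Y) (x₁ x₂ x₃ : X) :
    crossAux φ ((y₁ ⊗ₜ (y₂ ⊗ₜ y₃)) ⊗ₜ (x₁ ⊗ₜ (x₂ ⊗ₜ x₃))) =
      (φ (HopfAlgebra.antipode k y₁) x₁ * φ y₃ x₃) • (x₂ ⊗ₜ y₂) := by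
  simp [crossAux, smul_smul, mul_comm]

/-- The iterated comultiplication `a ↦ ∑ a₁ ⊗ (a₂ ⊗ a₃)`. -/
def comul₂ {A : Type*} [Ring A] [HopfAlgebra k A] : A →ₗ[k] A ⊗[k] (A ⊗[k] A) :=
  Coalgebra.comul.lTensor A ∘ₗ Coalgebra.comul

/-- The straightening map `y ⊗ x ↦ ∑ (S y₁, x₁) (y₃, x₃) x₂ ⊗ y₂`. -/
def cross : Y ⊗[k] X →ₗ[k] X ⊗[k] Y := crossAux φ ∘ₗ TensorProduct.map comul₂ comul₂

/-- The product of the Drinfeld double on pairs of tensors: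
`(x ⊗ y) (x' ⊗ y') = ∑ (S y₁, x'₁) (y₃, x'₃) x x'₂ ⊗ y₂ y'`. -/
def mulLin : (X ⊗[k] Y) ⊗[k] (X ⊗[k] Y) →ₗ[k] X ⊗[k] Y :=
  TensorProduct.map (LinearMap.mul' k X) (LinearMap.mul' k Y) ∘ₗ
    (TensorProduct.assoc k X X (Y ⊗[k] Y)).symm.toLinearMap ∘ₗ
    ((TensorProduct.assoc k X Y Y).toLinearMap ∘ₗ (cross φ).rTensor Y ∘ₗ
      (TensorProduct.assoc k Y X Y).symm.toLinearMap).lTensor X ∘ₗ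
    (TensorProduct.assoc k X Y (X ⊗[k] Y)).toLinearMap

theorem mulLin_tmul (x x' : X) (y y' : Y) :
    mulLin φ ((x ⊗ₜ y) ⊗ₜ (x' ⊗ₜ y')) =
      TensorProduct.map (LinearMap.mulLeft k x) (LinearMap.mulRight k y')
        (cross φ (y ⊗ₜ x')) := by
  simp only [mulLin, LinearMap.comp_apply, LinearEquiv.coe_coe, TensorProduct.assoc_tmul,
    LinearMap.lTensor_tmul, TensorProduct.assoc_symm_tmul, LinearMap.rTensor_tmul]
  generalize cross φ (y ⊗ₜ x') = z
  induction z with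
  | zero => simp
  | tmul a b => simp
  | add a b ha hb => simp only [TensorProduct.add_tmul, TensorProduct.tmul_add, map_add, ha, hb]

/-- The product of the Drinfeld double. -/
instance : Mul (DrinfeldDouble φ) := ⟨fun u v => mulLin φ (TensorProduct.tmul k u v)⟩

/-- The unit `1 ⊗ 1` of the Drinfeld double. -/
instance : One (DrinfeldDouble φ) := ⟨tmul φ 1 1⟩

/-- The antipode `S (x ⊗ y) = (1 ⊗ S y) (S x ⊗ 1)` of the Drinfeld double. -/
def antipode : DrinfeldDouble φ →ₗ[k] DrinfeldDouble φ :=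
  mulLin φ ∘ₗ TensorProduct.map (TensorProduct.mk k X Y 1 ∘ₗ HopfAlgebra.antipode k)
    ((TensorProduct.mk k X Y).flip 1 ∘ₗ HopfAlgebra.antipode k) ∘ₗ
    (TensorProduct.comm k X Y).toLinearMap

theorem antipode_tmul (x : X) (y : Y) :
    antipode φ (tmul φ x y) = tmul φ 1 (HopfAlgebra.antipode k y) *
      tmul φ (HopfAlgebra.antipode k x) 1 := rfl

/-- The product formula in Sweedler notation, for arbitrary expansions of the iterated
comultiplications. -/
theorem tmul_mul_tmul {ι κ : Type*} (s : Finset ι) (t : Finset κ) (x x' : X) (y y' : Y)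
    (y₁ y₂ y₃ : ι → Y) (x₁ x₂ x₃ : κ → X)
    (hy : comul₂ (k := k) y = ∑ i ∈ s, y₁ i ⊗ₜ (y₂ i ⊗ₜ y₃ i))
    (hx : comul₂ (k := k) x' = ∑ j ∈ t, x₁ j ⊗ₜ (x₂ j ⊗ₜ x₃ j)) :
    tmul φ x y * tmul φ x' y' = ∑ i ∈ s, ∑ j ∈ t,
      (φ (HopfAlgebra.antipode k (y₁ i)) (x₁ j) * φ (y₃ i) (x₃ j)) •
        tmul φ (x * x₂ j) (y₂ i * y') := by
  change mulLin φ ((x ⊗ₜ y) ⊗ₜ (x' ⊗ₜ y')) = _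
  rw [mulLin_tmul, cross, LinearMap.comp_apply, TensorProduct.map_tmul, hy, hx]
  simp only [TensorProduct.sum_tmul, TensorProduct.tmul_sum, map_sum, crossAux_tmul, map_smul,
    TensorProduct.map_tmul, LinearMap.mulLeft_apply, LinearMap.mulRight_apply]
  exact Finset.sum_comm

end DrinfeldDouble

end Double

section QuantumGroup

/-- A Cartan matrix `(a i j)` of finite type, indexed by a finite totally ordered set `I`, with
relatively prime positive integers `d i` such that `d i * a i j = d j * a j i`. -/
structure CartanDatum (I : Type*) [Fintype I] [LinearOrder I] where
  a : Matrix I I ℤ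
  d : I → ℕ
  diag : ∀ i, a i i = 2
  nonpos : ∀ i j, i ≠ j → a i j ≤ 0
  zero_symm : ∀ i j, a i j = 0 → a j i = 0
  d_pos : ∀ i, 0 < d i
  d_coprime : Finset.univ.gcd d = 1
  symm : ∀ i j, (d i : ℤ) * a i j = d j * a j i
  posDef : (Matrix.of fun i j => ((d i * a i j : ℤ) : ℝ)).PosDef

/-- The field `ℚ(r, s)` of rational functions in two variables. -/
def Krs : Type := FractionRing (MvPolynomial (Fin 2) ℚ)

instance : Field Krs := inferInstanceAs (Field (FractionRing (MvPolynomial (Fin 2) ℚ)))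

instance : Algebra (MvPolynomial (Fin 2) ℚ) Krs :=
  inferInstanceAs (Algebra (MvPolynomial (Fin 2) ℚ) (FractionRing (MvPolynomial (Fin 2) ℚ)))

instance : IsFractionRing (MvPolynomial (Fin 2) ℚ) Krs :=
  inferInstanceAs (IsFractionRing _ (FractionRing (MvPolynomial (Fin 2) ℚ)))

/-- The first variable. -/
def r : Krs := algebraMap (MvPolynomial (Fin 2) ℚ) Krs (MvPolynomial.X 0)

/-- The second variable. -/
def s : Krs := algebraMap (MvPolynomial (Fin 2) ℚ) Krs (MvPolynomial.X 1)

theorem r_ne_zero : r ≠ 0 :=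
  (map_ne_zero_iff _ (IsFractionRing.injective _ _)).2 (MvPolynomial.X_ne_zero 0)

theorem s_ne_zero : s ≠ 0 :=
  (map_ne_zero_iff _ (IsFractionRing.injective _ _)).2 (MvPolynomial.X_ne_zero 1)

theorem r_pow_ne (n : ℕ) : r ^ (n + 1) ≠ s ^ (n + 1) := by
  intro h
  rw [r, s, ← map_pow, ← map_pow] at h
  have h2 := IsFractionRing.injective (MvPolynomial (Fin 2) ℚ) Krs h
  have h3 := congrArg (MvPolynomial.eval (![2, 1] : Fin 2 → ℚ)) h2
  simp only [map_pow, MvPolynomial.eval_X, Matrix.cons_val_zero, Matrix.cons_val_one,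
    one_pow] at h3
  exact absurd h3 (one_lt_pow₀ (by norm_num) (by omega)).ne'

variable {I : Type*} [Fintype I] [LinearOrder I] (D : CartanDatum I)

namespace CartanDatum

/-- The Euler form on simple roots. -/
def euler (i j : I) : ℤ := if i < j then D.d i * D.a i j else if i = j then D.d i else 0

/-- The Euler form on the root lattice `Q = ⨁ ℤ αᵢ`. -/
def eulerQ (μ ν : I → ℤ) : ℤ := ∑ i, ∑ j, μ i * ν j * D.euler i j

/-- `r i = r ^ d i`. -/
def ri (i : I) : Krs := r ^ D.d i

/-- `s i = s ^ d i`. -/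
def si (i : I) : Krs := s ^ D.d i

/-- The exponent `1 - a i j` in the Serre relations (a natural number when `i ≠ j`). -/
def serreExp (i j : I) : ℕ := (1 - D.a i j).toNat

/-- The coefficient `c i j k` in the Serre relations. -/
def c (i j : I) (n : ℕ) : Krs :=
  (D.ri i * (D.si i)⁻¹) ^ (n * (n - 1) / 2) * r ^ (n * D.euler j i) * s ^ (-(n * D.euler i j))

end CartanDatum

/-- The generators `eᵢ, fᵢ, ωᵢ, ωᵢ⁻¹, ωᵢ', ωᵢ'⁻¹`. -/
inductive Gen (I : Type*) where
  | e (i : I)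
  | f (i : I)
  | w (i : I)
  | winv (i : I)
  | w' (i : I)
  | winv' (i : I)

section Relations

variable {A : Type*} [Ring A] [Algebra Krs A]

open Gen in
/-- The defining relations of the two-parameter quantum group, for a family `g` of elements of an
algebra indexed by the generators. The commutation relations that involve inverses of the `ωᵢ`,
`ωᵢ'` follow from those listed. -/
inductive Rel (g : Gen I → A) : A → A → Prop
  | w_w (i j : I) : Rel g (g (w i) * g (w j)) (g (w j) * g (w i))
  | w'_w' (i j : I) : Rel g (g (w' i) * g (w' j)) (g (w' j) * g (w' i))
  | w_w' (i j : I) : Rel g (g (w i) * g (w' j)) (g (w' j) * g (w i))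
  | w_winv (i : I) : Rel g (g (w i) * g (winv i)) 1
  | winv_w (i : I) : Rel g (g (winv i) * g (w i)) 1
  | w'_winv' (i : I) : Rel g (g (w' i) * g (winv' i)) 1
  | winv'_w' (i : I) : Rel g (g (winv' i) * g (w' i)) 1
  | w_e (i j : I) : Rel g (g (w i) * g (e j) * g (winv i))
      ((r ^ D.euler j i * s ^ (-D.euler i j)) • g (e j))
  | w'_e (i j : I) : Rel g (g (w' i) * g (e j) * g (winv' i))
      ((r ^ (-D.euler i j) * s ^ D.euler j i) • g (e j))
  | w_f (i j : I) : Rel g (g (w i) * g (f j) * g (winv i))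
      ((r ^ (-D.euler j i) * s ^ D.euler i j) • g (f j))
  | w'_f (i j : I) : Rel g (g (w' i) * g (f j) * g (winv' i))
      ((r ^ D.euler i j * s ^ (-D.euler j i)) • g (f j))
  | e_f (i j : I) : Rel g (g (e i) * g (f j) - g (f j) * g (e i))
      (if i = j then (D.ri i - D.si i)⁻¹ • (g (w i) - g (w' i)) else 0)
  | serre_e (i j : I) (h : i ≠ j) : Rel g (∑ n ∈ Finset.range (D.serreExp i j + 1),
      ((-1) ^ n * qBinom (D.ri i * (D.si i)⁻¹) (D.serreExp i j) n * D.c i j n) •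
        (g (e i) ^ (D.serreExp i j - n) * g (e j) * g (e i) ^ n)) 0
  | serre_f (i j : I) (h : i ≠ j) : Rel g (∑ n ∈ Finset.range (D.serreExp i j + 1),
      ((-1) ^ n * qBinom (D.ri i * (D.si i)⁻¹) (D.serreExp i j) n * D.c i j n) •
        (g (f i) ^ n * g (f j) * g (f i) ^ (D.serreExp i j - n))) 0

theorem Rel.map {B : Type*} [Ring B] [Algebra Krs B] (φ : A →ₐ[Krs] B) {g : Gen I → A} {x y : A}
    (h : Rel D g x y) : Rel D (φ ∘ g) (φ x) (φ y) := by
  cases h with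
  | w_w i j => simpa using Rel.w_w (D := D) (g := φ ∘ g) i j
  | w'_w' i j => simpa using Rel.w'_w' (D := D) (g := φ ∘ g) i j
  | w_w' i j => simpa using Rel.w_w' (D := D) (g := φ ∘ g) i j
  | w_winv i => simpa using Rel.w_winv (D := D) (g := φ ∘ g) i
  | winv_w i => simpa using Rel.winv_w (D := D) (g := φ ∘ g) i
  | w'_winv' i => simpa using Rel.w'_winv' (D := D) (g := φ ∘ g) i
  | winv'_w' i => simpa using Rel.winv'_w' (D := D) (g := φ ∘ g) i
  | w_e i j => simpa using Rel.w_e (D := D) (g := φ ∘ g) i j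
  | w'_e i j => simpa using Rel.w'_e (D := D) (g := φ ∘ g) i j
  | w_f i j => simpa using Rel.w_f (D := D) (g := φ ∘ g) i j
  | w'_f i j => simpa using Rel.w'_f (D := D) (g := φ ∘ g) i j
  | e_f i j =>
    have := Rel.e_f (D := D) (g := φ ∘ g) i j
    split_ifs at this ⊢ <;> simpa using this
  | serre_e i j h => simpa [map_sum] using Rel.serre_e (D := D) (g := φ ∘ g) i j h
  | serre_f i j h => simpa [map_sum] using Rel.serre_f (D := D) (g := φ ∘ g) i j h

end Relations

/-- The two-parameter quantum group `U_{r,s}(𝔤)`, presented by generators and relations. -/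
def U : Type _ := RingQuot (Rel D (FreeAlgebra.ι Krs))

namespace U

instance : Ring (U D) := inferInstanceAs (Ring (RingQuot (Rel D (FreeAlgebra.ι Krs))))

instance : Algebra Krs (U D) :=
  inferInstanceAs (Algebra Krs (RingQuot (Rel D (FreeAlgebra.ι Krs))))

/-- The quotient map from the free algebra. -/
def mk : FreeAlgebra Krs (Gen I) →ₐ[Krs] U D := RingQuot.mkAlgHom Krs (Rel D (FreeAlgebra.ι Krs))

/-- The generators of the quantum group. -/
def gen (x : Gen I) : U D := mk D (FreeAlgebra.ι Krs x)

theorem gen_rel {x y : U D} (h : Rel D (gen D) x y) : x = y := by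
  have key : ∀ {a b : FreeAlgebra Krs (Gen I)}, Rel D (FreeAlgebra.ι Krs) a b →
      mk D a = mk D b := fun h => RingQuot.mkAlgHom_rel Krs h
  cases h with
  | w_w i j => simpa [gen] using key (.w_w i j)
  | w'_w' i j => simpa [gen] using key (.w'_w' i j)
  | w_w' i j => simpa [gen] using key (.w_w' i j)
  | w_winv i => simpa [gen] using key (.w_winv i)
  | winv_w i => simpa [gen] using key (.winv_w i)
  | w'_winv' i => simpa [gen] using key (.w'_winv' i)
  | winv'_w' i => simpa [gen] using key (.winv'_w' i)
  | w_e i j => simpa [gen] using key (.w_e i j)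
  | w'_e i j => simpa [gen] using key (.w'_e i j)
  | w_f i j => simpa [gen] using key (.w_f i j)
  | w'_f i j => simpa [gen] using key (.w'_f i j)
  | e_f i j =>
    have := key (.e_f i j)
    split_ifs at this ⊢ <;> simpa [gen] using this
  | serre_e i j h => simpa [gen, map_sum] using key (.serre_e i j h)
  | serre_f i j h => simpa [gen, map_sum] using key (.serre_f i j h)

variable {A : Type*} [Ring A] [Algebra Krs A]

/-- The universal property of the presentation. -/
def lift (g : Gen I → A) (hg : ∀ x y, Rel D g x y → x = y) : U D →ₐ[Krs] A :=
  RingQuot.liftAlgHom Krs ⟨FreeAlgebra.lift Krs g, fun x y h => by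
    have := h.map D (FreeAlgebra.lift Krs g)
    rw [FreeAlgebra.ι_comp_lift] at this
    exact hg _ _ this⟩

@[simp] theorem lift_gen (g : Gen I → A) (hg : ∀ x y, Rel D g x y → x = y) (x : Gen I) :
    lift D g hg (gen D x) = g x := by
  have := RingQuot.liftAlgHom_mkAlgHom_apply (S := Krs) (FreeAlgebra.lift Krs g)
    (s := Rel D (FreeAlgebra.ι Krs)) (fun x y h => by
    have := h.map D (FreeAlgebra.lift Krs g)
    rw [FreeAlgebra.ι_comp_lift] at this
    exact hg _ _ this) (FreeAlgebra.ι Krs x)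
  rw [FreeAlgebra.lift_ι_apply] at this
  exact this

variable {D} in
theorem hom_ext {φ ψ : U D →ₐ[Krs] A} (h : ∀ x, φ (gen D x) = ψ (gen D x)) : φ = ψ :=
  RingQuot.ringQuot_ext' Krs _ _ (FreeAlgebra.hom_ext (funext h))

theorem adjoin_gen : Algebra.adjoin Krs (Set.range (gen D)) = ⊤ := by
  have h1 : (mk D).range = ⊤ :=
    (AlgHom.range_eq_top _).2 (RingQuot.mkAlgHom_surjective Krs (Rel D (FreeAlgebra.ι Krs)))
  rw [← h1, ← Algebra.map_top, ← FreeAlgebra.adjoin_range_ι, AlgHom.map_adjoin, ← Set.range_comp]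
  rfl

end U


section Structure

/-- The scalar with `ωᵢ eⱼ = χ i j • eⱼ ωᵢ`. -/
def chi (i j : I) : Krs := r ^ D.euler j i * s ^ (-D.euler i j)

theorem chi_ne_zero (i j : I) : chi D i j ≠ 0 :=
  mul_ne_zero (zpow_ne_zero _ r_ne_zero) (zpow_ne_zero _ s_ne_zero)

theorem chi_inv (i j : I) : (chi D i j)⁻¹ = r ^ (-D.euler j i) * s ^ D.euler i j := by
  rw [chi, mul_inv, ← zpow_neg, ← zpow_neg, neg_neg]

/-- The parameter `rᵢ sᵢ⁻¹` of the Gaussian binomials. -/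
def qi (i : I) : Krs := D.ri i * (D.si i)⁻¹

theorem qi_eq_zpow (i : I) : qi D i = r ^ (D.d i : ℤ) * s ^ (-(D.d i : ℤ)) := by
  rw [qi, CartanDatum.ri, CartanDatum.si, zpow_neg, zpow_natCast, zpow_natCast]

theorem chi_self (i : I) : chi D i i = qi D i := by
  rw [chi, qi_eq_zpow]; simp [CartanDatum.euler]

theorem qi_ne_zero (i : I) : qi D i ≠ 0 := chi_self D i ▸ chi_ne_zero D i i

theorem qi_pow_ne (i : I) (n : ℕ) : qi D i ^ (n + 1) ≠ 1 := by
  rw [qi, mul_pow, inv_pow]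
  intro h
  have h2 : D.ri i ^ (n + 1) = D.si i ^ (n + 1) := by
    have : D.si i ^ (n + 1) ≠ 0 := pow_ne_zero _ (pow_ne_zero _ s_ne_zero)
    field_simp at h
    exact h
  rw [CartanDatum.ri, CartanDatum.si, ← pow_mul, ← pow_mul] at h2
  obtain ⟨t, ht⟩ : ∃ t, D.d i * (n + 1) = t + 1 :=
    ⟨D.d i * (n + 1) - 1, by
      have : 0 < D.d i * (n + 1) := Nat.mul_pos (D.d_pos i) (Nat.succ_pos n)
      omega⟩
  rw [ht] at h2
  exact r_pow_ne t h2

theorem c_eq (i j : I) (n : ℕ) : D.c i j n = qi D i ^ (n * (n - 1) / 2) * chi D i j ^ n := by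
  rw [CartanDatum.c, qi, chi, mul_pow (r ^ _), ← zpow_natCast (r ^ _) n,
    ← zpow_natCast (s ^ _) n, ← zpow_mul, ← zpow_mul, mul_assoc]
  congr 3 <;> ring

theorem euler_add (i j : I) (h : i ≠ j) : D.euler i j + D.euler j i = D.d i * D.a i j := by
  rcases lt_trichotomy i j with h1 | h1 | h1
  · simp [CartanDatum.euler, h1, h1.not_gt, h.symm]
  · exact absurd h1 h
  · simp [CartanDatum.euler, h1, h1.not_gt, h, D.symm j i]

theorem chi_mul (i j : I) (h : i ≠ j) :
    qi D i ^ (D.serreExp i j - 1) * chi D i j * chi D j i = 1 := by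
  have h1 : ((D.serreExp i j - 1 : ℕ) : ℤ) = -D.a i j := by
    have := D.nonpos i j h
    rw [CartanDatum.serreExp]; omega
  have h2 := euler_add D i j h
  rw [← zpow_natCast, h1, qi_eq_zpow, chi, chi, mul_zpow, ← zpow_mul, ← zpow_mul]
  calc _ = (r ^ ((D.d i : ℤ) * -D.a i j) * r ^ D.euler j i * r ^ D.euler i j) *
        (s ^ (-(D.d i : ℤ) * -D.a i j) * s ^ (-D.euler i j) * s ^ (-D.euler j i)) := by ring
    _ = 1 := by
      rw [← zpow_add₀ r_ne_zero, ← zpow_add₀ r_ne_zero, ← zpow_add₀ s_ne_zero,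
        ← zpow_add₀ s_ne_zero]
      have e1 : (D.d i : ℤ) * -D.a i j + D.euler j i + D.euler i j = 0 := by linarith
      have e2 : -(D.d i : ℤ) * -D.a i j + -D.euler i j + -D.euler j i = 0 := by linarith
      rw [e1, e2]; simp

theorem comm_of_conj {k A : Type*} [Field k] [Ring A] [Algebra k A] {c : k} {w x v : A}
    (hv : v * w = 1) (h : w * x * v = c • x) : w * x = c • (x * w) := by
  rw [← smul_mul_assoc, ← h, mul_assoc, hv, mul_one]

theorem comm_inv_of_comm {k A : Type*} [Field k] [Ring A] [Algebra k A] {c : k} {w x v : A}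
    (hv : v * w = 1) (hv' : w * v = 1) (h : w * x = c • (x * w)) : x * v = c • (v * x) := by
  calc x * v = v * (w * x) * v := by rw [← mul_assoc, hv, one_mul]
    _ = c • (v * x) := by
      rw [h, mul_smul_comm, smul_mul_assoc, mul_assoc, mul_assoc, hv', mul_one]

theorem inv_half_comm {A : Type*} [Ring A] {w w' v : A} (h : w * w' = w' * w)
    (h1 : v * w = 1) (h2 : w * v = 1) : v * w' = w' * v := by
  calc v * w' = v * (w' * w) * v := by rw [mul_assoc, mul_assoc, h2, mul_one]
    _ = w' * v := by rw [← h, ← mul_assoc v, h1, one_mul]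

/-- Inverses of commuting elements commute. -/
theorem inv_comm_of_comm {A : Type*} [Ring A] {w w' v v' : A} (h : w * w' = w' * w)
    (h1 : v * w = 1) (h2 : w * v = 1) (h3 : v' * w' = 1) (h4 : w' * v' = 1) :
    v * v' = v' * v := by
  have e : w' * v = v * w' := by
    calc w' * v = v * (w * w') * v := by rw [← mul_assoc, h1, one_mul]
      _ = v * w' := by rw [h, mul_assoc, mul_assoc, h2, mul_one]
  calc v * v' = v' * (w' * v) * v' := by rw [← mul_assoc, h3, one_mul]
    _ = v' * v := by rw [e, mul_assoc, mul_assoc, h4, mul_one]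

section Family

variable {A : Type*} [Ring A] [Algebra Krs A] {D} {g : Gen I → A}

theorem serre_e_iff (i j : I) : (∑ n ∈ Finset.range (D.serreExp i j + 1),
      ((-1) ^ n * qBinom (D.ri i * (D.si i)⁻¹) (D.serreExp i j) n * D.c i j n) •
        (g (.e i) ^ (D.serreExp i j - n) * g (.e j) * g (.e i) ^ n)) =
    serreL (qi D i) (chi D i j) (D.serreExp i j) (g (.e i)) (g (.e j)) := by
  simp only [c_eq, serreL]; rfl

theorem serre_f_iff (i j : I) : (∑ n ∈ Finset.range (D.serreExp i j + 1),
      ((-1) ^ n * qBinom (D.ri i * (D.si i)⁻¹) (D.serreExp i j) n * D.c i j n) •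
        (g (.f i) ^ n * g (.f j) * g (.f i) ^ (D.serreExp i j - n))) =
    serreR (qi D i) (chi D i j) (D.serreExp i j) (g (.f i)) (g (.f j)) := by
  simp only [c_eq, serreR]; rfl

end Family


namespace U

theorem serre_e (i j : I) (h : i ≠ j) :
    serreL (qi D i) (chi D i j) (D.serreExp i j) (gen D (.e i)) (gen D (.e j)) = 0 := by
  rw [← serre_e_iff]; exact gen_rel D (.serre_e i j h)

theorem serre_f (i j : I) (h : i ≠ j) :
    serreR (qi D i) (chi D i j) (D.serreExp i j) (gen D (.f i)) (gen D (.f j)) = 0 := by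
  rw [← serre_f_iff]; exact gen_rel D (.serre_f i j h)

theorem w_winv (i : I) : gen D (.w i) * gen D (.winv i) = 1 := gen_rel D (.w_winv i)
theorem winv_w (i : I) : gen D (.winv i) * gen D (.w i) = 1 := gen_rel D (.winv_w i)
theorem w'_winv' (i : I) : gen D (.w' i) * gen D (.winv' i) = 1 := gen_rel D (.w'_winv' i)
theorem winv'_w' (i : I) : gen D (.winv' i) * gen D (.w' i) = 1 := gen_rel D (.winv'_w' i)

theorem w_w (i j : I) : gen D (.w i) * gen D (.w j) = gen D (.w j) * gen D (.w i) :=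
  gen_rel D (.w_w i j)
theorem w'_w' (i j : I) : gen D (.w' i) * gen D (.w' j) = gen D (.w' j) * gen D (.w' i) :=
  gen_rel D (.w'_w' i j)
theorem w_w' (i j : I) : gen D (.w i) * gen D (.w' j) = gen D (.w' j) * gen D (.w i) :=
  gen_rel D (.w_w' i j)

theorem winv_winv (i j : I) :
    gen D (.winv i) * gen D (.winv j) = gen D (.winv j) * gen D (.winv i) :=
  inv_comm_of_comm (w_w D i j) (winv_w D i) (w_winv D i) (winv_w D j) (w_winv D j)
theorem winv'_winv' (i j : I) :
    gen D (.winv' i) * gen D (.winv' j) = gen D (.winv' j) * gen D (.winv' i) :=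
  inv_comm_of_comm (w'_w' D i j) (winv'_w' D i) (w'_winv' D i) (winv'_w' D j) (w'_winv' D j)
theorem winv_winv' (i j : I) :
    gen D (.winv i) * gen D (.winv' j) = gen D (.winv' j) * gen D (.winv i) :=
  inv_comm_of_comm (w_w' D i j) (winv_w D i) (w_winv D i) (winv'_w' D j) (w'_winv' D j)

theorem w_e (i j : I) :
    gen D (.w i) * gen D (.e j) = chi D i j • (gen D (.e j) * gen D (.w i)) :=
  comm_of_conj (winv_w D i) (gen_rel D (.w_e i j))

theorem w'_e (i j : I) :
    gen D (.w' i) * gen D (.e j) = (chi D j i)⁻¹ • (gen D (.e j) * gen D (.w' i)) :=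
  comm_of_conj (winv'_w' D i) (by rw [chi_inv]; exact gen_rel D (.w'_e i j))

theorem w_f (i j : I) :
    gen D (.w i) * gen D (.f j) = (chi D i j)⁻¹ • (gen D (.f j) * gen D (.w i)) :=
  comm_of_conj (winv_w D i) (by rw [chi_inv]; exact gen_rel D (.w_f i j))

theorem w'_f (i j : I) :
    gen D (.w' i) * gen D (.f j) = chi D j i • (gen D (.f j) * gen D (.w' i)) :=
  comm_of_conj (winv'_w' D i) (gen_rel D (.w'_f i j))

theorem e_winv (i j : I) :
    gen D (.e j) * gen D (.winv i) = chi D i j • (gen D (.winv i) * gen D (.e j)) :=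
  comm_inv_of_comm (winv_w D i) (w_winv D i) (w_e D i j)

theorem e_winv' (i j : I) :
    gen D (.e j) * gen D (.winv' i) = (chi D j i)⁻¹ • (gen D (.winv' i) * gen D (.e j)) :=
  comm_inv_of_comm (winv'_w' D i) (w'_winv' D i) (w'_e D i j)

theorem f_winv (i j : I) :
    gen D (.f j) * gen D (.winv i) = (chi D i j)⁻¹ • (gen D (.winv i) * gen D (.f j)) :=
  comm_inv_of_comm (winv_w D i) (w_winv D i) (w_f D i j)

theorem f_winv' (i j : I) :
    gen D (.f j) * gen D (.winv' i) = chi D j i • (gen D (.winv' i) * gen D (.f j)) :=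
  comm_inv_of_comm (winv'_w' D i) (w'_winv' D i) (w'_f D i j)

theorem e_f_same (i : I) : gen D (.e i) * gen D (.f i) - gen D (.f i) * gen D (.e i) =
    (D.ri i - D.si i)⁻¹ • (gen D (.w i) - gen D (.w' i)) := by
  simpa using gen_rel D (.e_f i i)

theorem e_f_ne (i j : I) (h : i ≠ j) :
    gen D (.e i) * gen D (.f j) - gen D (.f j) * gen D (.e i) = 0 := by
  simpa [h] using gen_rel D (.e_f i j)

/-- The comultiplication on generators. -/
def comulGen : Gen I → U D ⊗[Krs] U D
  | .e i => gen D (.e i) ⊗ₜ 1 + gen D (.w i) ⊗ₜ gen D (.e i)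
  | .f i => 1 ⊗ₜ gen D (.f i) + gen D (.f i) ⊗ₜ gen D (.w' i)
  | .w i => gen D (.w i) ⊗ₜ gen D (.w i)
  | .winv i => gen D (.winv i) ⊗ₜ gen D (.winv i)
  | .w' i => gen D (.w' i) ⊗ₜ gen D (.w' i)
  | .winv' i => gen D (.winv' i) ⊗ₜ gen D (.winv' i)

/-- The counit on generators. -/
def counitGen : Gen I → Krs
  | .e _ => 0
  | .f _ => 0
  | .w _ => 1
  | .winv _ => 1
  | .w' _ => 1
  | .winv' _ => 1

/-- The antipode on generators, as elements of the opposite algebra. -/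
def antipodeGen : Gen I → (U D)ᵐᵒᵖ
  | .e i => MulOpposite.op (-(gen D (.winv i) * gen D (.e i)))
  | .f i => MulOpposite.op (-(gen D (.f i) * gen D (.winv' i)))
  | .w i => MulOpposite.op (gen D (.winv i))
  | .winv i => MulOpposite.op (gen D (.w i))
  | .w' i => MulOpposite.op (gen D (.winv' i))
  | .winv' i => MulOpposite.op (gen D (.w' i))

theorem counit_rel : ∀ x y, Rel D (counitGen (I := I)) x y → x = y := by
  intro x y h
  cases h with
  | serre_e i j h => simp [counitGen]
  | serre_f i j h => simp [counitGen]
  | w_e i j => simp [counitGen]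
  | w'_e i j => simp [counitGen]
  | w_f i j => simp [counitGen]
  | w'_f i j => simp [counitGen]
  | e_f i j => simp [counitGen]
  | _ => simp [counitGen]

/-- Tensor products of words of the form `ω^(m-j) ω' ω^j ⊗ x^(m-j) y x^j`. -/
theorem serreL_tmul_left {k B : Type*} [Field k] [Ring B] [Algebra k B] (q χ : k) (m : ℕ)
    {u v x y : B} (huv : u * v = v * u) (h : serreL q χ m x y = 0) :
    serreL q χ m (u ⊗ₜ[k] x) (v ⊗ₜ[k] y) = 0 := by
  have : serreL q χ m (u ⊗ₜ[k] x) (v ⊗ₜ[k] y) = (u ^ m * v) ⊗ₜ[k] serreL q χ m x y := by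
    rw [serreL, serreL, TensorProduct.tmul_sum]
    refine Finset.sum_congr rfl fun j hj => ?_
    have hj' : m = (m - j) + j := by have := Finset.mem_range.1 hj; omega
    rw [TensorProduct.tmul_smul]
    simp only [Algebra.TensorProduct.tmul_pow, Algebra.TensorProduct.tmul_mul_tmul]
    congr 2
    have hc : v * u ^ j = u ^ j * v := ((Commute.pow_left huv j).eq).symm
    rw [mul_assoc, hc, ← mul_assoc, ← pow_add, ← hj']
  rw [this, h, TensorProduct.tmul_zero]

theorem serreR_tmul_right {k B : Type*} [Field k] [Ring B] [Algebra k B] (q χ : k) (m : ℕ)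
    {u v x y : B} (huv : u * v = v * u) (h : serreR q χ m x y = 0) :
    serreR q χ m (x ⊗ₜ[k] u) (y ⊗ₜ[k] v) = 0 := by
  have : serreR q χ m (x ⊗ₜ[k] u) (y ⊗ₜ[k] v) = serreR q χ m x y ⊗ₜ[k] (u ^ m * v) := by
    rw [serreR, serreR, TensorProduct.sum_tmul]
    refine Finset.sum_congr rfl fun j hj => ?_
    have hj' : m = j + (m - j) := by have := Finset.mem_range.1 hj; omega
    rw [← TensorProduct.smul_tmul']
    simp only [Algebra.TensorProduct.tmul_pow, Algebra.TensorProduct.tmul_mul_tmul]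
    congr 2
    have hc : v * u ^ (m - j) = u ^ (m - j) * v := ((Commute.pow_left huv _).eq).symm
    rw [mul_assoc, hc, ← mul_assoc, ← pow_add, ← hj']
  rw [this, h, TensorProduct.zero_tmul]

open Algebra.TensorProduct in
theorem comul_rel : ∀ x y, Rel D (comulGen D) x y → x = y := by
  intro x y h
  cases h with
  | w_w i j => simp only [comulGen, tmul_mul_tmul, w_w D i j]
  | w'_w' i j => simp only [comulGen, tmul_mul_tmul, w'_w' D i j]
  | w_w' i j => simp only [comulGen, tmul_mul_tmul, w_w' D i j]
  | w_winv i => simp only [comulGen, tmul_mul_tmul, w_winv D i, one_def]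
  | winv_w i => simp only [comulGen, tmul_mul_tmul, winv_w D i, one_def]
  | w'_winv' i => simp only [comulGen, tmul_mul_tmul, w'_winv' D i, one_def]
  | winv'_w' i => simp only [comulGen, tmul_mul_tmul, winv'_w' D i, one_def]
  | w_e i j =>
    simp only [comulGen, tmul_mul_tmul, mul_add, add_mul, mul_one, w_winv, w_w D i j]
    rw [mul_assoc (gen D (.w j)), w_winv, mul_one, gen_rel D (.w_e i j)]
    simp only [TensorProduct.smul_tmul', TensorProduct.tmul_smul, smul_add]
  | w'_e i j =>
    simp only [comulGen, tmul_mul_tmul, mul_add, add_mul, mul_one, w'_winv', ← w_w' D j i]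
    rw [mul_assoc (gen D (.w j)), w'_winv', mul_one, gen_rel D (.w'_e i j)]
    simp only [TensorProduct.smul_tmul', TensorProduct.tmul_smul, smul_add]
  | w_f i j =>
    simp only [comulGen, tmul_mul_tmul, mul_add, add_mul, mul_one, w_winv, w_w' D i j]
    rw [mul_assoc (gen D (.w' j)), w_winv, mul_one, gen_rel D (.w_f i j)]
    simp only [TensorProduct.smul_tmul', TensorProduct.tmul_smul, smul_add]
  | w'_f i j =>
    simp only [comulGen, tmul_mul_tmul, mul_add, add_mul, mul_one, w'_winv', w'_w' D i j]
    rw [mul_assoc (gen D (.w' j)), w'_winv', mul_one, gen_rel D (.w'_f i j)]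
    simp only [TensorProduct.smul_tmul', TensorProduct.tmul_smul, smul_add]
  | e_f i j =>
    have h1 : (comulGen D (.e i) * comulGen D (.f j) - comulGen D (.f j) * comulGen D (.e i)) =
        (gen D (.e i) * gen D (.f j) - gen D (.f j) * gen D (.e i)) ⊗ₜ gen D (.w' j) +
        gen D (.w i) ⊗ₜ (gen D (.e i) * gen D (.f j) - gen D (.f j) * gen D (.e i)) := by
      simp only [comulGen, tmul_mul_tmul, mul_add, add_mul, mul_one, one_mul, w_f D i j,
        w'_e D j i, TensorProduct.smul_tmul', TensorProduct.tmul_smul,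
        TensorProduct.sub_tmul, TensorProduct.tmul_sub]
      abel
    rw [h1]
    split_ifs with hij
    · subst hij
      rw [e_f_same]
      simp only [comulGen, ← TensorProduct.smul_tmul', TensorProduct.tmul_smul,
        TensorProduct.sub_tmul, TensorProduct.tmul_sub, ← smul_add]
      congr 1; abel
    · rw [e_f_ne D i j hij]; simp
  | serre_e i j h =>
    rw [serre_e_iff]
    refine serreL_add_eq_zero (qi_pow_ne D i) _ (chi_mul D i j h) ?_ ?_ ?_ ?_ ?_
    · simp only [tmul_mul_tmul, mul_one, one_mul, w_e D i i, chi_self,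
        TensorProduct.smul_tmul']
    · simp only [tmul_mul_tmul, mul_one, one_mul, w_e D i j, TensorProduct.smul_tmul']
    · simp only [tmul_mul_tmul, mul_one, one_mul, w_e D j i, TensorProduct.smul_tmul']
    · have := map_serreL (includeLeft : U D →ₐ[Krs] U D ⊗[Krs] U D) (qi D i) (chi D i j)
        (D.serreExp i j) (gen D (.e i)) (gen D (.e j))
      rw [serre_e D i j h, map_zero] at this
      exact this.symm
    · exact serreL_tmul_left _ _ _ (w_w D i j) (serre_e D i j h)
  | serre_f i j h =>
    rw [serre_f_iff]
    apply MulOpposite.op_injective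
    rw [op_serreR, MulOpposite.op_zero]
    simp only [comulGen, MulOpposite.op_add]
    rw [add_comm (MulOpposite.op (1 ⊗ₜ[Krs] gen D (.f i))),
      add_comm (MulOpposite.op (1 ⊗ₜ[Krs] gen D (.f j)))]
    refine serreL_add_eq_zero (qi_pow_ne D i) _ (chi_mul D i j h) ?_ ?_ ?_ ?_ ?_
    · simp only [← MulOpposite.op_mul, tmul_mul_tmul, mul_one, one_mul, w'_f D i i, chi_self,
        TensorProduct.tmul_smul, MulOpposite.op_smul]
    · simp only [← MulOpposite.op_mul, tmul_mul_tmul, mul_one, one_mul, w'_f D j i,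
        TensorProduct.tmul_smul, MulOpposite.op_smul]
    · simp only [← MulOpposite.op_mul, tmul_mul_tmul, mul_one, one_mul, w'_f D i j,
        TensorProduct.tmul_smul, MulOpposite.op_smul]
    · rw [← op_serreR, serreR_tmul_right _ _ _ (w'_w' D i j) (serre_f D i j h),
        MulOpposite.op_zero]
    · rw [← op_serreR]
      have := map_serreR (includeRight : U D →ₐ[Krs] U D ⊗[Krs] U D) (qi D i) (chi D i j)
        (D.serreExp i j) (gen D (.f i)) (gen D (.f j))
      rw [serre_f D i j h, map_zero] at this
      rw [MulOpposite.op_eq_zero_iff]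
      exact this.symm

theorem antipode_rel : ∀ x y, Rel D (antipodeGen D) x y → x = y := by
  intro x y h
  apply MulOpposite.unop_injective
  cases h with
  | w_w i j => simpa [antipodeGen] using winv_winv D j i
  | w'_w' i j => simpa [antipodeGen] using winv'_winv' D j i
  | w_w' i j => simpa [antipodeGen] using (winv_winv' D i j).symm
  | w_winv i => simpa [antipodeGen] using w_winv D i
  | winv_w i => simpa [antipodeGen] using winv_w D i
  | w'_winv' i => simpa [antipodeGen] using w'_winv' D i
  | winv'_w' i => simpa [antipodeGen] using winv'_w' D i
  | w_e i j =>
    have h1 := gen_rel D (.w_e i j)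
    have h2 : gen D (.winv j) * gen D (.w i) = gen D (.w i) * gen D (.winv j) :=
      inv_half_comm (w_w D j i) (winv_w D j) (w_winv D j)
    simp only [antipodeGen, MulOpposite.unop_mul, MulOpposite.unop_op, MulOpposite.unop_smul,
      mul_neg, neg_mul, smul_neg, neg_inj]
    rw [← mul_smul_comm, ← h1]
    simp only [← mul_assoc, h2]
  | w'_e i j =>
    have h1 := gen_rel D (.w'_e i j)
    have h2 : gen D (.winv j) * gen D (.w' i) = gen D (.w' i) * gen D (.winv j) :=
      inv_half_comm (w_w' D j i) (winv_w D j) (w_winv D j)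
    simp only [antipodeGen, MulOpposite.unop_mul, MulOpposite.unop_op, MulOpposite.unop_smul,
      mul_neg, neg_mul, smul_neg, neg_inj]
    rw [← mul_smul_comm, ← h1]
    simp only [← mul_assoc, h2]
  | w_f i j =>
    have h1 := gen_rel D (.w_f i j)
    simp only [antipodeGen, MulOpposite.unop_mul, MulOpposite.unop_op, MulOpposite.unop_smul,
      mul_neg, neg_mul, smul_neg, neg_inj]
    rw [← smul_mul_assoc, ← h1]
    simp only [mul_assoc, winv_winv' D i j]
  | w'_f i j =>
    have h1 := gen_rel D (.w'_f i j)
    simp only [antipodeGen, MulOpposite.unop_mul, MulOpposite.unop_op, MulOpposite.unop_smul,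
      mul_neg, neg_mul, smul_neg, neg_inj]
    rw [← smul_mul_assoc, ← h1]
    simp only [mul_assoc, winv'_winv' D i j]
  | e_f i j =>
    have key : gen D (.f j) * gen D (.winv' j) * (gen D (.winv i) * gen D (.e i)) =
        gen D (.winv i) * (gen D (.f j) * gen D (.e i)) * gen D (.winv' j) := by
      have h1 : gen D (.winv' j) * gen D (.e i) =
          chi D i j • (gen D (.e i) * gen D (.winv' j)) := by
        rw [e_winv', smul_inv_smul₀ (chi_ne_zero D i j)]
      calc _ = gen D (.f j) * (gen D (.winv' j) * gen D (.winv i)) * gen D (.e i) := by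
            simp only [mul_assoc]
        _ = gen D (.f j) * gen D (.winv i) * (gen D (.winv' j) * gen D (.e i)) := by
            rw [← winv_winv']; simp only [mul_assoc]
        _ = _ := by
            rw [f_winv, h1, mul_smul_comm, smul_mul_assoc, smul_inv_smul₀ (chi_ne_zero D i j)]
            simp only [mul_assoc]
    have h2 : (antipodeGen D (.e i) * antipodeGen D (.f j) -
        antipodeGen D (.f j) * antipodeGen D (.e i)).unop =
        -(gen D (.winv i) * (gen D (.e i) * gen D (.f j) - gen D (.f j) * gen D (.e i)) *
          gen D (.winv' j)) := by
      simp only [antipodeGen, MulOpposite.unop_sub, MulOpposite.unop_mul, MulOpposite.unop_op,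
        neg_mul_neg]
      rw [key, mul_sub, sub_mul]
      simp only [mul_assoc]
      abel
    rw [h2]
    split_ifs with hij
    · subst hij
      rw [e_f_same, mul_smul_comm, smul_mul_assoc, mul_sub, winv_w, sub_mul, one_mul, mul_assoc,
        w'_winv', mul_one]
      simp only [antipodeGen, MulOpposite.unop_sub, MulOpposite.unop_smul, MulOpposite.unop_op]
      rw [← smul_neg, neg_sub]
    · rw [e_f_ne D i j hij]; simp
  | serre_e i j h =>
    rw [serre_e_iff]
    have h0 := serreR_antipode (qi_pow_ne D i) (D.serreExp i j) (α := qi D i) (β := chi D j i)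
      (γ := chi D i j) (χ := chi D i j) (x := gen D (.e i)) (y := gen D (.e j))
      (u := gen D (.winv i)) (v := gen D (.winv j))
      (by linear_combination (-chi D i j) * chi_mul D i j h) (winv_winv D i j)
      (by rw [e_winv, chi_self]) (e_winv D j i) (e_winv D i j) (serre_e D i j h)
    have h1 := congrArg MulOpposite.op h0
    rw [op_serreR] at h1
    exact congrArg MulOpposite.unop h1
  | serre_f i j h =>
    rw [serre_f_iff]
    have hc := chi_mul D i j h
    have hf := congrArg MulOpposite.op (serre_f D i j h)
    rw [op_serreR, MulOpposite.op_zero] at hf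
    have h0 := serreR_antipode (qi_pow_ne D i) (D.serreExp i j) (α := (qi D i)⁻¹)
      (β := (chi D i j)⁻¹) (γ := (chi D j i)⁻¹) (χ := chi D i j)
      (x := MulOpposite.op (gen D (.f i))) (y := MulOpposite.op (gen D (.f j)))
      (u := MulOpposite.op (gen D (.winv' i))) (v := MulOpposite.op (gen D (.winv' j)))
      (by
        have h1 := chi_ne_zero D i j
        have h2 := chi_ne_zero D j i
        field_simp
        linear_combination -hc)
      (by rw [← MulOpposite.op_mul, ← MulOpposite.op_mul, winv'_winv'])
      (by
        rw [← MulOpposite.op_mul, ← MulOpposite.op_mul, ← MulOpposite.op_smul, f_winv', chi_self,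
          inv_smul_smul₀ (qi_ne_zero D i)])
      (by
        rw [← MulOpposite.op_mul, ← MulOpposite.op_mul, ← MulOpposite.op_smul, f_winv',
          inv_smul_smul₀ (chi_ne_zero D i j)])
      (by
        rw [← MulOpposite.op_mul, ← MulOpposite.op_mul, ← MulOpposite.op_smul, f_winv',
          inv_smul_smul₀ (chi_ne_zero D j i)]) hf
    exact congrArg MulOpposite.unop h0

/-- The comultiplication. -/
def comulHom : U D →ₐ[Krs] U D ⊗[Krs] U D := lift D (comulGen D) (comul_rel D)

/-- The counit. -/
def counitHom : U D →ₐ[Krs] Krs := lift D counitGen (counit_rel D)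

/-- The antipode, as a homomorphism to the opposite algebra. -/
def antipodeHom : U D →ₐ[Krs] (U D)ᵐᵒᵖ := lift D (antipodeGen D) (antipode_rel D)

instance : Bialgebra Krs (U D) :=
  Bialgebra.ofAlgHom (comulHom D) (counitHom D)
    (hom_ext fun x => by
      cases x <;> simp [comulHom, comulGen, Algebra.TensorProduct.one_def, TensorProduct.add_tmul,
        TensorProduct.tmul_add, add_assoc])
    (hom_ext fun x => by
      cases x <;> simp [comulHom, comulGen, counitHom, counitGen])
    (hom_ext fun x => by
      cases x <;> simp [comulHom, comulGen, counitHom, counitGen])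

theorem comul_gen (x : Gen I) : Coalgebra.comul (R := Krs) (gen D x) = comulGen D x :=
  lift_gen D _ (comul_rel D) x

theorem counit_gen (x : Gen I) : Coalgebra.counit (R := Krs) (gen D x) = counitGen x :=
  lift_gen D _ (counit_rel D) x

/-- The Hopf algebra structure of the two-parameter quantum group. -/
instance : HopfAlgebra Krs (U D) :=
  hopfOfGenerators (antipodeHom D) (Set.range (gen D)) (adjoin_gen D)
    (by
      rintro _ ⟨x, rfl⟩
      rw [comul_gen, counit_gen]
      cases x <;> simp [comulGen, counitGen, antipodeHom, antipodeGen, w_winv, winv_w,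
        w'_winv', winv'_w', mul_assoc])
    (by
      rintro _ ⟨x, rfl⟩
      rw [comul_gen, counit_gen]
      cases x <;> simp [comulGen, counitGen, antipodeHom, antipodeGen, w_winv, winv_w,
        w'_winv', winv'_w', ← mul_assoc])

theorem antipode_gen (x : Gen I) :
    HopfAlgebra.antipode Krs (gen D x) = (antipodeGen D x).unop :=
  congrArg MulOpposite.unop (lift_gen D _ (antipode_rel D) x)

theorem antipode_mul (x y : U D) : HopfAlgebra.antipode Krs (x * y) =
    HopfAlgebra.antipode Krs y * HopfAlgebra.antipode Krs x :=
  congrArg MulOpposite.unop (map_mul (antipodeHom D) x y)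

theorem antipode_algebraMap (c : Krs) :
    HopfAlgebra.antipode Krs (algebraMap Krs (U D) c) = algebraMap Krs (U D) c :=
  congrArg MulOpposite.unop ((antipodeHom D).commutes c)

/-- A subalgebra generated by elements on which `Δ` and `S` restrict is a Hopf subalgebra. -/
theorem isHopfSubalgebra_adjoin (t : Set (U D))
    (h1 : ∀ x ∈ t, Coalgebra.comul (R := Krs) x ∈ (inclTensor (Algebra.adjoin Krs t)).range)
    (h2 : ∀ x ∈ t, HopfAlgebra.antipode Krs x ∈ Algebra.adjoin Krs t) :
    IsHopfSubalgebra (Algebra.adjoin Krs t) where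
  comul_mem b hb := by
    induction hb using Algebra.adjoin_induction with
    | mem x hx => exact h1 x hx
    | algebraMap c => rw [Bialgebra.comul_algebraMap]; exact Subalgebra.algebraMap_mem _ c
    | add x y _ _ hx hy => rw [map_add]; exact Subalgebra.add_mem _ hx hy
    | mul x y _ _ hx hy => rw [Bialgebra.comul_mul]; exact Subalgebra.mul_mem _ hx hy
  antipode_mem b hb := by
    induction hb using Algebra.adjoin_induction with
    | mem x hx => exact h2 x hx
    | algebraMap c => rw [antipode_algebraMap]; exact Subalgebra.algebraMap_mem _ c
    | add x y _ _ hx hy => rw [map_add]; exact Subalgebra.add_mem _ hx hy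
    | mul x y _ _ hx hy => rw [antipode_mul]; exact Subalgebra.mul_mem _ hy hx

theorem tmul_mem_range {B : Subalgebra Krs (U D)} {x y : U D} (hx : x ∈ B) (hy : y ∈ B) :
    x ⊗ₜ[Krs] y ∈ (inclTensor B).range := ⟨⟨x, hx⟩ ⊗ₜ ⟨y, hy⟩, rfl⟩

/-- `U^{≥0}`: the subalgebra generated by the `eᵢ` and `ωᵢ^{±1}`. -/
def geq : Subalgebra Krs (U D) :=
  Algebra.adjoin Krs (⋃ i, {gen D (.e i), gen D (.w i), gen D (.winv i)})

/-- `U^{≤0}`: the subalgebra generated by the `fᵢ` and `ωᵢ'^{±1}`. -/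
def leq : Subalgebra Krs (U D) :=
  Algebra.adjoin Krs (⋃ i, {gen D (.f i), gen D (.w' i), gen D (.winv' i)})

theorem e_mem (i : I) : gen D (.e i) ∈ geq D :=
  Algebra.subset_adjoin (Set.mem_iUnion.2 ⟨i, by simp⟩)
theorem w_mem (i : I) : gen D (.w i) ∈ geq D :=
  Algebra.subset_adjoin (Set.mem_iUnion.2 ⟨i, by simp⟩)
theorem winv_mem (i : I) : gen D (.winv i) ∈ geq D :=
  Algebra.subset_adjoin (Set.mem_iUnion.2 ⟨i, by simp⟩)
theorem f_mem (i : I) : gen D (.f i) ∈ leq D :=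
  Algebra.subset_adjoin (Set.mem_iUnion.2 ⟨i, by simp⟩)
theorem w'_mem (i : I) : gen D (.w' i) ∈ leq D :=
  Algebra.subset_adjoin (Set.mem_iUnion.2 ⟨i, by simp⟩)
theorem winv'_mem (i : I) : gen D (.winv' i) ∈ leq D :=
  Algebra.subset_adjoin (Set.mem_iUnion.2 ⟨i, by simp⟩)

theorem geq_isHopfSubalgebra : IsHopfSubalgebra (geq D) := by
  refine isHopfSubalgebra_adjoin D _ ?_ ?_
  · intro x hx
    obtain ⟨i, hi⟩ := Set.mem_iUnion.1 hx
    rcases hi with rfl | rfl | rfl <;> rw [comul_gen]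
    · exact add_mem (tmul_mem_range D (e_mem D i) (one_mem _))
        (tmul_mem_range D (w_mem D i) (e_mem D i))
    · exact tmul_mem_range D (w_mem D i) (w_mem D i)
    · exact tmul_mem_range D (winv_mem D i) (winv_mem D i)
  · intro x hx
    obtain ⟨i, hi⟩ := Set.mem_iUnion.1 hx
    rcases hi with rfl | rfl | rfl <;> rw [antipode_gen]
    · exact neg_mem (mul_mem (winv_mem D i) (e_mem D i))
    · exact winv_mem D i
    · exact w_mem D i

theorem leq_isHopfSubalgebra : IsHopfSubalgebra (leq D) := by
  refine isHopfSubalgebra_adjoin D _ ?_ ?_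
  · intro x hx
    obtain ⟨i, hi⟩ := Set.mem_iUnion.1 hx
    rcases hi with rfl | rfl | rfl <;> rw [comul_gen]
    · exact add_mem (tmul_mem_range D (one_mem _) (f_mem D i))
        (tmul_mem_range D (f_mem D i) (w'_mem D i))
    · exact tmul_mem_range D (w'_mem D i) (w'_mem D i)
    · exact tmul_mem_range D (winv'_mem D i) (winv'_mem D i)
  · intro x hx
    obtain ⟨i, hi⟩ := Set.mem_iUnion.1 hx
    rcases hi with rfl | rfl | rfl <;> rw [antipode_gen]
    · exact neg_mem (mul_mem (f_mem D i) (winv'_mem D i))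
    · exact winv'_mem D i
    · exact w'_mem D i

/-- `U^{≥0}` with the Hopf algebra structure restricted from `U`. -/
instance : HopfAlgebra Krs (geq D) := (geq_isHopfSubalgebra D).hopfAlgebra

/-- `U^{≤0}` with the Hopf algebra structure restricted from `U`. -/
instance : HopfAlgebra Krs (leq D) := (leq_isHopfSubalgebra D).hopfAlgebra

/-- `ωᵢ` as a unit of `U^{≥0}`. -/
def wUnit (i : I) : (geq D)ˣ where
  val := ⟨gen D (.w i), w_mem D i⟩
  inv := ⟨gen D (.winv i), winv_mem D i⟩
  val_inv := Subtype.ext (w_winv D i)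
  inv_val := Subtype.ext (winv_w D i)

/-- `ωᵢ'` as a unit of `U^{≤0}`. -/
def w'Unit (i : I) : (leq D)ˣ where
  val := ⟨gen D (.w' i), w'_mem D i⟩
  inv := ⟨gen D (.winv' i), winv'_mem D i⟩
  val_inv := Subtype.ext (w'_winv' D i)
  inv_val := Subtype.ext (winv'_w' D i)

/-- `ω_μ = ∏ ωᵢ^{μᵢ}` for `μ = ∑ μᵢ αᵢ` in the root lattice. The factors commute; they are
multiplied in the order of the index set. -/
def wQ (μ : I → ℤ) : geq D :=
  (((Finset.univ.sort (· ≤ ·)).map fun i => wUnit D i ^ μ i).prod : (geq D)ˣ)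

/-- `ω'_μ = ∏ ωᵢ'^{μᵢ}` for `μ = ∑ μᵢ αᵢ` in the root lattice. -/
def w'Q (μ : I → ℤ) : leq D :=
  (((Finset.univ.sort (· ≤ ·)).map fun i => w'Unit D i ^ μ i).prod : (leq D)ˣ)

/-- A skew pairing `U^{≤0} × U^{≥0} → ℚ(r, s)` with the prescribed values on generators. -/
structure IsBorelPairing (φ : leq D →ₗ[Krs] geq D →ₗ[Krs] Krs) : Prop where
  isSkewPairing : IsSkewPairing φ
  f_e : ∀ i j, φ ⟨gen D (.f i), f_mem D i⟩ ⟨gen D (.e j), e_mem D j⟩ =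
    if i = j then (D.si i - D.ri i)⁻¹ else 0
  w'_w : ∀ μ ν : I → ℤ, φ (w'Q D μ) (wQ D ν) = r ^ D.eulerQ μ ν * s ^ (-D.eulerQ ν μ)
  w'_e : ∀ (μ : I → ℤ) (i : I), φ (w'Q D μ) ⟨gen D (.e i), e_mem D i⟩ = 0
  f_w : ∀ (i : I) (μ : I → ℤ), φ ⟨gen D (.f i), f_mem D i⟩ (wQ D μ) = 0

end U

end Structure

end QuantumGroup
end TwoParam

end

open scoped TensorProduct

noncomputable section

/-! The difficulty is that the Borel subalgebras sit inside `U D`, and it is not clear in advance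
that the positive (or negative) relations alone present them, so nothing can be defined on them by
generators. The argument therefore works with abstract algebras `Borel b`, presented by a
bicharacter χ and Serre exponents. The positive half B⁺ is `Borel (borelDatum D)`; the negative half
B⁻ is the Borel algebra of the transposed bicharacter with co-opposite comultiplication.

The pairing is an algebra homomorphism `dualHom` from B⁻ to the convolution algebra of functionals
on B⁺. It sends ω'ⱼ to a character and fⱼ to a corner entry of an upper triangular two-dimensional
representation, that is, to a twisted derivation. The relations of B⁻ hold among these functionals
because pullback along the multiplication of B⁺ behaves like a comultiplication: the difference of
the two sides satisfies a twisted Leibniz rule, hence is zero once it vanishes on 1 and on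
generators (`functional_eq_zero`). For the Serre relation this is the usual proof that the Serre
expression is skew-primitive (`dual_serre`).

The product formula of the double says how y ∈ B⁻ should act on B⁺ ⊗ B⁻, namely y · (x ⊗ y') = ∑ (S
y₁, x₁)(y₃, x₃) x₂ ⊗ y₂ y'. This is an action because it is assembled from algebra homomorphisms
(`straighten`). Together with left multiplication by B⁺ it satisfies all relations of `U D`
(`repGen_rel`), the essential one being the commutator of eᵢ and fⱼ (`Borel.posAct_e_negAct_f`).
Evaluating this representation at 1 ⊗ 1 inverts the multiplication map B⁺ ⊗ B⁻ → `U D`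
(`rep_mulMap`, `mulMap_surjective`). Consequently B⁺ and B⁻ are the two Borel subalgebras, the
pairing transports to them, and y x in `U D` is the straightening of y ⊗ x (`negHom_mul_posHom`),
which is multiplicativity of the map from the double.

Uniqueness holds because the coproduct of a generator involves only generators and 1, so the skew
pairing axioms determine the form from its values on generators (`IsSkewPairing.ext_of_gen`). -/

namespace TwoParam

/-! ### Quantum Serre expressions: reversal, rescaling, sums and tensor products -/

section SerreLemmas

variable {k : Type*} [Field k] {A : Type*} [Ring A] [Algebra k A]

/-- Reversing the order of multiplication turns one quantum Serre relation into another. -/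
theorem serreL_eq_zero_of_serreR {q χ χ' : k} (hq : ∀ n : ℕ, q ^ (n + 1) ≠ 1) (m : ℕ)
    (hχ : q ^ (m - 1) * χ * χ' = 1) {x y : A} (h : serreR q χ m x y = 0) :
    serreL q χ' m x y = 0 := by
  have h' := congrArg MulOpposite.op h
  rw [op_serreR, MulOpposite.op_zero, serreL_eq' hq] at h'
  rw [serreL_eq hq]
  -- In the opposite algebra a twisted commutator with parameter p reads N x - p x N = -p (x N - p⁻¹
  -- N x). So each step costs a nonzero scalar and inverts the parameter; by `hχ` the inverse of χ
  -- q^(m-1-n) is χ' q^n.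
  have key : ∀ n ≤ m, ∃ c : k, c ≠ 0 ∧ adIter (fun t => χ * q ^ (m - 1 - t))
      (MulOpposite.op x) (MulOpposite.op y) n =
      MulOpposite.op (c • adIter (fun t => χ' * q ^ t) x y n) := by
    intro n hn
    induction n with
    | zero => exact ⟨1, one_ne_zero, by simp [adIter]⟩
    | succ n ih =>
      obtain ⟨c, hc, ih⟩ := ih (by omega)
      have e : χ * q ^ (m - 1 - n) * (χ' * q ^ n) = 1 := by
        rw [← hχ, show m - 1 = (m - 1 - n) + n by omega, pow_add]
        simp only [Nat.add_sub_cancel]; ring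
      refine ⟨-(c * (χ * q ^ (m - 1 - n))), neg_ne_zero.2 (mul_ne_zero hc
        (left_ne_zero_of_mul_eq_one e)), ?_⟩
      rw [adIter, ih]
      apply MulOpposite.unop_injective
      simp only [MulOpposite.unop_sub, MulOpposite.unop_mul, MulOpposite.unop_op,
        MulOpposite.unop_smul, smul_mul_assoc, mul_smul_comm, adIter, smul_sub, neg_smul,
        smul_smul]
      rw [neg_mul, mul_assoc c, e, mul_one, mul_comm c, neg_smul, sub_neg_eq_add, neg_add_eq_sub]
  obtain ⟨c, hc, h2⟩ := key m le_rfl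
  rw [h', eq_comm, MulOpposite.op_eq_zero_iff] at h2
  exact (smul_eq_zero.1 h2).resolve_left hc

theorem serreR_smul_smul (q χ : k) (m : ℕ) (a b : k) (x y : A) :
    serreR q χ m (a • x) (b • y) = (a ^ m * b) • serreR q χ m x y := by
  rw [serreR, serreR, Finset.smul_sum]
  refine Finset.sum_congr rfl fun j hj => ?_
  have hj' : m = j + (m - j) := by have := Finset.mem_range.1 hj; omega
  simp only [smul_pow, smul_mul_assoc, mul_smul_comm, smul_smul]
  congr 1
  rw [show a ^ m = a ^ j * a ^ (m - j) by rw [← pow_add, ← hj']]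
  ring

/-- The quantum Serre expression of `a + b` and `c + d`, for suitably skew-commuting elements. -/
theorem serreL_add_add {q χ : k} (hq : ∀ n : ℕ, q ^ (n + 1) ≠ 1) (m : ℕ) {χ' : k} {a b c d : A}
    (hχ : q ^ (m - 1) * χ * χ' = 1)
    (hba : b * a = q • (a * b)) (hbc : b * c = χ • (c * b)) (hda : d * a = χ' • (a * d)) :
    serreL q χ m (a + b) (c + d) = serreL q χ m a c + serreL q χ m b d := by
  rw [serreL_add, serreL_left hq m hba hbc, serreL_right hq m hχ hba hda]

/-- As `u` and `v` commute, all words of the sum have the same left leg, which factors out. -/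
theorem serreL_tmul {B C : Type*} [Ring B] [Algebra k B] [Ring C] [Algebra k C] (q χ : k) (m : ℕ)
    {u v : B} {x y : C} (huv : u * v = v * u) :
    serreL q χ m (u ⊗ₜ[k] x) (v ⊗ₜ[k] y) = (u ^ m * v) ⊗ₜ[k] serreL q χ m x y := by
  rw [serreL, serreL, TensorProduct.tmul_sum]
  refine Finset.sum_congr rfl fun j hj => ?_
  have hj' : m = (m - j) + j := by have := Finset.mem_range.1 hj; omega
  rw [TensorProduct.tmul_smul]
  simp only [Algebra.TensorProduct.tmul_pow, Algebra.TensorProduct.tmul_mul_tmul]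
  congr 2
  have hc : v * u ^ j = u ^ j * v := ((Commute.pow_left huv j).eq).symm
  rw [mul_assoc, hc, ← mul_assoc, ← pow_add, ← hj']

end SerreLemmas

/-! ### Abstract Borel algebras and their bialgebra structure -/

/-- The numerical data of a two-parameter Borel algebra: a bicharacter on the root lattice and the
exponents of the quantum Serre relations. -/
structure BorelDatum (k I : Type*) [Field k] where
  χ : I → I → k
  m : I → I → ℕ
  χ_ne_zero : ∀ i j, χ i j ≠ 0
  pow_ne : ∀ i (n : ℕ), χ i i ^ (n + 1) ≠ 1
  m_pos : ∀ i j, i ≠ j → 0 < m i j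
  compat : ∀ i j, i ≠ j → χ i i ^ (m i j - 1) * χ i j * χ j i = 1

/-- The datum with the opposite bicharacter. -/
def BorelDatum.transpose {k I : Type*} [Field k] (b : BorelDatum k I) : BorelDatum k I where
  χ i j := b.χ j i
  m := b.m
  χ_ne_zero i j := b.χ_ne_zero j i
  pow_ne := b.pow_ne
  m_pos := b.m_pos
  compat i j h := by rw [← b.compat i j h]; ring

/-- The generators of a Borel algebra. -/
inductive BorelGen (I : Type*) where
  | e (i : I)
  | w (i : I)
  | winv (i : I)

section Borel

variable {k I : Type*} [Field k] (b : BorelDatum k I)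

/-- The defining relations of a Borel algebra, for a family of elements of an algebra. -/
structure IsBorelFamily {A : Type*} [Ring A] [Algebra k A] (g : BorelGen I → A) : Prop where
  w_w : ∀ i j, g (.w i) * g (.w j) = g (.w j) * g (.w i)
  w_winv : ∀ i, g (.w i) * g (.winv i) = 1
  winv_w : ∀ i, g (.winv i) * g (.w i) = 1
  w_e : ∀ i j, g (.w i) * g (.e j) = b.χ i j • (g (.e j) * g (.w i))
  serre : ∀ i j, i ≠ j → serreL (b.χ i i) (b.χ i j) (b.m i j) (g (.e i)) (g (.e j)) = 0

namespace IsBorelFamily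

variable {b} {A : Type*} [Ring A] [Algebra k A] {g : BorelGen I → A} (hg : IsBorelFamily b g)
include hg

theorem e_winv (i j : I) : g (.e j) * g (.winv i) = b.χ i j • (g (.winv i) * g (.e j)) :=
  comm_inv_of_comm (hg.winv_w i) (hg.w_winv i) (hg.w_e i j)

theorem winv_winv (i j : I) : g (.winv i) * g (.winv j) = g (.winv j) * g (.winv i) :=
  inv_comm_of_comm (hg.w_w i j) (hg.winv_w i) (hg.w_winv i) (hg.winv_w j) (hg.w_winv j)

end IsBorelFamily

open BorelGen in
/-- The defining relations of a Borel algebra in the free algebra. -/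
inductive BorelRel : FreeAlgebra k (BorelGen I) → FreeAlgebra k (BorelGen I) → Prop
  | w_w (i j : I) : BorelRel (FreeAlgebra.ι k (w i) * FreeAlgebra.ι k (w j))
      (FreeAlgebra.ι k (w j) * FreeAlgebra.ι k (w i))
  | w_winv (i : I) : BorelRel (FreeAlgebra.ι k (w i) * FreeAlgebra.ι k (winv i)) 1
  | winv_w (i : I) : BorelRel (FreeAlgebra.ι k (winv i) * FreeAlgebra.ι k (w i)) 1
  | w_e (i j : I) : BorelRel (FreeAlgebra.ι k (w i) * FreeAlgebra.ι k (e j))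
      (b.χ i j • (FreeAlgebra.ι k (e j) * FreeAlgebra.ι k (w i)))
  | serre (i j : I) (h : i ≠ j) : BorelRel (serreL (b.χ i i) (b.χ i j) (b.m i j)
      (FreeAlgebra.ι k (e i)) (FreeAlgebra.ι k (e j))) 0

/-- The Borel algebra, presented by generators and relations. -/
def Borel : Type _ := RingQuot (BorelRel b)

namespace Borel

instance : Ring (Borel b) := inferInstanceAs (Ring (RingQuot (BorelRel b)))
instance : Algebra k (Borel b) := inferInstanceAs (Algebra k (RingQuot (BorelRel b)))

/-- The quotient map from the free algebra. -/
def mk : FreeAlgebra k (BorelGen I) →ₐ[k] Borel b := RingQuot.mkAlgHom k (BorelRel b)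

/-- The generators of the Borel algebra. -/
def gen (x : BorelGen I) : Borel b := mk b (FreeAlgebra.ι k x)

theorem isBorelFamily_gen : IsBorelFamily b (gen b) := by
  have key : ∀ {x y : FreeAlgebra k (BorelGen I)}, BorelRel b x y → mk b x = mk b y :=
    fun h => RingQuot.mkAlgHom_rel k h
  exact
    { w_w := fun i j => by simpa [gen] using key (.w_w i j)
      w_winv := fun i => by simpa [gen] using key (.w_winv i)
      winv_w := fun i => by simpa [gen] using key (.winv_w i)
      w_e := fun i j => by simpa [gen] using key (.w_e i j)
      serre := fun i j h => by simpa only [gen, map_serreL, map_zero] using key (.serre i j h) }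

variable {b} {A : Type*} [Ring A] [Algebra k A]

/-- The universal property of the Borel algebra. -/
def lift {g : BorelGen I → A} (hg : IsBorelFamily b g) : Borel b →ₐ[k] A :=
  RingQuot.liftAlgHom k ⟨FreeAlgebra.lift k g, fun x y h => by
    cases h with
    | w_w i j => simpa using hg.w_w i j
    | w_winv i => simpa using hg.w_winv i
    | winv_w i => simpa using hg.winv_w i
    | w_e i j => simpa using hg.w_e i j
    | serre i j h => simpa only [map_serreL, FreeAlgebra.lift_ι_apply, map_zero]
        using hg.serre i j h⟩

@[simp] theorem lift_gen {g : BorelGen I → A} (hg : IsBorelFamily b g) (x : BorelGen I) :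
    lift hg (gen b x) = g x := by
  refine (RingQuot.liftAlgHom_mkAlgHom_apply (S := k) (FreeAlgebra.lift k g) _ _).trans ?_
  exact FreeAlgebra.lift_ι_apply g x

theorem hom_ext {φ ψ : Borel b →ₐ[k] A} (h : ∀ x, φ (gen b x) = ψ (gen b x)) : φ = ψ :=
  RingQuot.ringQuot_ext' k _ _ (FreeAlgebra.hom_ext (funext h))

variable (b)

theorem adjoin_gen : Algebra.adjoin k (Set.range (gen b)) = ⊤ := by
  have h1 : (mk b).range = ⊤ :=
    (AlgHom.range_eq_top _).2 (RingQuot.mkAlgHom_surjective k (BorelRel b))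
  rw [← h1, ← Algebra.map_top, ← FreeAlgebra.adjoin_range_ι, AlgHom.map_adjoin, ← Set.range_comp]
  rfl

/-- The comultiplication on generators. -/
def comulGen : BorelGen I → Borel b ⊗[k] Borel b
  | .e i => gen b (.e i) ⊗ₜ 1 + gen b (.w i) ⊗ₜ gen b (.e i)
  | .w i => gen b (.w i) ⊗ₜ gen b (.w i)
  | .winv i => gen b (.winv i) ⊗ₜ gen b (.winv i)

/-- The counit on generators. -/
def counitGen : BorelGen I → k
  | .e _ => 0
  | .w _ => 1
  | .winv _ => 1

-- In the Serre relation the summands eᵢ ⊗ 1 and ωᵢ ⊗ eᵢ skew-commute with exactly the parameters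
-- tied together by `compat`. The mixed terms therefore cancel, and each leg satisfies its own Serre
-- relation.
open Algebra.TensorProduct in
theorem isBorelFamily_comulGen : IsBorelFamily b (comulGen b) where
  w_w i j := by simp only [comulGen, tmul_mul_tmul, (isBorelFamily_gen b).w_w i j]
  w_winv i := by simp only [comulGen, tmul_mul_tmul, (isBorelFamily_gen b).w_winv i, one_def]
  winv_w i := by simp only [comulGen, tmul_mul_tmul, (isBorelFamily_gen b).winv_w i, one_def]
  w_e i j := by
    simp only [comulGen, tmul_mul_tmul, mul_add, add_mul, mul_one, one_mul,
      (isBorelFamily_gen b).w_e i j, (isBorelFamily_gen b).w_w i j]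
    simp only [TensorProduct.smul_tmul', TensorProduct.tmul_smul, smul_add]
  serre i j h := by
    have hg := isBorelFamily_gen b
    refine serreL_add_eq_zero (b.pow_ne i) _ (b.compat i j h) ?_ ?_ ?_ ?_ ?_
    · simp only [tmul_mul_tmul, mul_one, one_mul, hg.w_e i i, TensorProduct.smul_tmul']
    · simp only [tmul_mul_tmul, mul_one, one_mul, hg.w_e i j, TensorProduct.smul_tmul']
    · simp only [tmul_mul_tmul, mul_one, one_mul, hg.w_e j i, TensorProduct.smul_tmul']
    · have := map_serreL (includeLeft : Borel b →ₐ[k] Borel b ⊗[k] Borel b) (b.χ i i) (b.χ i j)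
        (b.m i j) (gen b (.e i)) (gen b (.e j))
      rw [hg.serre i j h, map_zero] at this
      exact this.symm
    · rw [serreL_tmul _ _ _ (hg.w_w i j), hg.serre i j h, TensorProduct.tmul_zero]

theorem isBorelFamily_counitGen : IsBorelFamily b (counitGen (k := k) (I := I)) where
  w_w i j := rfl
  w_winv i := by simp [counitGen]
  winv_w i := by simp [counitGen]
  w_e i j := by simp [counitGen]
  serre i j h := by simp [counitGen, serreL]

instance : Bialgebra k (Borel b) :=
  Bialgebra.ofAlgHom (lift (isBorelFamily_comulGen b)) (lift (isBorelFamily_counitGen b))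
    (hom_ext fun x => by
      cases x <;> simp [comulGen, Algebra.TensorProduct.one_def, TensorProduct.add_tmul,
        TensorProduct.tmul_add, add_assoc])
    (hom_ext fun x => by
      cases x <;> simp [comulGen, counitGen])
    (hom_ext fun x => by
      cases x <;> simp [comulGen, counitGen])

theorem comul_gen (x : BorelGen I) : Coalgebra.comul (R := k) (gen b x) = comulGen b x :=
  lift_gen (isBorelFamily_comulGen b) x

theorem counit_gen (x : BorelGen I) : Coalgebra.counit (R := k) (gen b x) = counitGen x :=
  lift_gen (isBorelFamily_counitGen b) x

/-- The antipode of the co-opposite Hopf algebra, on generators. -/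
def antipodeGen : BorelGen I → (Borel b)ᵐᵒᵖ
  | .e i => MulOpposite.op (-(gen b (.e i) * gen b (.winv i)))
  | .w i => MulOpposite.op (gen b (.winv i))
  | .winv i => MulOpposite.op (gen b (.w i))

theorem isBorelFamily_antipodeGen : IsBorelFamily b (antipodeGen b) where
  w_w i j := by
    simp only [antipodeGen, ← MulOpposite.op_mul, (isBorelFamily_gen b).winv_winv i j]
  w_winv i := by
    simp only [antipodeGen, ← MulOpposite.op_mul, (isBorelFamily_gen b).w_winv i,
      MulOpposite.op_one]
  winv_w i := by
    simp only [antipodeGen, ← MulOpposite.op_mul, (isBorelFamily_gen b).winv_w i,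
      MulOpposite.op_one]
  w_e i j := by
    simp only [antipodeGen, ← MulOpposite.op_mul, ← MulOpposite.op_smul, neg_mul, mul_neg,
      smul_neg]
    rw [mul_assoc, (isBorelFamily_gen b).winv_winv, ← mul_assoc, (isBorelFamily_gen b).e_winv,
      smul_mul_assoc, mul_assoc]
  serre i j h := by
    have hg := isBorelFamily_gen b
    have h0 := serreR_antipode (b.pow_ne i) (b.m i j) (α := b.χ i i) (β := b.χ j i)
      (γ := b.χ i j) (χ := b.χ i j) (u := gen b (.winv i)) (v := gen b (.winv j))
      (by linear_combination (-b.χ i j) * b.compat i j h) (hg.winv_winv i j)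
      (hg.e_winv i i) (hg.e_winv j i) (hg.e_winv i j) (hg.serre i j h)
    simp only [antipodeGen]
    -- `serreR_antipode` treats ωᵢ⁻¹ eᵢ, while the antipode of the co-opposite structure is -eᵢ
    -- ωᵢ⁻¹. The two differ by a scalar, and the Serre expression is homogeneous.
    rw [← op_serreR, hg.e_winv, hg.e_winv, ← smul_neg, ← smul_neg, serreR_smul_smul, h0, smul_zero,
      MulOpposite.op_zero]

/-- The antipode of the co-opposite Hopf algebra. -/
def antipodeHom : Borel b →ₐ[k] (Borel b)ᵐᵒᵖ := lift (isBorelFamily_antipodeGen b)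

/-- The co-opposite comultiplication. -/
def comulCop : Borel b →ₐ[k] Borel b ⊗[k] Borel b :=
  (Algebra.TensorProduct.comm k (Borel b) (Borel b)).toAlgHom.comp
    (Bialgebra.comulAlgHom k (Borel b))

end Borel

end Borel

/-! ### Convolution algebras of functionals -/

section DualAlgebra

/-- The convolution algebra of linear functionals on a coalgebra. -/
def ConvDual (k C : Type*) [Field k] [AddCommGroup C] [Module k C] [Coalgebra k C] : Type _ :=
  WithConv (C →ₗ[k] k)

variable {k : Type*} [Field k]

namespace ConvDual

variable {C E : Type*} [AddCommGroup C] [Module k C] [Coalgebra k C] [AddCommGroup E]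
  [Module k E] [Coalgebra k E]

instance : Ring (ConvDual k C) := inferInstanceAs (Ring (WithConv (C →ₗ[k] k)))
instance : Algebra k (ConvDual k C) := inferInstanceAs (Algebra k (WithConv (C →ₗ[k] k)))

variable (k C) in
/-- The underlying functional of an element of the convolution algebra. -/
def toLin : ConvDual k C ≃ₗ[k] (C →ₗ[k] k) where
  toFun ψ := WithConv.ofConv ψ
  invFun ψ := WithConv.toConv ψ
  map_add' _ _ := rfl
  map_smul' _ _ := rfl
  left_inv _ := rfl
  right_inv _ := rfl

instance : CoeFun (ConvDual k C) fun _ => C → k := ⟨fun ψ => toLin k C ψ⟩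

theorem ext {ψ ψ' : ConvDual k C} (h : ∀ x, ψ x = ψ' x) : ψ = ψ' :=
  (toLin k C).injective (LinearMap.ext h)

@[simp] theorem zero_apply (x : C) : (0 : ConvDual k C) x = 0 := rfl
@[simp] theorem add_apply (a b : ConvDual k C) (x : C) : (a + b) x = a x + b x := rfl
@[simp] theorem sub_apply (a b : ConvDual k C) (x : C) : (a - b) x = a x - b x := rfl
@[simp] theorem smul_apply (c : k) (a : ConvDual k C) (x : C) : (c • a) x = c * a x := rfl
@[simp] theorem one_apply (x : C) : (1 : ConvDual k C) x = Coalgebra.counit (R := k) x := rfl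

theorem mul_apply (a b : ConvDual k C) (x : C) : (a * b) x =
    LinearMap.mul' k k (TensorProduct.map (toLin k C a) (toLin k C b) (Coalgebra.comul x)) := rfl

theorem mul_apply_of_comul (a b : ConvDual k C) {x p q : C}
    (h : Coalgebra.comul (R := k) x = p ⊗ₜ q) : (a * b) x = a p * b q := by
  rw [mul_apply, h]; simp

theorem mul_apply_of_comul_add (a b : ConvDual k C) {x p q p' q' : C}
    (h : Coalgebra.comul (R := k) x = p ⊗ₜ q + p' ⊗ₜ q') :
    (a * b) x = a p * b q + a p' * b q' := by
  rw [mul_apply, h]; simp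

end ConvDual

/-- The tensor product of functionals, as a homomorphism of convolution algebras. -/
def dualTensor (k : Type*) [Field k] (C E : Type*) [AddCommGroup C] [Module k C] [Coalgebra k C]
    [AddCommGroup E] [Module k E] [Coalgebra k E] :
    ConvDual k C ⊗[k] ConvDual k E →ₐ[k] ConvDual k (C ⊗[k] E) :=
  Algebra.TensorProduct.algHomOfLinearMapTensorProduct
    ((ConvDual.toLin k (C ⊗[k] E)).symm.toLinearMap ∘ₗ TensorProduct.dualDistrib k C E ∘ₗ
      TensorProduct.map (ConvDual.toLin k C).toLinearMap (ConvDual.toLin k E).toLinearMap)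
    (by
      intro a₁ a₂ b₁ b₂
      -- The functional a ⊗ b is `TensorProduct.map a b` followed by k ⊗ k → k. Forming `map`
      -- respects convolution, and so does composing with an algebra homomorphism, which k ⊗ k → k
      -- is since k is commutative.
      have h : ∀ (a : ConvDual k C) (b : ConvDual k E),
          ((ConvDual.toLin k (C ⊗[k] E)).symm.toLinearMap ∘ₗ TensorProduct.dualDistrib k C E ∘ₗ
            TensorProduct.map (ConvDual.toLin k C).toLinearMap
              (ConvDual.toLin k E).toLinearMap) (a ⊗ₜ b) =
          WithConv.toConv ((Algebra.TensorProduct.lmul' k (S := k)).toLinearMap ∘ₗ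
            (WithConv.toConv (TensorProduct.map (ConvDual.toLin k C a)
              (ConvDual.toLin k E b))).ofConv) := by
        intro a b
        refine ConvDual.ext fun z => ?_
        induction z with
        | zero => simp
        | tmul x y => rfl
        | add x y hx hy => rw [map_add, hx, hy, map_add]
      rw [h, h, h]
      exact congrArg WithConv.toConv ((congrArg (fun z => (Algebra.TensorProduct.lmul' k
        (S := k)).toLinearMap ∘ₗ WithConv.ofConv z) TensorProduct.map_convMul_map.symm).trans
          (LinearMap.algHom_comp_convMul_distrib _ _ _)))
    (by
      refine ConvDual.ext fun z => ?_
      induction z with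
      | zero => simp
      | tmul x y => exact mul_comm _ _
      | add x y hx hy => rw [map_add, hx, hy, map_add])

@[simp] theorem dualTensor_tmul_apply {C E : Type*} [AddCommGroup C] [Module k C] [Coalgebra k C]
    [AddCommGroup E] [Module k E] [Coalgebra k E] (a : ConvDual k C)
    (b : ConvDual k E) (x : C) (y : E) :
    dualTensor k C E (a ⊗ₜ b) (x ⊗ₜ y) = a x * b y := rfl

/-- The pullback of functionals along the multiplication of a bialgebra. -/
def mulPullback (k : Type*) [Field k] (H : Type*) [Ring H] [Bialgebra k H] :
    ConvDual k H →ₐ[k] ConvDual k (H ⊗[k] H) :=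
  AlgHom.ofLinearMap
    ((ConvDual.toLin k (H ⊗[k] H)).symm.toLinearMap ∘ₗ
      LinearMap.lcomp k k (Bialgebra.mulCoalgHom k H).toLinearMap ∘ₗ
        (ConvDual.toLin k H).toLinearMap)
    (by
      refine ConvDual.ext fun z => ?_
      induction z with
      | zero => simp
      | tmul x y => exact (Bialgebra.counit_mul x y).trans (mul_comm _ _)
      | add x y hx hy => rw [map_add, hx, hy, map_add])
    -- The multiplication of a bialgebra is a morphism of coalgebras, so precomposing with it
    -- respects convolution.
    (fun a b => congrArg WithConv.toConv
      (LinearMap.convMul_comp_coalgHom_distrib a b (Bialgebra.mulCoalgHom k H)))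

@[simp] theorem mulPullback_apply {H : Type*} [Ring H] [Bialgebra k H] (a : ConvDual k H)
    (x y : H) : mulPullback k H a (x ⊗ₜ y) = a (x * y) := rfl

/-- A functional with a twisted Leibniz rule. -/
theorem mulPullback_eq_iff {H : Type*} [Ring H] [Bialgebra k H] (ψ : ConvDual k H)
    (z : ConvDual k H ⊗[k] ConvDual k H) :
    mulPullback k H ψ = dualTensor k H H z ↔ ∀ x y, ψ (x * y) = dualTensor k H H z (x ⊗ₜ y) := by
  constructor
  · intro h x y
    rw [← h, mulPullback_apply]
  · intro h
    exact (ConvDual.toLin k (H ⊗[k] H)).injective (TensorProduct.ext' h)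

/-- A character of a bialgebra, as a functional. -/
def character {H : Type*} [Ring H] [Bialgebra k H] (g : H →ₐ[k] k) : ConvDual k H :=
  (ConvDual.toLin k H).symm g.toLinearMap

@[simp] theorem character_apply {H : Type*} [Ring H] [Bialgebra k H] (g : H →ₐ[k] k) (x : H) :
    character g x = g x := rfl

theorem mulPullback_character {H : Type*} [Ring H] [Bialgebra k H] (g : H →ₐ[k] k) :
    mulPullback k H (character g) = dualTensor k H H (character g ⊗ₜ character g) := by
  rw [mulPullback_eq_iff]
  intro x y
  simp

end DualAlgebra

/-! ### The opposite Borel algebra as functionals on a Borel algebra -/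

namespace Borel

variable {k I : Type*} [Field k] {b : BorelDatum k I}

theorem induction {p : Borel b → Prop} (gen : ∀ x, p (gen b x))
    (algebraMap : ∀ c, p (algebraMap k _ c)) (add : ∀ x y, p x → p y → p (x + y))
    (mul : ∀ x y, p x → p y → p (x * y)) (x : Borel b) : p x := by
  have hx : x ∈ Algebra.adjoin k (Set.range (Borel.gen b)) := adjoin_gen b ▸ Algebra.mem_top
  induction hx using Algebra.adjoin_induction with
  | mem x hx => obtain ⟨y, rfl⟩ := hx; exact gen y
  | algebraMap c => exact algebraMap c
  | add x y _ _ hx hy => exact add x y hx hy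
  | mul x y _ _ hx hy => exact mul x y hx hy

/-- The hypothesis `h` is a twisted Leibniz rule ψ(xy) = ψ(x) A(y) + B(x) ψ(y), so vanishing passes
from factors to products. Relations between functionals can thus be tested on generators, with no
basis of the Borel algebra at hand. -/
theorem functional_eq_zero {ψ A B : ConvDual k (Borel b)}
    (h : mulPullback k _ ψ = dualTensor k _ _ (ψ ⊗ₜ A + B ⊗ₜ ψ)) (h1 : ψ 1 = 0)
    (hgen : ∀ x, ψ (gen b x) = 0) : ψ = 0 := by
  refine ConvDual.ext fun x => ?_
  rw [ConvDual.zero_apply]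
  induction x using Borel.induction with
  | gen x => exact hgen x
  | algebraMap c => rw [Algebra.algebraMap_eq_smul_one, map_smul, h1, smul_zero]
  | add x y hx hy => rw [map_add, hx, hy, add_zero]
  | mul x y hx hy =>
    have h := (mulPullback_eq_iff _ _).1 h
    rw [h, map_add, ConvDual.add_apply, dualTensor_tmul_apply, dualTensor_tmul_apply,
      hx, hy, zero_mul, mul_zero, add_zero]

/-- The character with `eᵢ ↦ 0` and `ωᵢ ↦ v i`. -/
def charGen (v : I → k) : BorelGen I → k
  | .e _ => 0
  | .w i => v i
  | .winv i => (v i)⁻¹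

theorem isBorelFamily_charGen {v : I → k} (hv : ∀ i, v i ≠ 0) : IsBorelFamily b (charGen v) where
  w_w i j := mul_comm _ _
  w_winv i := mul_inv_cancel₀ (hv i)
  winv_w i := inv_mul_cancel₀ (hv i)
  w_e i j := by simp [charGen]
  serre i j h := by simp [charGen, serreL]

variable (b) in
/-- The character with `eᵢ ↦ 0` and `ωᵢ ↦ v i`. -/
def charHom (v : I → k) (hv : ∀ i, v i ≠ 0) : Borel b →ₐ[k] k := lift (isBorelFamily_charGen hv)

variable (b)

/-- `ω'ⱼ` as a character of the Borel algebra. -/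
def wChar (j : I) : Borel b →ₐ[k] k := charHom b (fun i => b.χ i j) fun i => b.χ_ne_zero i j

/-- `ω'ⱼ⁻¹` as a character of the Borel algebra. -/
def wCharInv (j : I) : Borel b →ₐ[k] k :=
  charHom b (fun i => (b.χ i j)⁻¹) fun i => inv_ne_zero (b.χ_ne_zero i j)

theorem wChar_gen (j : I) (x : BorelGen I) :
    wChar b j (gen b x) = charGen (fun i => b.χ i j) x :=
  lift_gen (isBorelFamily_charGen fun i => b.χ_ne_zero i j) _

theorem wCharInv_gen (j : I) (x : BorelGen I) :
    wCharInv b j (gen b x) = charGen (fun i => (b.χ i j)⁻¹) x :=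
  lift_gen (isBorelFamily_charGen fun i => inv_ne_zero (b.χ_ne_zero i j)) _

theorem dual_mul_e (a a' : ConvDual k (Borel b)) (i : I) :
    (a * a') (gen b (.e i)) = a (gen b (.e i)) * a' 1 + a (gen b (.w i)) * a' (gen b (.e i)) :=
  ConvDual.mul_apply_of_comul_add _ _ (comul_gen b (.e i))

theorem dual_mul_w (a a' : ConvDual k (Borel b)) (i : I) :
    (a * a') (gen b (.w i)) = a (gen b (.w i)) * a' (gen b (.w i)) :=
  ConvDual.mul_apply_of_comul _ _ (comul_gen b (.w i))

theorem dual_mul_winv (a a' : ConvDual k (Borel b)) (i : I) :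
    (a * a') (gen b (.winv i)) = a (gen b (.winv i)) * a' (gen b (.winv i)) :=
  ConvDual.mul_apply_of_comul _ _ (comul_gen b (.winv i))

theorem dual_mul_one (a a' : ConvDual k (Borel b)) : (a * a') 1 = a 1 * a' 1 :=
  ConvDual.mul_apply_of_comul _ _ (Bialgebra.comul_one.trans rfl)

/-- Two functionals that are multiplicative and agree on generators are equal. -/
theorem functional_ext {ψ ψ' : ConvDual k (Borel b)}
    (h : mulPullback k _ ψ = dualTensor k _ _ (ψ ⊗ₜ ψ))
    (h' : mulPullback k _ ψ' = dualTensor k _ _ (ψ' ⊗ₜ ψ')) (h1 : ψ 1 = ψ' 1)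
    (hgen : ∀ x, ψ (gen b x) = ψ' (gen b x)) : ψ = ψ' := by
  rw [← sub_eq_zero]
  -- The Leibniz rule comes from ψ ⊗ ψ - ψ' ⊗ ψ' = (ψ - ψ') ⊗ ψ + ψ' ⊗ (ψ - ψ').
  refine functional_eq_zero (A := ψ) (B := ψ') ?_ (by simp [h1]) (fun x => by simp [hgen])
  rw [map_sub, h, h', ← map_sub]
  congr 1
  simp only [TensorProduct.sub_tmul, TensorProduct.tmul_sub]
  abel

theorem mulPullback_mul_character (g g' : Borel b →ₐ[k] k) :
    mulPullback k _ (character g * character g') =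
      dualTensor k _ _ ((character g * character g') ⊗ₜ (character g * character g')) := by
  rw [map_mul, mulPullback_character, mulPullback_character, ← map_mul,
    Algebra.TensorProduct.tmul_mul_tmul]

theorem mulPullback_one : mulPullback k (Borel b) 1 = dualTensor k _ _ (1 ⊗ₜ 1) := by
  rw [map_one, ← Algebra.TensorProduct.one_def, map_one]

variable [DecidableEq I]

/-- The representation of the Borel algebra underlying the twisted derivation dual to `eⱼ`. -/
def derivGen (c : I → k) (j : I) : BorelGen I → Matrix (Fin 2) (Fin 2) k
  | .e i => !![0, if i = j then c j else 0; 0, 0]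
  | .w i => !![b.χ i j, 0; 0, 1]
  | .winv i => !![(b.χ i j)⁻¹, 0; 0, 1]

/-- For the Serre relation: the images of the eᵢ are strictly upper triangular, so any two of them
multiply to zero, and every Serre word has m + 1 ≥ 2 such letters. -/
theorem isBorelFamily_derivGen (c : I → k) (j : I) : IsBorelFamily b (derivGen b c j) where
  w_w i l := by simp [derivGen, mul_comm]
  w_winv i := by simp [derivGen, b.χ_ne_zero i j, Matrix.one_fin_two]
  winv_w i := by simp [derivGen, b.χ_ne_zero i j, Matrix.one_fin_two]
  w_e i l := by
    by_cases h : l = j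
    · subst h; simp [derivGen]
    · simp [derivGen, h]
  serre i l h := by
    have h1 : ∀ p q, derivGen b c j (.e p) * derivGen b c j (.e q) = 0 := fun p q => by
      simp [derivGen, ← Matrix.of_zero]
    have h2 : ∀ n, derivGen b c j (.e i) ^ (b.m i l - n) * derivGen b c j (.e l) *
        derivGen b c j (.e i) ^ n = 0 := by
      have hm := b.m_pos i l h
      rintro (_ | n)
      · obtain ⟨t, ht⟩ : ∃ t, b.m i l - 0 = t + 1 := ⟨b.m i l - 1, by omega⟩
        rw [ht, pow_succ, mul_assoc (derivGen b c j (.e i) ^ t), h1, mul_zero, zero_mul]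
      · rw [pow_succ' (derivGen b c j (.e i)) n, mul_assoc (_ ^ _),
          ← mul_assoc (derivGen b c j (.e l)), h1, zero_mul, mul_zero]
    simp only [serreL, h2, smul_zero, Finset.sum_const_zero]

/-- `fⱼ` as a functional on the Borel algebra. -/
def fFun (c : I → k) (j : I) : ConvDual k (Borel b) :=
  (ConvDual.toLin k (Borel b)).symm (LinearMap.proj (1 : Fin 2) ∘ₗ LinearMap.proj (R := k) (φ := fun _ : Fin 2 => Fin 2 → k) (0 : Fin 2) ∘ₗ
    (Matrix.ofLinearEquiv k).symm.toLinearMap ∘ₗ (lift (isBorelFamily_derivGen b c j)).toLinearMap)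

theorem fFun_apply (c : I → k) (j : I) (x : Borel b) :
    fFun b c j x = lift (isBorelFamily_derivGen b c j) x 0 1 := rfl

theorem fFun_gen (c : I → k) (j : I) (x : BorelGen I) :
    fFun b c j (gen b x) = derivGen b c j x 0 1 := by
  rw [fFun_apply, lift_gen]

theorem fFun_one (c : I → k) (j : I) : fFun b c j 1 = 0 := by
  rw [fFun_apply, map_one]; rfl

theorem lift_derivGen (c : I → k) (j : I) (x : Borel b) :
    lift (isBorelFamily_derivGen b c j) x 1 0 = 0 ∧
    lift (isBorelFamily_derivGen b c j) x 0 0 = wChar b j x ∧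
    lift (isBorelFamily_derivGen b c j) x 1 1 = Coalgebra.counit (R := k) x := by
  induction x using Borel.induction with
  | gen x =>
    rw [lift_gen, wChar, charHom, lift_gen, counit_gen]
    cases x <;> simp [derivGen, charGen, counitGen]
  | algebraMap t =>
    simp [Matrix.algebraMap_matrix_apply]
  | add x y hx hy =>
    simp only [map_add, Matrix.add_apply, hx, hy, add_zero, and_self]
  | mul x y hx hy =>
    simp only [map_mul, Matrix.mul_apply, Fin.sum_univ_two, hx, hy, Bialgebra.counit_mul]
    simp

/-- This is the upper right entry of a product of upper triangular matrices. By `lift_derivGen` the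
diagonal entries are the character ω'ⱼ and the counit. -/
theorem mulPullback_fFun (c : I → k) (j : I) : mulPullback k _ (fFun b c j) =
    dualTensor k _ _ (fFun b c j ⊗ₜ 1 + character (wChar b j) ⊗ₜ fFun b c j) := by
  rw [mulPullback_eq_iff]
  intro x y
  rw [map_add, ConvDual.add_apply, dualTensor_tmul_apply, dualTensor_tmul_apply,
    fFun_apply, map_mul, Matrix.mul_apply, Fin.sum_univ_two, (lift_derivGen b c j x).2.1,
    (lift_derivGen b c j y).2.2, add_comm]
  rfl

/-- The family of functionals on the Borel algebra dual to the generators. -/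
def dualGen (c : I → k) : BorelGen I → ConvDual k (Borel b)
  | .e j => fFun b c j
  | .w j => character (wChar b j)
  | .winv j => character (wCharInv b j)

omit [DecidableEq I] in
theorem dual_w_w (i j : I) : character (wChar b i) * character (wChar b j) =
    character (wChar b j) * character (wChar b i) := by
  refine functional_ext b (mulPullback_mul_character b _ _) (mulPullback_mul_character b _ _)
    ?_ ?_
  · simp [dual_mul_one]
  · intro x
    cases x <;> simp [dual_mul_w, dual_mul_e, dual_mul_winv, wChar_gen, charGen, mul_comm]

/-- Both products obey Leibniz rules with the same outer factors ω'ᵢ and ω'ᵢ ω'ⱼ, so their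
difference can be tested on generators. Only eⱼ matters: there ω'ᵢ fⱼ picks up the extra factor
ω'ᵢ(ωⱼ) = `b.χ j i`. -/
theorem dual_w_e (c : I → k) (i j : I) : character (wChar b i) * fFun b c j =
    b.χ j i • (fFun b c j * character (wChar b i)) := by
  rw [← sub_eq_zero]
  refine functional_eq_zero (A := character (wChar b i))
    (B := character (wChar b i) * character (wChar b j)) ?_ ?_ ?_
  · rw [map_sub, map_smul, map_mul, map_mul, mulPullback_character, mulPullback_fFun, ← map_mul,
      ← map_mul, ← map_smul, ← map_sub]
    congr 1
    simp only [mul_add, add_mul, Algebra.TensorProduct.tmul_mul_tmul, mul_one, one_mul,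
      dual_w_w b j i, TensorProduct.sub_tmul, TensorProduct.tmul_sub, TensorProduct.tmul_smul,
      TensorProduct.smul_tmul', smul_add]
    abel
  · simp [dual_mul_one, fFun_one]
  · intro x
    cases x with
    | e l =>
      by_cases h : l = j
      · subst h; simp [dual_mul_e, wChar_gen, fFun_gen, derivGen, charGen, fFun_one]
      · simp [dual_mul_e, wChar_gen, fFun_gen, derivGen, charGen, fFun_one, h]
    | w l => simp [dual_mul_w, fFun_gen, derivGen]
    | winv l => simp [dual_mul_winv, fFun_gen, derivGen]

/-- Evaluation at a group-like element is multiplicative for convolution, so iterated commutators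
vanish wherever their letters do. -/
theorem adIter_fFun_groupLike (c : I → k) (i j : I) (t : ℕ → k) {z : Borel b}
    (hz : Coalgebra.comul (R := k) z = z ⊗ₜ z) (hj : fFun b c j z = 0) (n : ℕ)
    (hi : fFun b c i z = 0) : adIter t (fFun b c i) (fFun b c j) n z = 0 := by
  cases n with
  | zero => exact hj
  | succ n =>
    rw [adIter, ConvDual.sub_apply, ConvDual.smul_apply,
      ConvDual.mul_apply_of_comul _ _ hz, ConvDual.mul_apply_of_comul _ _ hz, hi, zero_mul,
      mul_zero, mul_zero, sub_zero]

/-- Each term of the coproduct of `e l` has a group-like leg, 1 or ω, and both factors of every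
product in the outermost commutator vanish on such legs. -/
theorem adIter_fFun_e (c : I → k) (i j l : I) (t : ℕ → k) (n : ℕ) :
    adIter t (fFun b c i) (fFun b c j) (n + 1) (gen b (.e l)) = 0 := by
  have h1 := adIter_fFun_groupLike b c i j t (z := 1) Bialgebra.comul_one (fFun_one b c j) n
    (fFun_one b c i)
  have h2 := adIter_fFun_groupLike b c i j t (comul_gen b (.w l))
    (by simp [fFun_gen, derivGen]) n (by simp [fFun_gen, derivGen])
  rw [adIter, ConvDual.sub_apply, ConvDual.smul_apply,
    dual_mul_e, dual_mul_e, h1, h2, fFun_one, fFun_gen b c i (.w l)]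
  simp [derivGen]

/-- With `mulPullback` in the role of the comultiplication, the Serre expression of the fᵢ is
skew-primitive: it obeys a Leibniz rule with A = 1 and B = ω'ᵢ^m ω'ⱼ. It also vanishes on 1 and on
generators, hence everywhere. The parameter is `b.χ j i` because the functionals realise the
transposed datum. -/
theorem dual_serre (c : I → k) (i j : I) (h : i ≠ j) :
    serreL (b.χ i i) (b.χ j i) (b.m i j) (fFun b c i) (fFun b c j) = 0 := by
  have hc : b.χ i i ^ (b.m i j - 1) * b.χ j i * b.χ i j = 1 := b.transpose.compat i j h
  refine functional_eq_zero (A := 1)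
    (B := character (wChar b i) ^ b.m i j * character (wChar b j)) ?_ ?_ ?_
  · rw [map_serreL, mulPullback_fFun, mulPullback_fFun, ← map_serreL,
      serreL_add_add (b.pow_ne i) _ hc]
    · rw [serreL_tmul _ _ _ (dual_w_w b i j)]
      have := map_serreL (Algebra.TensorProduct.includeLeft : ConvDual k (Borel b) →ₐ[k]
        ConvDual k (Borel b) ⊗[k] ConvDual k (Borel b)) (b.χ i i) (b.χ j i)
        (b.m i j) (fFun b c i) (fFun b c j)
      simp only [Algebra.TensorProduct.includeLeft_apply] at this
      rw [← this]
    · simp only [Algebra.TensorProduct.tmul_mul_tmul, mul_one, one_mul, dual_w_e b c i i,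
        TensorProduct.smul_tmul']
    · simp only [Algebra.TensorProduct.tmul_mul_tmul, mul_one, one_mul, dual_w_e b c i j,
        TensorProduct.smul_tmul']
    · simp only [Algebra.TensorProduct.tmul_mul_tmul, mul_one, one_mul, dual_w_e b c j i,
        TensorProduct.smul_tmul']
  · rw [serreL_eq (b.pow_ne i)]
    exact adIter_fFun_groupLike b c i j _ Bialgebra.comul_one (fFun_one b c j) _ (fFun_one b c i)
  · intro x
    rw [serreL_eq (b.pow_ne i)]
    cases x with
    | e l =>
      -- At least one commutator is needed: `fFun b c j` itself takes the value `c j` at `e j`.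
      obtain ⟨t, ht⟩ : ∃ t, b.m i j = t + 1 := ⟨b.m i j - 1, by have := b.m_pos i j h; omega⟩
      rw [ht]
      exact adIter_fFun_e b c i j l _ t
    | w l =>
      exact adIter_fFun_groupLike b c i j _ (comul_gen b (.w l)) (by simp [fFun_gen, derivGen]) _
        (by simp [fFun_gen, derivGen])
    | winv l =>
      exact adIter_fFun_groupLike b c i j _ (comul_gen b (.winv l)) (by simp [fFun_gen, derivGen])
        _ (by simp [fFun_gen, derivGen])

theorem isBorelFamily_dualGen (c : I → k) : IsBorelFamily b.transpose (dualGen b c) where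
  w_w i j := dual_w_w b i j
  w_winv i := by
    refine functional_ext b (mulPullback_mul_character b _ _) (mulPullback_one b) ?_ ?_
    · simp [dualGen, dual_mul_one]
    · intro x
      cases x <;> simp [dualGen, dual_mul_w, dual_mul_e, dual_mul_winv, wChar_gen, wCharInv_gen, charGen,
        counit_gen, counitGen, b.χ_ne_zero]
  winv_w i := by
    refine functional_ext b (mulPullback_mul_character b _ _) (mulPullback_one b) ?_ ?_
    · simp [dualGen, dual_mul_one]
    · intro x
      cases x <;> simp [dualGen, dual_mul_w, dual_mul_e, dual_mul_winv, wChar_gen, wCharInv_gen, charGen,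
        counit_gen, counitGen, b.χ_ne_zero]
  w_e i j := dual_w_e b c i j
  serre i j h := dual_serre b c i j h

/-- The pairing of opposite Borel algebras, as a homomorphism to the convolution algebra. -/
def dualHom (c : I → k) : Borel b.transpose →ₐ[k] ConvDual k (Borel b) :=
  lift (isBorelFamily_dualGen b c)

theorem dualHom_gen (c : I → k) (x : BorelGen I) :
    dualHom b c (gen b.transpose x) = dualGen b c x := lift_gen _ _

/-- This is the pairing axiom for a product in the second argument. Both sides are algebra
homomorphisms in `y`, so generators suffice. -/
theorem mulPullback_dualHom (c : I → k) (y : Borel b.transpose) :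
    mulPullback k _ (dualHom b c y) = dualTensor k _ _
      (Algebra.TensorProduct.map (dualHom b c) (dualHom b c) (Coalgebra.comul (R := k) y)) := by
  have h : (mulPullback k (Borel b)).comp (dualHom b c) = (dualTensor k _ _).comp
      ((Algebra.TensorProduct.map (dualHom b c) (dualHom b c)).comp
        (Bialgebra.comulAlgHom k (Borel b.transpose))) := by
    refine hom_ext fun x => ?_
    simp only [AlgHom.comp_apply, Bialgebra.comulAlgHom_apply, comul_gen, dualHom_gen]
    cases x with
    | e j => simp [comulGen, dualHom_gen, dualGen, mulPullback_fFun]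
    | w j => simp [comulGen, dualHom_gen, dualGen, mulPullback_character]
    | winv j => simp [comulGen, dualHom_gen, dualGen, mulPullback_character]
  exact DFunLike.congr_fun h y

theorem dualHom_apply_one (c : I → k) (y : Borel b.transpose) :
    dualHom b c y 1 = Coalgebra.counit (R := k) y := by
  induction y using Borel.induction with
  | gen x =>
    rw [dualHom_gen, counit_gen]
    cases x <;> simp [dualGen, fFun_one, counitGen]
  | algebraMap t =>
    rw [Algebra.algebraMap_eq_smul_one, map_smul, map_one (dualHom b c), ConvDual.smul_apply,
      ConvDual.one_apply, map_smul, Bialgebra.counit_one, Bialgebra.counit_one, smul_eq_mul]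
  | add x y hx hy => rw [map_add, ConvDual.add_apply, hx, hy, map_add]
  | mul x y hx hy => rw [map_mul, dual_mul_one, hx, hy, Bialgebra.counit_mul]

end Borel

/-! ### Coregular actions and the straightening action -/

section Actions

variable {k : Type*} [Field k]

section Coalgebra

variable {C : Type*} [AddCommGroup C] [Module k C] [Coalgebra k C]

/-- Contraction of the right tensor factor with a functional. -/
def contractRight (ψ : ConvDual k C) : C ⊗[k] C →ₗ[k] C :=
  (TensorProduct.rid k C).toLinearMap ∘ₗ (ConvDual.toLin k C ψ).lTensor C

/-- Contraction of the left tensor factor with a functional. -/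
def contractLeft (ψ : ConvDual k C) : C ⊗[k] C →ₗ[k] C :=
  (TensorProduct.lid k C).toLinearMap ∘ₗ (ConvDual.toLin k C ψ).rTensor C

@[simp] theorem contractRight_tmul (ψ : ConvDual k C) (x y : C) :
    contractRight ψ (x ⊗ₜ y) = ψ y • x := by simp [contractRight]

@[simp] theorem contractLeft_tmul (ψ : ConvDual k C) (x y : C) :
    contractLeft ψ (x ⊗ₜ y) = ψ x • y := by simp [contractLeft]

/-- By coassociativity both sides are ∑ a(x₂) b(x₃) x₁. -/
theorem contractRight_comul_mul (a b : ConvDual k C) (x : C) :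
    contractRight (a * b) (Coalgebra.comul x) =
      contractRight a (Coalgebra.comul (contractRight b (Coalgebra.comul x))) := by
  have e1 : ∀ z : C ⊗[k] C, contractRight (a * b) z =
      (TensorProduct.rid k C ∘ (LinearMap.mul' k k ∘ₗ TensorProduct.map (ConvDual.toLin k C a)
        (ConvDual.toLin k C b)).lTensor C) ((Coalgebra.comul (R := k)).lTensor C z) := by
    intro z
    induction z with
    | zero => simp
    | tmul p q => simp [ConvDual.mul_apply]
    | add p q hp hq => simp only [map_add, Function.comp_apply] at *; rw [hp, hq]
  have e2 : ∀ z : C ⊗[k] C, contractRight a (Coalgebra.comul (contractRight b z)) =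
      (TensorProduct.rid k C ∘ (LinearMap.mul' k k ∘ₗ TensorProduct.map (ConvDual.toLin k C a)
        (ConvDual.toLin k C b)).lTensor C)
        (TensorProduct.assoc k C C C ((Coalgebra.comul (R := k)).rTensor C z)) := by
    intro z
    induction z with
    | zero => simp
    | tmul p q =>
      simp only [contractRight_tmul, map_smul, LinearMap.rTensor_tmul]
      generalize Coalgebra.comul (R := k) p = w
      induction w with
      | zero => simp
      | tmul p q => simp [smul_smul, mul_comm]
      | add p q hp hq =>
        simp only [map_add, TensorProduct.add_tmul, Function.comp_apply, smul_add] at *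
        rw [hp, hq]
    | add p q hp hq => simp only [map_add, Function.comp_apply] at *; rw [hp, hq]
  rw [e1, e2, Coalgebra.coassoc_apply]

/-- By coassociativity both sides are ∑ a(x₁) b(x₂) x₃. Here `a` is contracted before `b`, which is
why `leftAct` takes values in the opposite of the endomorphism algebra. -/
theorem contractLeft_comul_mul (a b : ConvDual k C) (x : C) :
    contractLeft (a * b) (Coalgebra.comul x) =
      contractLeft b (Coalgebra.comul (contractLeft a (Coalgebra.comul x))) := by
  have e1 : ∀ z : C ⊗[k] C, contractLeft (a * b) z =
      (TensorProduct.lid k C ∘ (LinearMap.mul' k k ∘ₗ TensorProduct.map (ConvDual.toLin k C a)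
        (ConvDual.toLin k C b)).rTensor C) ((Coalgebra.comul (R := k)).rTensor C z) := by
    intro z
    induction z with
    | zero => simp
    | tmul p q => simp [ConvDual.mul_apply]
    | add p q hp hq => simp only [map_add, Function.comp_apply] at *; rw [hp, hq]
  have e2 : ∀ z : C ⊗[k] C, contractLeft b (Coalgebra.comul (contractLeft a z)) =
      (TensorProduct.lid k C ∘ (LinearMap.mul' k k ∘ₗ TensorProduct.map (ConvDual.toLin k C a)
        (ConvDual.toLin k C b)).rTensor C)
        ((TensorProduct.assoc k C C C).symm ((Coalgebra.comul (R := k)).lTensor C z)) := by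
    intro z
    induction z with
    | zero => simp
    | tmul p q =>
      simp only [contractLeft_tmul, map_smul, LinearMap.lTensor_tmul]
      generalize Coalgebra.comul (R := k) q = w
      induction w with
      | zero => simp
      | tmul p q => simp [smul_smul]
      | add p q hp hq =>
        simp only [map_add, TensorProduct.tmul_add, Function.comp_apply, smul_add] at *
        rw [hp, hq]
    | add p q hp hq => simp only [map_add, Function.comp_apply] at *; rw [hp, hq]
  rw [e1, e2, Coalgebra.coassoc_symm_apply]

/-- Both sides are ∑ a(x₁) b(x₃) x₂: the left and right coregular actions commute. -/
theorem contractLeft_comul_contractRight (a b : ConvDual k C) (x : C) :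
    contractLeft a (Coalgebra.comul (contractRight b (Coalgebra.comul x))) =
      contractRight b (Coalgebra.comul (contractLeft a (Coalgebra.comul x))) := by
  have e1 : ∀ z : C ⊗[k] C, contractLeft a (Coalgebra.comul (contractRight b z)) =
      (TensorProduct.lid k C ∘ TensorProduct.map (ConvDual.toLin k C a) (contractRight b))
        (TensorProduct.assoc k C C C ((Coalgebra.comul (R := k)).rTensor C z)) := by
    intro z
    induction z with
    | zero => simp
    | tmul p q =>
      simp only [contractRight_tmul, map_smul, LinearMap.rTensor_tmul]
      generalize Coalgebra.comul (R := k) p = w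
      induction w with
      | zero => simp
      | tmul p q => simp [smul_smul, mul_comm]
      | add p q hp hq =>
        simp only [map_add, TensorProduct.add_tmul, Function.comp_apply, smul_add] at *
        rw [hp, hq]
    | add p q hp hq => simp only [map_add, Function.comp_apply] at *; rw [hp, hq]
  have e2 : ∀ z : C ⊗[k] C, contractRight b (Coalgebra.comul (contractLeft a z)) =
      (TensorProduct.lid k C ∘ TensorProduct.map (ConvDual.toLin k C a) (contractRight b))
        ((Coalgebra.comul (R := k)).lTensor C z) := by
    intro z
    induction z with
    | zero => simp
    | tmul p q => simp
    | add p q hp hq => simp only [map_add, Function.comp_apply] at *; rw [hp, hq]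
  rw [e1, e2, Coalgebra.coassoc_apply]

variable (k C)

/-- The right coregular action `ψ ⬝ x = ∑ ψ(x₂) x₁` of the convolution algebra. -/
def rightAct : ConvDual k C →ₐ[k] Module.End k C :=
  AlgHom.ofLinearMap
    { toFun := fun ψ => contractRight ψ ∘ₗ Coalgebra.comul
      map_add' := fun a b => by
        ext x; simp [contractRight, LinearMap.lTensor_add]
      map_smul' := fun c a => by
        ext x; simp [contractRight, LinearMap.lTensor_smul] }
    (by
      ext x
      have : ConvDual.toLin k C 1 = Coalgebra.counit := rfl
      simp [contractRight, this])
    (fun a b => LinearMap.ext fun x => contractRight_comul_mul a b x)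

/-- The left coregular action `ψ ⬝ x = ∑ ψ(x₁) x₂` of the opposite convolution algebra. -/
def leftAct : ConvDual k C →ₐ[k] (Module.End k C)ᵐᵒᵖ :=
  AlgHom.ofLinearMap
    { toFun := fun ψ => MulOpposite.op (contractLeft ψ ∘ₗ Coalgebra.comul)
      map_add' := fun a b => by
        rw [← MulOpposite.op_add]; congr 1
        ext x; simp [contractLeft, LinearMap.rTensor_add]
      map_smul' := fun c a => by
        rw [RingHom.id_apply, ← MulOpposite.op_smul]; congr 1
        ext x; simp [contractLeft, LinearMap.rTensor_smul] }
    (by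
      apply MulOpposite.unop_injective
      apply LinearMap.ext
      intro x
      have : ConvDual.toLin k C 1 = Coalgebra.counit := rfl
      simp [contractLeft, this])
    (fun a b => MulOpposite.unop_injective (LinearMap.ext fun x => contractLeft_comul_mul a b x))

variable {k C}

theorem rightAct_apply (ψ : ConvDual k C) (x : C) :
    rightAct k C ψ x = contractRight ψ (Coalgebra.comul x) := rfl

theorem leftAct_apply (ψ : ConvDual k C) (x : C) :
    (leftAct k C ψ).unop x = contractLeft ψ (Coalgebra.comul x) := rfl

end Coalgebra

section Bialgebra

variable {H : Type*} [Ring H] [Bialgebra k H]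

/-- Because the comultiplication is multiplicative, a Leibniz rule for a functional becomes the same
rule for its coregular action. This is how the actions of ω'ⱼ and fⱼ are moved past left
multiplication by a generator. -/
theorem rightAct_mul {ψ a b a' b' : ConvDual k H}
    (h : mulPullback k H ψ = dualTensor k H H (a ⊗ₜ b + a' ⊗ₜ b')) (x y : H) :
    rightAct k H ψ (x * y) = rightAct k H a x * rightAct k H b y +
      rightAct k H a' x * rightAct k H b' y := by
  have h' : ∀ x y, ψ (x * y) = a x * b y + a' x * b' y := (mulPullback_eq_iff _ _).1 h
  simp only [rightAct_apply, Bialgebra.comul_mul]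
  generalize Coalgebra.comul (R := k) x = z
  generalize Coalgebra.comul (R := k) y = w
  induction z with
  | zero => simp
  | add p q hp hq => simp only [add_mul, map_add, hp, hq]; abel
  | tmul p q =>
    induction w with
    | zero => simp
    | add p q hp hq => simp only [mul_add, map_add, hp, hq]; abel
    | tmul p' q' =>
      simp only [Algebra.TensorProduct.tmul_mul_tmul, contractRight_tmul, h', smul_mul_smul_comm,
        add_smul]

theorem leftAct_mul {ψ a b a' b' : ConvDual k H}
    (h : mulPullback k H ψ = dualTensor k H H (a ⊗ₜ b + a' ⊗ₜ b')) (x y : H) :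
    (leftAct k H ψ).unop (x * y) = (leftAct k H a).unop x * (leftAct k H b).unop y +
      (leftAct k H a').unop x * (leftAct k H b').unop y := by
  have h' : ∀ x y, ψ (x * y) = a x * b y + a' x * b' y := (mulPullback_eq_iff _ _).1 h
  simp only [leftAct_apply, Bialgebra.comul_mul]
  generalize Coalgebra.comul (R := k) x = z
  generalize Coalgebra.comul (R := k) y = w
  induction z with
  | zero => simp
  | add p q hp hq => simp only [add_mul, map_add, hp, hq]; abel
  | tmul p q =>
    induction w with
    | zero => simp
    | add p q hp hq => simp only [mul_add, map_add, hp, hq]; abel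
    | tmul p' q' =>
      simp only [Algebra.TensorProduct.tmul_mul_tmul, contractLeft_tmul, h', smul_mul_smul_comm,
        add_smul]

theorem rightAct_character_mul (g : H →ₐ[k] k) (x y : H) :
    rightAct k H (character g) (x * y) =
      rightAct k H (character g) x * rightAct k H (character g) y := by
  have := rightAct_mul (ψ := character g) (a := character g) (b := character g) (a' := 0)
    (b' := 0) (by rw [mulPullback_character, TensorProduct.zero_tmul, add_zero]) x y
  simpa using this

theorem leftAct_character_mul (g : H →ₐ[k] k) (x y : H) :
    (leftAct k H (character g)).unop (x * y) =
      (leftAct k H (character g)).unop x * (leftAct k H (character g)).unop y := by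
  have := leftAct_mul (ψ := character g) (a := character g) (b := character g) (a' := 0)
    (b' := 0) (by rw [mulPullback_character, TensorProduct.zero_tmul, add_zero]) x y
  simpa using this

end Bialgebra

section Straightening

variable {C Y : Type*} [AddCommGroup C] [Module k C] [Coalgebra k C] [Ring Y] [Algebra k Y]
  (Δ : Y →ₐ[k] Y ⊗[k] Y) (S : Y →ₐ[k] Yᵐᵒᵖ) (Φ : Y →ₐ[k] ConvDual k C)

/-- The action `y ⬝ x = ∑ (S y, x₁) x₂`. -/
def antipodeAct : Y →ₐ[k] Module.End k C := (AlgHom.opComm ((leftAct k C).comp Φ)).comp S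

theorem antipodeAct_apply (y : Y) : antipodeAct S Φ y = (leftAct k C (Φ (S y).unop)).unop := rfl

theorem commute_lmul_rightAct (y y' : Y) :
    Commute (((Module.End.lTensorAlgHom k Y C).comp (Algebra.lmul k Y)) y)
      (((Module.End.rTensorAlgHom k C Y).comp ((rightAct k C).comp Φ)) y') := by
  apply LinearMap.ext
  intro z
  induction z with
  | zero => rw [map_zero, map_zero]
  | tmul p q => rfl
  | add p q hp hq => rw [map_add, map_add, hp, hq]

/-- The action of `Y ⊗ Y` on `C ⊗ Y` by `(y₂ ⊗ y₃) ⬝ (x ⊗ y) = ∑ (y₃, x₂) x₁ ⊗ y₂ y`. -/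
def doubleAct : Y ⊗[k] Y →ₐ[k] Module.End k (C ⊗[k] Y) :=
  Algebra.TensorProduct.lift ((Module.End.lTensorAlgHom k Y C).comp (Algebra.lmul k Y))
    ((Module.End.rTensorAlgHom k C Y).comp ((rightAct k C).comp Φ)) (commute_lmul_rightAct Φ)

theorem doubleAct_tmul (y₂ y₃ y : Y) (x : C) :
    doubleAct Φ (y₂ ⊗ₜ y₃) (x ⊗ₜ y) = rightAct k C (Φ y₃) x ⊗ₜ (y₂ * y) := by
  rw [doubleAct, Algebra.TensorProduct.lift_tmul]
  rfl

/-- The legs y₁ and y₃ act from the two sides of the coalgebra `C`, while y₂ acts on the other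
tensor factor, so the three actions commute. Hence Y ⊗ Y ⊗ Y acts, and straightening is an action as
a composite of algebra homomorphisms. -/
theorem commute_antipodeAct_doubleAct (y : Y) (w : Y ⊗[k] Y) :
    Commute (((Module.End.rTensorAlgHom k C Y).comp (antipodeAct S Φ)) y) (doubleAct Φ w) := by
  induction w with
  | zero => rw [map_zero]; exact Commute.zero_right _
  | add p q hp hq => rw [map_add]; exact hp.add_right hq
  | tmul p q =>
    apply LinearMap.ext
    intro z
    induction z with
    | zero => rw [map_zero, map_zero]
    | tmul u v =>
      have h := contractLeft_comul_contractRight (Φ (S y).unop) (Φ q) u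
      have h1 : ∀ u v, ((Module.End.rTensorAlgHom k C Y).comp (antipodeAct S Φ)) y (u ⊗ₜ v) =
        (leftAct k C (Φ (S y).unop)).unop u ⊗ₜ v := fun _ _ => rfl
      rw [Module.End.mul_apply, Module.End.mul_apply, h1, doubleAct_tmul, doubleAct_tmul, h1]
      exact congrArg (fun t => t ⊗ₜ[k] (p * v)) h
    | add p q hp hq => rw [map_add, map_add, hp, hq]

/-- The action of `Y ⊗ (Y ⊗ Y)` on `C ⊗ Y` by
`(y₁ ⊗ y₂ ⊗ y₃) ⬝ (x ⊗ y) = ∑ (S y₁, x₁) (y₃, x₃) x₂ ⊗ y₂ y`. -/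
def tripleAct : Y ⊗[k] (Y ⊗[k] Y) →ₐ[k] Module.End k (C ⊗[k] Y) :=
  Algebra.TensorProduct.lift ((Module.End.rTensorAlgHom k C Y).comp (antipodeAct S Φ))
    (doubleAct Φ) (commute_antipodeAct_doubleAct S Φ)

theorem tripleAct_tmul (y₁ y₂ y₃ y : Y) (x : C) :
    tripleAct S Φ (y₁ ⊗ₜ (y₂ ⊗ₜ y₃)) (x ⊗ₜ y) =
      antipodeAct S Φ y₁ (rightAct k C (Φ y₃) x) ⊗ₜ (y₂ * y) := by
  rw [tripleAct, Algebra.TensorProduct.lift_tmul, Module.End.mul_apply, doubleAct_tmul]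
  rfl

/-- The left action of `Y` on `C ⊗ Y` by straightening:
`y ⬝ (x ⊗ y') = ∑ (S y₁, x₁) (y₃, x₃) x₂ ⊗ y₂ y'`. -/
def straighten : Y →ₐ[k] Module.End k (C ⊗[k] Y) :=
  (tripleAct S Φ).comp ((Algebra.TensorProduct.map (AlgHom.id k Y) Δ).comp Δ)

theorem straighten_apply (y : Y) : straighten Δ S Φ y =
    tripleAct S Φ (Algebra.TensorProduct.map (AlgHom.id k Y) Δ (Δ y)) := rfl

end Straightening

end Actions

section SerreLemmas

variable {k : Type*} [Field k] {A : Type*} [Ring A] [Algebra k A]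

/-- This is `serreL_eq_zero_of_serreR` in the opposite algebra, with `A` identified with its double
opposite. -/
theorem serreR_eq_zero_of_serreL {q χ χ' : k} (hq : ∀ n : ℕ, q ^ (n + 1) ≠ 1) (m : ℕ)
    (hχ : q ^ (m - 1) * χ * χ' = 1) {x y : A} (h : serreL q χ m x y = 0) :
    serreR q χ' m x y = 0 := by
  apply MulOpposite.op_injective
  rw [op_serreR, MulOpposite.op_zero]
  refine serreL_eq_zero_of_serreR hq m hχ ?_
  apply MulOpposite.op_injective
  rw [op_serreR]
  have := map_serreL (AlgEquiv.opOp k A).toAlgHom q χ m x y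
  rw [h, map_zero] at this
  exact this.symm

end SerreLemmas

namespace IsBorelFamily

variable {k I : Type*} [Field k] {b : BorelDatum k I} {A B : Type*} [Ring A] [Algebra k A]
  [Ring B] [Algebra k B] {g : BorelGen I → A}

theorem map (hg : IsBorelFamily b g) (φ : A →ₐ[k] B) : IsBorelFamily b (φ ∘ g) where
  w_w i j := by simp only [Function.comp_apply, ← map_mul, hg.w_w i j]
  w_winv i := by simp only [Function.comp_apply, ← map_mul, hg.w_winv i, map_one]
  winv_w i := by simp only [Function.comp_apply, ← map_mul, hg.winv_w i, map_one]
  w_e i j := by simp only [Function.comp_apply, ← map_mul, hg.w_e i j, map_smul]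
  serre i j h := by
    simp only [Function.comp_apply]
    rw [← map_serreL, hg.serre i j h, map_zero]

end IsBorelFamily

/-! ### Cross relations between the two Borel actions on the tensor product -/

namespace Borel

variable {k I : Type*} [Field k] (b : BorelDatum k I)

theorem rightAct_e (ψ : ConvDual k (Borel b)) (i : I) : rightAct k _ ψ (gen b (.e i)) =
    ψ 1 • gen b (.e i) + ψ (gen b (.e i)) • gen b (.w i) := by
  rw [rightAct_apply, comul_gen, comulGen, map_add, contractRight_tmul, contractRight_tmul]

theorem rightAct_w (ψ : ConvDual k (Borel b)) (i : I) : rightAct k _ ψ (gen b (.w i)) =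
    ψ (gen b (.w i)) • gen b (.w i) := by
  rw [rightAct_apply, comul_gen, comulGen, contractRight_tmul]

theorem leftAct_e (ψ : ConvDual k (Borel b)) (i : I) : (leftAct k _ ψ).unop (gen b (.e i)) =
    ψ (gen b (.e i)) • 1 + ψ (gen b (.w i)) • gen b (.e i) := by
  rw [leftAct_apply, comul_gen, comulGen, map_add, contractLeft_tmul, contractLeft_tmul]

theorem leftAct_w (ψ : ConvDual k (Borel b)) (i : I) : (leftAct k _ ψ).unop (gen b (.w i)) =
    ψ (gen b (.w i)) • gen b (.w i) := by
  rw [leftAct_apply, comul_gen, comulGen, contractLeft_tmul]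

theorem comulCop_gen (x : BorelGen I) : comulCop b (gen b x) = match x with
    | .e i => 1 ⊗ₜ gen b (.e i) + gen b (.e i) ⊗ₜ gen b (.w i)
    | .w i => gen b (.w i) ⊗ₜ gen b (.w i)
    | .winv i => gen b (.winv i) ⊗ₜ gen b (.winv i) := by
  rw [comulCop, AlgHom.comp_apply, Bialgebra.comulAlgHom_apply, comul_gen]
  cases x <;> simp [comulGen]

theorem antipodeHom_gen (x : BorelGen I) : antipodeHom b (gen b x) = antipodeGen b x :=
  lift_gen _ _

variable [DecidableEq I] (c : I → k)

/-- The action of a Borel algebra on the tensor product with the opposite Borel algebra by left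
multiplication. -/
def posAct : Borel b →ₐ[k] Module.End k (Borel b ⊗[k] Borel b.transpose) :=
  (Module.End.rTensorAlgHom k (Borel b) (Borel b.transpose)).comp (Algebra.lmul k (Borel b))

omit [DecidableEq I] in
theorem posAct_tmul (x x' : Borel b) (y : Borel b.transpose) :
    posAct b x (x' ⊗ₜ y) = (x * x') ⊗ₜ y := rfl

/-- The action of the opposite Borel algebra by straightening. -/
def negAct : Borel b.transpose →ₐ[k] Module.End k (Borel b ⊗[k] Borel b.transpose) :=
  straighten (comulCop b.transpose) (antipodeHom b.transpose) (dualHom b c)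

theorem negAct_w (j : I) (x : Borel b) (y : Borel b.transpose) :
    negAct b c (gen _ (.w j)) (x ⊗ₜ y) = (leftAct k _ (character (wCharInv b j))).unop
      (rightAct k _ (character (wChar b j)) x) ⊗ₜ (gen _ (.w j) * y) := by
  rw [negAct, straighten_apply, comulCop_gen]
  simp only [Algebra.TensorProduct.map_tmul, comulCop_gen, AlgHom.id_apply]
  rw [tripleAct_tmul, antipodeAct_apply, antipodeHom_gen, antipodeGen, MulOpposite.unop_op,
    dualHom_gen, dualHom_gen]
  rfl

/-- The three terms come from the iterated coproduct 1 ⊗ 1 ⊗ f + 1 ⊗ f ⊗ ω' + f ⊗ ω' ⊗ ω'. In the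
last one S(f) = -f ω'⁻¹ gives the sign and the two left actions. -/
theorem negAct_f (j : I) (x : Borel b) (y : Borel b.transpose) :
    negAct b c (gen _ (.e j)) (x ⊗ₜ y) = rightAct k _ (fFun b c j) x ⊗ₜ y +
      rightAct k _ (character (wChar b j)) x ⊗ₜ (gen _ (.e j) * y) -
      (leftAct k _ (character (wCharInv b j))).unop ((leftAct k _ (fFun b c j)).unop
        (rightAct k _ (character (wChar b j)) x)) ⊗ₜ (gen _ (.w j) * y) := by
  rw [negAct, straighten_apply, comulCop_gen]
  simp only [map_add, Algebra.TensorProduct.map_tmul, comulCop_gen, AlgHom.id_apply, map_one,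
    TensorProduct.tmul_add, LinearMap.add_apply]
  rw [tripleAct_tmul, tripleAct_tmul, tripleAct_tmul,
    antipodeAct_apply (k := k) (y := gen b.transpose (.e j)), antipodeHom_gen, antipodeGen,
    MulOpposite.unop_op, map_neg,
    map_mul (dualHom b c), dualHom_gen, dualHom_gen, dualHom_gen, map_one, map_neg, map_mul]
  simp only [Module.End.one_apply, one_mul, dualGen, MulOpposite.unop_neg, MulOpposite.unop_mul,
    LinearMap.neg_apply, Module.End.mul_apply, TensorProduct.neg_tmul]
  abel

variable {b c}

theorem end_ext {V W : Type*} [AddCommGroup V] [Module k V] [AddCommGroup W] [Module k W]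
    {f g : Module.End k (V ⊗[k] W)} (h : ∀ x y, f (x ⊗ₜ y) = g (x ⊗ₜ y)) : f = g :=
  TensorProduct.ext' h

/-- The right action of ω'ⱼ scales ωᵢ by `b.χ i j` and the left action of its inverse scales it
back. -/
theorem posAct_w_negAct_w (i j : I) : posAct b (gen b (.w i)) * negAct b c (gen _ (.w j)) =
    negAct b c (gen _ (.w j)) * posAct b (gen b (.w i)) := by
  refine end_ext fun x y => ?_
  simp only [Module.End.mul_apply, negAct_w, posAct_tmul]
  rw [rightAct_character_mul, rightAct_w, smul_mul_assoc, map_smul, leftAct_character_mul,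
    leftAct_w, smul_mul_assoc, smul_smul]
  simp [wChar_gen, wCharInv_gen, charGen, b.χ_ne_zero]

theorem negAct_w_posAct_e (i j : I) : negAct b c (gen _ (.w i)) * posAct b (gen b (.e j)) =
    (b.χ j i)⁻¹ • (posAct b (gen b (.e j)) * negAct b c (gen _ (.w i))) := by
  refine end_ext fun x y => ?_
  simp only [Module.End.mul_apply, LinearMap.smul_apply, negAct_w, posAct_tmul]
  rw [rightAct_character_mul, rightAct_e, character_apply, character_apply, map_one, one_smul,
    wChar_gen, charGen, zero_smul, add_zero, leftAct_character_mul, leftAct_e, character_apply,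
    character_apply, wCharInv_gen, wCharInv_gen, charGen, charGen, zero_smul, zero_add,
    smul_mul_assoc, TensorProduct.smul_tmul']

theorem fFun_w (i j : I) : fFun b c j (gen b (.w i)) = 0 := by simp [fFun_gen, derivGen]

theorem fFun_e (i j : I) : fFun b c j (gen b (.e i)) = if i = j then c j else 0 := by
  simp [fFun_gen, derivGen]

theorem posAct_w_negAct_f (i j : I) : posAct b (gen b (.w i)) * negAct b c (gen _ (.e j)) =
    (b.χ i j)⁻¹ • (negAct b c (gen _ (.e j)) * posAct b (gen b (.w i))) := by
  rw [eq_inv_smul_iff₀ (b.χ_ne_zero i j)]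
  refine end_ext fun x y => ?_
  simp only [Module.End.mul_apply, LinearMap.smul_apply, negAct_f, map_add, map_sub, posAct_tmul]
  rw [rightAct_mul (mulPullback_fFun b c j), rightAct_w, rightAct_character_mul, rightAct_w,
    fFun_w, zero_smul, zero_mul, zero_add, smul_mul_assoc, smul_mul_assoc, map_smul, map_smul,
    leftAct_mul (mulPullback_fFun b c j), leftAct_w, leftAct_w, fFun_w, zero_smul, zero_mul,
    zero_add, smul_mul_assoc, map_smul, leftAct_character_mul, leftAct_w]
  simp only [character_apply, wChar_gen, wCharInv_gen, charGen, smul_mul_assoc, smul_smul,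
    ← TensorProduct.smul_tmul', smul_add, smul_sub]
  rw [mul_inv_cancel₀ (b.χ_ne_zero i j), mul_one]

/-- By the Leibniz rules, fⱼ applied to eᵢ x gives eᵢ (fⱼ · x) plus two corrections, present only
for i = j. The right action turns eᵢ into `c j` ωᵢ. The left action turns eᵢ into `c j`, and what
remains of that term is minus the action of ω'ⱼ. -/
theorem posAct_e_negAct_f (i j : I) : posAct b (gen b (.e i)) * negAct b c (gen _ (.e j)) -
    negAct b c (gen _ (.e j)) * posAct b (gen b (.e i)) =
    if i = j then (-c j) • (posAct b (gen b (.w i)) - negAct b c (gen _ (.w i))) else 0 := by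
  have h : negAct b c (gen _ (.e j)) * posAct b (gen b (.e i)) =
      posAct b (gen b (.e i)) * negAct b c (gen _ (.e j)) +
      (if i = j then c j else 0) • (posAct b (gen b (.w i)) - negAct b c (gen _ (.w j))) := by
    refine end_ext fun x y => ?_
    simp only [Module.End.mul_apply, LinearMap.smul_apply, LinearMap.add_apply,
      LinearMap.sub_apply, negAct_f, negAct_w, map_add, map_sub, posAct_tmul]
    rw [rightAct_mul (mulPullback_fFun b c j), rightAct_e, rightAct_character_mul, rightAct_e,
      leftAct_mul (mulPullback_fFun b c j)]
    simp only [character_apply, map_one, wChar_gen, charGen, zero_smul, one_smul, add_zero,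
      fFun_one, fFun_e, zero_add, leftAct_e, MulOpposite.unop_one, Module.End.one_apply,
      fFun_w, map_add, leftAct_character_mul, wCharInv_gen, smul_mul_assoc, map_smul, smul_smul,
      one_mul, TensorProduct.add_tmul, ← TensorProduct.smul_tmul', smul_sub]
    rw [mul_inv_cancel₀ (b.χ_ne_zero i j), one_smul]
    abel
  rw [h]
  split_ifs with hij
  · subst hij
    exact (sub_add_cancel_left _ _).trans (neg_smul _ _).symm
  · rw [zero_smul, add_zero, sub_self]

end Borel

/-! ### The representation of the quantum group on B⁺ ⊗ B⁻ -/

namespace U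

variable {I : Type*} [Fintype I] [LinearOrder I] (D : CartanDatum I)

/-- The Borel datum of a Cartan datum. -/
def borelDatum : BorelDatum Krs I where
  χ := chi D
  m := D.serreExp
  χ_ne_zero := chi_ne_zero D
  pow_ne i := by rw [chi_self]; exact qi_pow_ne D i
  m_pos i j h := by
    have := D.nonpos i j h
    rw [CartanDatum.serreExp]; omega
  compat i j h := by rw [chi_self]; exact chi_mul D i j h

/-- The positive generators. -/
def posGen : BorelGen I → U D
  | .e i => gen D (.e i)
  | .w i => gen D (.w i)
  | .winv i => gen D (.winv i)

/-- The negative generators. -/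
def negGen : BorelGen I → U D
  | .e i => gen D (.f i)
  | .w i => gen D (.w' i)
  | .winv i => gen D (.winv' i)

theorem isBorelFamily_posGen : IsBorelFamily (borelDatum D) (posGen D) where
  w_w := w_w D
  w_winv := w_winv D
  winv_w := winv_w D
  w_e := w_e D
  serre i j h := by
    have := serre_e D i j h
    rwa [← chi_self] at this

/-- The Serre relation for the fᵢ is presented with reversed multiplication and parameter `chi D i
j`. Undoing the reversal replaces this by `chi D j i`, which is why the negative half belongs to the
transposed datum. -/
theorem isBorelFamily_negGen : IsBorelFamily (borelDatum D).transpose (negGen D) where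
  w_w := w'_w' D
  w_winv := w'_winv' D
  winv_w := winv'_w' D
  w_e := w'_f D
  serre i j h := by
    have := serreL_eq_zero_of_serreR (qi_pow_ne D i) _ (chi_mul D i j h) (serre_f D i j h)
    rwa [← chi_self] at this

/-- The homomorphism from the abstract positive Borel algebra. -/
def posHom : Borel (borelDatum D) →ₐ[Krs] U D := Borel.lift (isBorelFamily_posGen D)

/-- The homomorphism from the abstract negative Borel algebra. -/
def negHom : Borel (borelDatum D).transpose →ₐ[Krs] U D := Borel.lift (isBorelFamily_negGen D)

theorem posHom_gen (x : BorelGen I) : posHom D (Borel.gen _ x) = posGen D x := Borel.lift_gen _ _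

theorem negHom_gen (x : BorelGen I) : negHom D (Borel.gen _ x) = negGen D x := Borel.lift_gen _ _

/-- The values of the pairing on `fᵢ` and `eᵢ`. -/
def pairCoeff (i : I) : Krs := (D.si i - D.ri i)⁻¹

/-- The action of the generators on the tensor product of the abstract Borel algebras. -/
def repGen : Gen I → Module.End Krs (Borel (borelDatum D) ⊗[Krs] Borel (borelDatum D).transpose)
  | .e i => Borel.posAct _ (Borel.gen _ (.e i))
  | .w i => Borel.posAct _ (Borel.gen _ (.w i))
  | .winv i => Borel.posAct _ (Borel.gen _ (.winv i))
  | .f i => Borel.negAct _ (pairCoeff D) (Borel.gen _ (.e i))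
  | .w' i => Borel.negAct _ (pairCoeff D) (Borel.gen _ (.w i))
  | .winv' i => Borel.negAct _ (pairCoeff D) (Borel.gen _ (.winv i))

theorem conj_of_comm {k A : Type*} [Field k] [Ring A] [Algebra k A] {c : k} {w x v : A}
    (hv : w * v = 1) (h : w * x = c • (x * w)) : w * x * v = c • x := by
  rw [h, smul_mul_assoc, mul_assoc, hv, mul_one]

/-- Relations inside one half are inherited, since `Borel.posAct` and `Borel.negAct` are algebra
homomorphisms; only the mixed relations rest on computations with the pairing. -/
theorem repGen_rel : ∀ x y, Rel D (repGen D) x y → x = y := by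
  have hp := (Borel.isBorelFamily_gen (borelDatum D)).map (Borel.posAct (borelDatum D))
  have hn := (Borel.isBorelFamily_gen (borelDatum D).transpose).map
    (Borel.negAct (borelDatum D) (pairCoeff D))
  intro x y h
  cases h with
  | w_w i j => exact hp.w_w i j
  | w'_w' i j => exact hn.w_w i j
  | w_w' i j => exact Borel.posAct_w_negAct_w i j
  | w_winv i => exact hp.w_winv i
  | winv_w i => exact hp.winv_w i
  | w'_winv' i => exact hn.w_winv i
  | winv'_w' i => exact hn.winv_w i
  | w_e i j => exact conj_of_comm (hp.w_winv i) (hp.w_e i j)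
  | w'_e i j =>
    rw [← chi_inv]
    exact conj_of_comm (hn.w_winv i) (Borel.negAct_w_posAct_e i j)
  | w_f i j =>
    rw [← chi_inv]
    exact conj_of_comm (hp.w_winv i) (Borel.posAct_w_negAct_f i j)
  | w'_f i j => exact conj_of_comm (hn.w_winv i) (hn.w_e i j)
  | e_f i j =>
    refine (Borel.posAct_e_negAct_f i j).trans ?_
    -- The commutator on the tensor product has coefficient `-pairCoeff D j`; this is what forces
    -- the value (s - r)⁻¹ of the pairing on fⱼ and eⱼ.
    have h : -pairCoeff D j = (D.ri j - D.si j)⁻¹ := by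
      rw [pairCoeff, ← inv_neg, neg_sub]
    split_ifs with hij
    · subst hij; rw [h]; rfl
    · rfl
  | serre_e i j h =>
    rw [serre_e_iff, ← chi_self]
    exact hp.serre i j h
  | serre_f i j h =>
    rw [serre_f_iff]
    have h1 := hn.serre i j h
    have h2 := chi_mul D i j h
    rw [← chi_self] at h2 ⊢
    -- The action satisfies the unreversed relation for the transposed datum, whereas the
    -- presentation of `U D` asks for the reversed one.
    refine serreR_eq_zero_of_serreL ((borelDatum D).pow_ne i) _ ?_ h1
    exact (borelDatum D).transpose.compat i j h

/-- The action of the quantum group on the tensor product of the abstract Borel algebras. -/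
def rep : U D →ₐ[Krs] Module.End Krs (Borel (borelDatum D) ⊗[Krs] Borel (borelDatum D).transpose) :=
  lift D (repGen D) (repGen_rel D)

theorem rep_posHom (x : Borel (borelDatum D)) : rep D (posHom D x) = Borel.posAct _ x := by
  have : (rep D).comp (posHom D) = Borel.posAct _ := Borel.hom_ext fun x => by
    rw [AlgHom.comp_apply, posHom_gen]
    cases x <;> simp [posGen, rep, repGen]
  exact DFunLike.congr_fun this x

theorem rep_negHom (y : Borel (borelDatum D).transpose) :
    rep D (negHom D y) = Borel.negAct _ (pairCoeff D) y := by
  have : (rep D).comp (negHom D) = Borel.negAct _ (pairCoeff D) := Borel.hom_ext fun x => by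
    rw [AlgHom.comp_apply, negHom_gen]
    cases x <;> simp [negGen, rep, repGen]
  exact DFunLike.congr_fun this y

end U

namespace Borel

variable {k I : Type*} [Field k] (b : BorelDatum k I)

theorem rightAct_one (ψ : ConvDual k (Borel b)) : rightAct k _ ψ 1 = ψ 1 • 1 := by
  rw [rightAct_apply, Bialgebra.comul_one, Algebra.TensorProduct.one_def, contractRight_tmul]

theorem leftAct_one (ψ : ConvDual k (Borel b)) : (leftAct k _ ψ).unop 1 = ψ 1 • 1 := by
  rw [leftAct_apply, Bialgebra.comul_one, Algebra.TensorProduct.one_def, contractLeft_tmul]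

/-- On the group-like element 1 functionals act by their values at 1, so ω'ⱼ acts trivially on the
first factor and fⱼ kills it; what is left is multiplication on the second factor. -/
theorem negAct_one_tmul [DecidableEq I] (c : I → k) (y y' : Borel b.transpose) :
    negAct b c y (1 ⊗ₜ y') = 1 ⊗ₜ (y * y') := by
  have hw : ∀ j y', negAct b c (gen _ (.w j)) (1 ⊗ₜ y') = 1 ⊗ₜ (gen _ (.w j) * y') := by
    intro j y'
    rw [negAct_w, rightAct_one, map_smul, leftAct_one]
    simp
  have hg := isBorelFamily_gen b.transpose
  induction y using Borel.induction generalizing y' with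
  | gen x =>
    cases x with
    | e j =>
      rw [negAct_f, rightAct_one, rightAct_one, map_smul, leftAct_one, fFun_one]
      simp
    | w j => exact hw j y'
    | winv j =>
      -- The inverse needs no formula of its own: the formula for ω'ⱼ is applied at ω'ⱼ⁻¹ y' and
      -- inverted.
      have h := hw j (gen _ (.winv j) * y')
      rw [← mul_assoc, hg.w_winv, one_mul] at h
      rw [← h, ← Module.End.mul_apply, ← map_mul, hg.winv_w, map_one, Module.End.one_apply]
  | algebraMap t =>
    rw [AlgHom.commutes, Module.algebraMap_end_apply, ← TensorProduct.tmul_smul,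
      Algebra.smul_def]
  | add p q hp hq => rw [map_add, LinearMap.add_apply, hp, hq, add_mul, TensorProduct.tmul_add]
  | mul p q hp hq => rw [map_mul, Module.End.mul_apply, hq, hp, mul_assoc]

end Borel

/-! ### Injectivity of multiplication; presentation of the Borel subalgebras -/

namespace U

variable {I : Type*} [Fintype I] [LinearOrder I] (D : CartanDatum I)

/-- The multiplication map from the tensor product of the abstract Borel algebras. -/
def mulMap : Borel (borelDatum D) ⊗[Krs] Borel (borelDatum D).transpose →ₗ[Krs] U D :=
  LinearMap.mul' Krs (U D) ∘ₗ TensorProduct.map (posHom D).toLinearMap (negHom D).toLinearMap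

@[simp] theorem mulMap_tmul (x : Borel (borelDatum D)) (y : Borel (borelDatum D).transpose) :
    mulMap D (x ⊗ₜ y) = posHom D x * negHom D y := rfl

/-- The element 1 ⊗ 1 is a cyclic vector: `y` sends it to 1 ⊗ y, and `x` sends that to x ⊗ y. Linear
independence of products of the two halves thus comes from a representation, without a PBW basis. -/
theorem rep_mulMap (z : Borel (borelDatum D) ⊗[Krs] Borel (borelDatum D).transpose) :
    rep D (mulMap D z) (1 ⊗ₜ 1) = z := by
  induction z with
  | zero => simp
  | add x y hx hy => rw [map_add, map_add, LinearMap.add_apply, hx, hy]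
  | tmul x y =>
    rw [mulMap_tmul, map_mul, rep_posHom, rep_negHom, Module.End.mul_apply,
      Borel.negAct_one_tmul, mul_one, Borel.posAct_tmul, mul_one]

/-- The image of `x` recovers x ⊗ 1, and the counit on the second factor recovers `x`. -/
theorem posHom_injective : Function.Injective (posHom D) := by
  intro x y h
  have h1 := rep_mulMap D (x ⊗ₜ 1)
  have h2 := rep_mulMap D (y ⊗ₜ 1)
  rw [mulMap_tmul] at h1 h2
  rw [h] at h1
  have h3 := congrArg (TensorProduct.rid Krs _ ∘ (Coalgebra.counit (R := Krs)).lTensor _)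
    (h1.symm.trans h2)
  simpa using h3

theorem negHom_injective : Function.Injective (negHom D) := by
  intro x y h
  have h1 := rep_mulMap D (1 ⊗ₜ x)
  have h2 := rep_mulMap D (1 ⊗ₜ y)
  rw [mulMap_tmul] at h1 h2
  rw [h] at h1
  have h3 := congrArg (TensorProduct.lid Krs _ ∘ (Coalgebra.counit (R := Krs)).rTensor _)
    (h1.symm.trans h2)
  simpa using h3

theorem range_posHom : (posHom D).range = geq D := by
  rw [← Algebra.map_top, ← Borel.adjoin_gen, AlgHom.map_adjoin, ← Set.range_comp, geq]
  congr 1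
  ext u
  simp only [Set.mem_range, Function.comp_apply, posHom_gen, Set.mem_iUnion,
    Set.mem_insert_iff, Set.mem_singleton_iff]
  constructor
  · rintro ⟨x, rfl⟩
    rcases x with i | i | i
    exacts [⟨i, .inl rfl⟩, ⟨i, .inr (.inl rfl)⟩, ⟨i, .inr (.inr rfl)⟩]
  · rintro ⟨i, rfl | rfl | rfl⟩
    · exact ⟨.e i, rfl⟩
    · exact ⟨.w i, rfl⟩
    · exact ⟨.winv i, rfl⟩

theorem range_negHom : (negHom D).range = leq D := by
  rw [← Algebra.map_top, ← Borel.adjoin_gen, AlgHom.map_adjoin, ← Set.range_comp, leq]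
  congr 1
  ext u
  simp only [Set.mem_range, Function.comp_apply, negHom_gen, Set.mem_iUnion,
    Set.mem_insert_iff, Set.mem_singleton_iff]
  constructor
  · rintro ⟨x, rfl⟩
    rcases x with i | i | i
    exacts [⟨i, .inl rfl⟩, ⟨i, .inr (.inl rfl)⟩, ⟨i, .inr (.inr rfl)⟩]
  · rintro ⟨i, rfl | rfl | rfl⟩
    · exact ⟨.e i, rfl⟩
    · exact ⟨.w i, rfl⟩
    · exact ⟨.winv i, rfl⟩

/-- The positive Borel subalgebra is presented by the positive relations. -/
def posEquiv : Borel (borelDatum D) ≃ₐ[Krs] geq D :=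
  AlgEquiv.ofBijective ((posHom D).codRestrict (geq D) fun x => by
      rw [← range_posHom]; exact ⟨x, rfl⟩)
    ⟨fun x y h => posHom_injective D (congrArg Subtype.val h), fun ⟨u, hu⟩ => by
      rw [← range_posHom] at hu
      obtain ⟨x, hx⟩ := hu
      exact ⟨x, Subtype.ext hx⟩⟩

/-- The negative Borel subalgebra is presented by the negative relations. -/
def negEquiv : Borel (borelDatum D).transpose ≃ₐ[Krs] leq D :=
  AlgEquiv.ofBijective ((negHom D).codRestrict (leq D) fun x => by
      rw [← range_negHom]; exact ⟨x, rfl⟩)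
    ⟨fun x y h => negHom_injective D (congrArg Subtype.val h), fun ⟨u, hu⟩ => by
      rw [← range_negHom] at hu
      obtain ⟨x, hx⟩ := hu
      exact ⟨x, Subtype.ext hx⟩⟩

theorem coe_posEquiv (x : Borel (borelDatum D)) : (posEquiv D x : U D) = posHom D x := rfl

theorem coe_negEquiv (y : Borel (borelDatum D).transpose) : (negEquiv D y : U D) = negHom D y := rfl

end U

/-! ### Surjectivity of multiplication; transport of the pairing to the Borel subalgebras -/

namespace U

variable {I : Type*} [Fintype I] [LinearOrder I] (D : CartanDatum I)

section Surjectivity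

/-- The span of the negative generators and `1`. -/
def negSpan : Submodule Krs (U D) :=
  Submodule.span Krs (insert 1 (Set.range (negGen D)))

/-- Moving one negative letter to the right past a positive one leaves terms with at most one
negative letter, since the commutator of e and f is linear in the ω and ω'. The linear span
`negSpan` is therefore large enough, and a check on pairs of generators suffices. -/
theorem negGen_mul_posGen_mem (p q : BorelGen I) :
    negGen D p * posGen D q ∈ Subalgebra.toSubmodule (geq D) * negSpan D := by
  have hq : ∀ q, posGen D q ∈ Subalgebra.toSubmodule (geq D) := fun q => by
    cases q
    exacts [e_mem D _, w_mem D _, winv_mem D _]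
  have hp : ∀ p, negGen D p ∈ negSpan D := fun p =>
    Submodule.subset_span (Set.mem_insert_of_mem _ ⟨p, rfl⟩)
  have h1 : (1 : U D) ∈ negSpan D := Submodule.subset_span (Set.mem_insert _ _)
  have key : ∀ {p q} (c : Krs), negGen D p * posGen D q = c • (posGen D q * negGen D p) →
      negGen D p * posGen D q ∈ Subalgebra.toSubmodule (geq D) * negSpan D := fun c h => by
    rw [h]; exact Submodule.smul_mem _ _ (Submodule.mul_mem_mul (hq _) (hp _))
  rcases p with j | j | j <;> rcases q with i | i | i
  · have h : gen D (.f j) * gen D (.e i) = gen D (.e i) * gen D (.f j) -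
        (gen D (.e i) * gen D (.f j) - gen D (.f j) * gen D (.e i)) := by abel
    change gen D (.f j) * gen D (.e i) ∈ _
    rw [h]
    refine Submodule.sub_mem _ (Submodule.mul_mem_mul (hq (.e i)) (hp (.e j))) ?_
    by_cases hij : i = j
    · subst hij
      rw [e_f_same]
      refine Submodule.smul_mem _ _ (Submodule.sub_mem _ ?_ ?_)
      · have := Submodule.mul_mem_mul (hq (.w i)) h1
        rwa [mul_one] at this
      · have := Submodule.mul_mem_mul ((Subalgebra.mem_toSubmodule (geq D)).2 (one_mem (geq D))) (hp (.w i))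
        rwa [one_mul] at this
    · rw [e_f_ne D i j hij]; exact Submodule.zero_mem _
  · refine key (chi D i j) ?_
    change gen D (.f j) * gen D (.w i) = _ • (gen D (.w i) * gen D (.f j))
    rw [w_f, smul_inv_smul₀ (chi_ne_zero D i j)]
  · exact key _ (f_winv D i j)
  · exact key _ (w'_e D j i)
  · exact key 1 (by rw [one_smul]; exact (w_w' D i j).symm)
  · exact key 1 (by
      rw [one_smul]; exact (inv_half_comm (w_w' D i j) (winv_w D i) (w_winv D i)).symm)
  · refine key (chi D i j) ?_
    change gen D (.winv' j) * gen D (.e i) = _ • (gen D (.e i) * gen D (.winv' j))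
    rw [e_winv', smul_inv_smul₀ (chi_ne_zero D i j)]
  · exact key 1 (by
      rw [one_smul]
      exact inv_half_comm (w_w' D i j).symm (winv'_w' D j) (w'_winv' D j))
  · exact key 1 (by rw [one_smul]; exact (winv_winv' D i j).symm)

theorem negSpan_mul_geq : negSpan D * Subalgebra.toSubmodule (geq D) ≤
    Subalgebra.toSubmodule (geq D) * negSpan D := by
  refine Submodule.mul_le.2 fun v hv x hx => ?_
  rw [Subalgebra.mem_toSubmodule, ← range_posHom] at hx
  obtain ⟨x, rfl⟩ := hx
  change v * posHom D x ∈ _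
  induction x using Borel.induction generalizing v with
  | gen q =>
    rw [posHom_gen]
    induction hv using Submodule.span_induction with
    | zero => rw [zero_mul]; exact Submodule.zero_mem _
    | add x y _ _ hx hy => rw [add_mul]; exact Submodule.add_mem _ hx hy
    | smul c x _ hx => rw [smul_mul_assoc]; exact Submodule.smul_mem _ _ hx
    | mem v hv =>
      rcases hv with rfl | ⟨p, rfl⟩
      · rw [one_mul, ← mul_one (posGen D q)]
        refine Submodule.mul_mem_mul ?_ (Submodule.subset_span (Set.mem_insert _ _))
        rw [Subalgebra.mem_toSubmodule, ← range_posHom]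
        exact ⟨_, posHom_gen D q⟩
      · exact negGen_mul_posGen_mem D p q
  | algebraMap c =>
    rw [AlgHom.commutes, ← Algebra.commutes]
    exact Submodule.mul_mem_mul (Subalgebra.algebraMap_mem _ c) hv
  | add x y hx hy => rw [map_add, mul_add]; exact Submodule.add_mem _ (hx v hv) (hy v hv)
  | mul x y hx hy =>
    rw [map_mul, ← mul_assoc]
    -- After `v` has passed `x`, each term is g v' with g positive and v' again in `negSpan`, so the
    -- hypothesis for `y` applies to v'; this is why `v` is generalized.
    refine Submodule.mul_induction_on (hx v hv) (fun g hg v hv => ?_) fun a b ha hb => ?_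
    · rw [mul_assoc, ← (Subalgebra.isIdempotentElem_toSubmodule (geq D)).eq, mul_assoc]
      exact Submodule.mul_mem_mul hg (hy v hv)
    · rw [add_mul]; exact Submodule.add_mem _ ha hb

theorem negSpan_le : negSpan D ≤ Subalgebra.toSubmodule (leq D) := by
  refine Submodule.span_le.2 ?_
  rintro _ (rfl | ⟨x, rfl⟩)
  · exact one_mem (leq D)
  · cases x
    exacts [f_mem D _, w'_mem D _, winv'_mem D _]

/-- The product contains 1 and is stable under left multiplication by every generator, the negative
ones being moved past the positive part one at a time. -/
theorem geq_mul_leq :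
    Subalgebra.toSubmodule (geq D) * Subalgebra.toSubmodule (leq D) = ⊤ := by
  have h : ∀ u z : U D, z ∈ Subalgebra.toSubmodule (geq D) * Subalgebra.toSubmodule (leq D) →
      u * z ∈ Subalgebra.toSubmodule (geq D) * Subalgebra.toSubmodule (leq D) := by
    intro u
    have hu : u ∈ Algebra.adjoin Krs (Set.range (gen D)) := adjoin_gen D ▸ Algebra.mem_top
    have hp : ∀ u ∈ geq D, ∀ z ∈ Subalgebra.toSubmodule (geq D) * Subalgebra.toSubmodule (leq D),
        u * z ∈ Subalgebra.toSubmodule (geq D) * Subalgebra.toSubmodule (leq D) := by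
      intro u hu z hz
      have := Submodule.mul_mem_mul ((Subalgebra.mem_toSubmodule (S := geq D)).2 hu) hz
      rwa [← mul_assoc, (Subalgebra.isIdempotentElem_toSubmodule (geq D)).eq] at this
    have hn : ∀ u ∈ negSpan D, ∀ z ∈ Subalgebra.toSubmodule (geq D) *
        Subalgebra.toSubmodule (leq D),
        u * z ∈ Subalgebra.toSubmodule (geq D) * Subalgebra.toSubmodule (leq D) := by
      intro u hu z hz
      have h1 := Submodule.mul_mem_mul hu hz
      rw [← mul_assoc] at h1
      have h2 := mul_le_mul_left (negSpan_mul_geq D) (Subalgebra.toSubmodule (leq D)) h1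
      rw [mul_assoc] at h2
      have h3 := mul_le_mul_right (mul_le_mul_left (negSpan_le D)
        (Subalgebra.toSubmodule (leq D))) (Subalgebra.toSubmodule (geq D)) h2
      rw [(Subalgebra.isIdempotentElem_toSubmodule (leq D)).eq] at h3
      exact h3
    induction hu using Algebra.adjoin_induction with
    | algebraMap c => exact hp _ (Subalgebra.algebraMap_mem _ c)
    | add x y _ _ hx hy =>
      intro z hz; rw [add_mul]; exact Submodule.add_mem _ (hx z hz) (hy z hz)
    | mul x y _ _ hx hy => intro z hz; rw [mul_assoc]; exact hx _ (hy z hz)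
    | mem x hx =>
      have hs : ∀ p, negGen D p ∈ negSpan D := fun p =>
        Submodule.subset_span (Set.mem_insert_of_mem _ ⟨p, rfl⟩)
      obtain ⟨x, rfl⟩ := hx
      cases x with
      | e i => exact hp _ (e_mem D i)
      | w i => exact hp _ (w_mem D i)
      | winv i => exact hp _ (winv_mem D i)
      | f i => exact hn _ (hs (.e i))
      | w' i => exact hn _ (hs (.w i))
      | winv' i => exact hn _ (hs (.winv i))
  rw [eq_top_iff]
  intro u _
  simpa using h u 1 (by
    rw [← mul_one (1 : U D)]
    exact Submodule.mul_mem_mul (one_mem (geq D)) (one_mem (leq D)))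

theorem mulMap_surjective : Function.Surjective (mulMap D) := by
  rw [← LinearMap.range_eq_top, eq_top_iff, ← geq_mul_leq]
  refine Submodule.mul_le.2 fun x hx y hy => ?_
  rw [Subalgebra.mem_toSubmodule, ← range_posHom] at hx
  rw [Subalgebra.mem_toSubmodule, ← range_negHom] at hy
  obtain ⟨x, rfl⟩ := hx
  obtain ⟨y, rfl⟩ := hy
  exact ⟨x ⊗ₜ y, rfl⟩

theorem mulMap_bijective : Function.Bijective (mulMap D) :=
  ⟨Function.LeftInverse.injective (g := fun u => rep D u (1 ⊗ₜ 1)) (rep_mulMap D),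
    mulMap_surjective D⟩

theorem mulMap_rep (u : U D) : mulMap D (rep D u (1 ⊗ₜ 1)) = u := by
  obtain ⟨z, rfl⟩ := mulMap_surjective D u
  rw [rep_mulMap]

/-- The straightening rule in the quantum group. -/
theorem negHom_mul_posHom (x : Borel (borelDatum D)) (y : Borel (borelDatum D).transpose) :
    negHom D y * posHom D x = mulMap D (Borel.negAct _ (pairCoeff D) y (x ⊗ₜ 1)) := by
  -- An element of `U D` is determined by its action on 1 ⊗ 1, and y x sends this vector to y · (x ⊗
  -- 1).
  rw [← mulMap_rep D (negHom D y * posHom D x), map_mul, rep_posHom, rep_negHom,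
    Module.End.mul_apply, Borel.posAct_tmul, mul_one]

end Surjectivity

section Transport

theorem inclTensor_comul_geq (x : geq D) :
    inclTensor (geq D) (Coalgebra.comul x) = Coalgebra.comul (x : U D) :=
  (geq_isHopfSubalgebra D).inclTensor_comulHom x

theorem inclTensor_comul_leq (y : leq D) :
    inclTensor (leq D) (Coalgebra.comul y) = Coalgebra.comul (y : U D) :=
  (leq_isHopfSubalgebra D).inclTensor_comulHom y

/-- After the injection into `U D ⊗ U D` both sides are algebra homomorphisms, so it is enough to
compare generators. -/
theorem comul_posEquiv (x : Borel (borelDatum D)) : Coalgebra.comul (posEquiv D x) =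
    TensorProduct.map (posEquiv D).toLinearMap (posEquiv D).toLinearMap
      (Coalgebra.comul (R := Krs) x) := by
  apply inclTensor_injective
  rw [inclTensor_comul_geq, coe_posEquiv]
  have h1 : (Bialgebra.comulAlgHom Krs (U D)).comp (posHom D) =
      (Algebra.TensorProduct.map (posHom D) (posHom D)).comp (Bialgebra.comulAlgHom Krs _) := by
    refine Borel.hom_ext fun x => ?_
    simp only [AlgHom.comp_apply, Bialgebra.comulAlgHom_apply, Borel.comul_gen, posHom_gen]
    cases x <;> simp [posGen, comul_gen, comulGen, Borel.comulGen, posHom_gen]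
  refine (DFunLike.congr_fun h1 x).trans ?_
  rw [AlgHom.comp_apply, Bialgebra.comulAlgHom_apply]
  generalize Coalgebra.comul (R := Krs) x = z
  induction z with
  | zero => simp
  | tmul p q => rfl
  | add p q hp hq => simp only [map_add, hp, hq]

/-- The coproduct 1 ⊗ f + f ⊗ ω' is the flip of that of the abstract generator, hence
`Borel.comulCop`. -/
theorem comul_negEquiv (y : Borel (borelDatum D).transpose) : Coalgebra.comul (negEquiv D y) =
    TensorProduct.map (negEquiv D).toLinearMap (negEquiv D).toLinearMap
      (Borel.comulCop _ y) := by
  apply inclTensor_injective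
  rw [inclTensor_comul_leq, coe_negEquiv]
  have h1 : (Bialgebra.comulAlgHom Krs (U D)).comp (negHom D) =
      (Algebra.TensorProduct.map (negHom D) (negHom D)).comp (Borel.comulCop _) := by
    refine Borel.hom_ext fun x => ?_
    simp only [AlgHom.comp_apply, Bialgebra.comulAlgHom_apply, Borel.comulCop_gen, negHom_gen]
    cases x <;> simp [negGen, comul_gen, comulGen, negHom_gen]
  refine (DFunLike.congr_fun h1 y).trans ?_
  rw [AlgHom.comp_apply]
  generalize Borel.comulCop _ y = z
  induction z with
  | zero => simp
  | tmul p q => rfl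
  | add p q hp hq => simp only [map_add, hp, hq]

theorem counit_posEquiv (x : Borel (borelDatum D)) :
    Coalgebra.counit (R := Krs) (posEquiv D x) = Coalgebra.counit (R := Krs) x := by
  have h1 : (Bialgebra.counitAlgHom Krs (U D)).comp (posHom D) = Bialgebra.counitAlgHom Krs _ :=
    Borel.hom_ext fun x => by
      simp only [AlgHom.comp_apply, Bialgebra.counitAlgHom_apply, Borel.counit_gen, posHom_gen]
      cases x <;> simp [posGen, counit_gen, counitGen, Borel.counitGen]
  exact DFunLike.congr_fun h1 x

theorem counit_negEquiv (y : Borel (borelDatum D).transpose) :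
    Coalgebra.counit (R := Krs) (negEquiv D y) = Coalgebra.counit (R := Krs) y := by
  have h1 : (Bialgebra.counitAlgHom Krs (U D)).comp (negHom D) = Bialgebra.counitAlgHom Krs _ :=
    Borel.hom_ext fun x => by
      simp only [AlgHom.comp_apply, Bialgebra.counitAlgHom_apply, Borel.counit_gen, negHom_gen]
      cases x <;> simp [negGen, counit_gen, counitGen, Borel.counitGen]
  exact DFunLike.congr_fun h1 y

theorem antipode_negEquiv (y : Borel (borelDatum D).transpose) :
    HopfAlgebra.antipode Krs (negEquiv D y) = negEquiv D (Borel.antipodeHom _ y).unop := by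
  apply Subtype.ext
  have h1 : (antipodeHom D).comp (negHom D) =
      (AlgHom.op (negHom D)).comp (Borel.antipodeHom _) := by
    refine Borel.hom_ext fun x => ?_
    simp only [AlgHom.comp_apply, Borel.antipodeHom_gen, negHom_gen]
    cases x <;> simp [negGen, antipodeHom, antipodeGen, Borel.antipodeGen, negHom_gen]
  exact congrArg MulOpposite.unop (DFunLike.congr_fun h1 y)

/-- The skew pairing of the Borel subalgebras. -/
def pairing : leq D →ₗ[Krs] geq D →ₗ[Krs] Krs :=
  LinearMap.compl₁₂ ((ConvDual.toLin Krs _).toLinearMap ∘ₗ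
    (Borel.dualHom (borelDatum D) (pairCoeff D)).toLinearMap)
    (negEquiv D).symm.toLinearMap (posEquiv D).symm.toLinearMap

theorem pairing_apply (x : Borel (borelDatum D)) (y : Borel (borelDatum D).transpose) :
    pairing D (negEquiv D y) (posEquiv D x) = Borel.dualHom _ (pairCoeff D) y x := by
  simp [pairing]

/-- Products on the left are convolution products, since `Borel.dualHom` is an algebra homomorphism.
Products on the right are `Borel.mulPullback_dualHom`; the exchange of `x` and `x'` in the axiom is
absorbed by the co-opposite comultiplication. -/
theorem isSkewPairing_pairing : IsSkewPairing (pairing D) where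
  mul_right y x x' := by
    obtain ⟨y, rfl⟩ := (negEquiv D).surjective y
    obtain ⟨x, rfl⟩ := (posEquiv D).surjective x
    obtain ⟨x', rfl⟩ := (posEquiv D).surjective x'
    rw [← map_mul, pairing_apply, comul_negEquiv, ← mulPullback_apply, Borel.mulPullback_dualHom,
      Borel.comulCop, AlgHom.comp_apply, Bialgebra.comulAlgHom_apply]
    generalize Coalgebra.comul (R := Krs) y = z
    induction z with
    | zero => simp
    | add p q hp hq => simp only [map_add, LinearMap.add_apply, hp, hq]
    | tmul p q =>
      rw [Algebra.TensorProduct.map_tmul, dualTensor_tmul_apply]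
      change _ = tensorPairing (pairing D) (negEquiv D q ⊗ₜ negEquiv D p) _
      rw [tensorPairing_tmul, pairing_apply, pairing_apply, mul_comm]
  mul_left y y' x := by
    obtain ⟨y, rfl⟩ := (negEquiv D).surjective y
    obtain ⟨y', rfl⟩ := (negEquiv D).surjective y'
    obtain ⟨x, rfl⟩ := (posEquiv D).surjective x
    rw [← map_mul, pairing_apply, comul_posEquiv, map_mul, ConvDual.mul_apply]
    generalize Coalgebra.comul (R := Krs) x = z
    induction z with
    | zero => simp
    | add p q hp hq => simp only [map_add, hp, hq]
    | tmul p q =>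
      simp only [TensorProduct.map_tmul, AlgEquiv.toLinearMap_apply, tensorPairing_tmul,
        pairing_apply, LinearMap.mul'_apply]
  one_right y := by
    obtain ⟨y, rfl⟩ := (negEquiv D).surjective y
    rw [← map_one (posEquiv D), pairing_apply, Borel.dualHom_apply_one, counit_negEquiv]
  one_left x := by
    obtain ⟨x, rfl⟩ := (posEquiv D).surjective x
    rw [← map_one (negEquiv D), pairing_apply, map_one, ConvDual.one_apply, counit_posEquiv]

end Transport

end U

/-! ### Comparison of the straightening action with the double's formulas -/

section General

variable {k : Type*} [Field k]

/-- Both sides are ∑ (S y₁, x₁)(y₃, x₃) x₂ ⊗ y₂ on pure tensors. Swapping the two contractions makes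
the right side expand along the same iterated coproduct as the double. -/
theorem crossAux_map {X Y C B : Type*} [Ring X] [HopfAlgebra k X] [Ring Y] [HopfAlgebra k Y]
    [AddCommGroup C] [Module k C] [Coalgebra k C] [Ring B] [Algebra k B]
    {φ : Y →ₗ[k] X →ₗ[k] k} {S : B →ₐ[k] Bᵐᵒᵖ} {Φ : B →ₐ[k] ConvDual k C} {f : C →ₗ[k] X}
    {g : B →ₗ[k] Y} (hφ : ∀ y x, φ (g y) (f x) = Φ y x)
    (hS : ∀ y, HopfAlgebra.antipode k (g y) = g (S y).unop) (x : C) (t : B ⊗[k] (B ⊗[k] B)) :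
    DrinfeldDouble.crossAux φ (TensorProduct.map g (TensorProduct.map g g) t ⊗ₜ
        TensorProduct.map f (TensorProduct.map f f)
          ((Coalgebra.comul (R := k)).lTensor _ (Coalgebra.comul (R := k) x))) =
      TensorProduct.map f g (tripleAct S Φ t (x ⊗ₜ 1)) := by
  induction t with
  | zero => simp
  | add p q hp hq =>
    simp only [map_add, TensorProduct.add_tmul, LinearMap.add_apply, hp, hq]
  | tmul y₁ t =>
  induction t with
  | zero => simp
  | add p q hp hq =>
    simp only [map_add, TensorProduct.tmul_add, TensorProduct.add_tmul, LinearMap.add_apply,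
      hp, hq]
  | tmul y₂ y₃ =>
    rw [tripleAct_tmul, mul_one, antipodeAct_apply, rightAct_apply, leftAct_apply,
      contractLeft_comul_contractRight]
    generalize Coalgebra.comul (R := k) x = z
    induction z with
    | zero => simp
    | add p q hp hq =>
      simp only [map_add, TensorProduct.tmul_add, TensorProduct.add_tmul, hp, hq]
    | tmul p q =>
      rw [contractLeft_tmul, map_smul, map_smul, LinearMap.lTensor_tmul]
      generalize Coalgebra.comul (R := k) q = w
      induction w with
      | zero => simp
      | add p q hp hq =>
        simp only [map_add, TensorProduct.tmul_add, TensorProduct.add_tmul, smul_add, hp, hq]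
      | tmul u v =>
        rw [contractRight_tmul, smul_smul]
        simp only [TensorProduct.map_tmul, DrinfeldDouble.crossAux_tmul, hS, hφ, map_smul,
          ← TensorProduct.smul_tmul']

/-- Both maps respect comultiplication, and so does the multiplication of a bialgebra. -/
theorem comul_mul_map {H A B : Type*} [Ring H] [Bialgebra k H] [Ring A] [Bialgebra k A] [Ring B]
    [Bialgebra k B] {f : A →ₗ[k] H} {g : B →ₗ[k] H}
    (hf : ∀ x, Coalgebra.comul (f x) = TensorProduct.map f f (Coalgebra.comul (R := k) x))
    (hg : ∀ y, Coalgebra.comul (g y) = TensorProduct.map g g (Coalgebra.comul (R := k) y))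
    (u : A ⊗[k] B) : Coalgebra.comul (R := k) (LinearMap.mul' k H (TensorProduct.map f g u)) =
      TensorProduct.map (LinearMap.mul' k H ∘ₗ TensorProduct.map f g)
        (LinearMap.mul' k H ∘ₗ TensorProduct.map f g) (Coalgebra.comul (R := k) u) := by
  induction u with
  | zero => simp
  | add p q hp hq => simp only [map_add, hp, hq]
  | tmul x y =>
    rw [TensorProduct.map_tmul, LinearMap.mul'_apply, Bialgebra.comul_mul, hf, hg,
      TensorProduct.comul_tmul]
    generalize Coalgebra.comul (R := k) x = z
    generalize Coalgebra.comul (R := k) y = w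
    induction z with
    | zero => simp
    | add p q hp hq => simp only [map_add, add_mul, TensorProduct.add_tmul, hp, hq]
    | tmul p q =>
      induction w with
      | zero => simp
      | add p q hp hq => simp only [map_add, mul_add, TensorProduct.tmul_add, hp, hq]
      | tmul p' q' => simp

end General

/-! ### Multiplication as an isomorphism from the Drinfeld double -/

namespace U

variable {I : Type*} [Fintype I] [LinearOrder I] (D : CartanDatum I)

section Cross

theorem comul₂_posEquiv (x : Borel (borelDatum D)) :
    DrinfeldDouble.comul₂ (k := Krs) (posEquiv D x) = TensorProduct.map (posEquiv D).toLinearMap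
      (TensorProduct.map (posEquiv D).toLinearMap (posEquiv D).toLinearMap)
      ((Coalgebra.comul (R := Krs)).lTensor _ (Coalgebra.comul (R := Krs) x)) := by
  rw [DrinfeldDouble.comul₂, LinearMap.comp_apply, comul_posEquiv]
  generalize Coalgebra.comul (R := Krs) x = z
  induction z with
  | zero => simp
  | add p q hp hq => simp only [map_add, hp, hq]
  | tmul p q =>
    simp only [TensorProduct.map_tmul, LinearMap.lTensor_tmul, AlgEquiv.toLinearMap_apply,
      comul_posEquiv]

theorem comul₂_negEquiv (y : Borel (borelDatum D).transpose) :
    DrinfeldDouble.comul₂ (k := Krs) (negEquiv D y) = TensorProduct.map (negEquiv D).toLinearMap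
      (TensorProduct.map (negEquiv D).toLinearMap (negEquiv D).toLinearMap)
      (Algebra.TensorProduct.map (AlgHom.id Krs _) (Borel.comulCop _) (Borel.comulCop _ y)) := by
  rw [DrinfeldDouble.comul₂, LinearMap.comp_apply, comul_negEquiv]
  generalize Borel.comulCop _ y = z
  induction z with
  | zero => simp
  | add p q hp hq => simp only [map_add, hp, hq]
  | tmul p q =>
    simp only [TensorProduct.map_tmul, Algebra.TensorProduct.map_tmul, LinearMap.lTensor_tmul,
      AlgEquiv.toLinearMap_apply, comul_negEquiv, AlgHom.id_apply]

theorem cross_pairing (x : Borel (borelDatum D)) (y : Borel (borelDatum D).transpose) :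
    DrinfeldDouble.cross (pairing D) (negEquiv D y ⊗ₜ posEquiv D x) =
      TensorProduct.map (posEquiv D).toLinearMap (negEquiv D).toLinearMap
        (Borel.negAct _ (pairCoeff D) y (x ⊗ₜ 1)) := by
  rw [DrinfeldDouble.cross, LinearMap.comp_apply, TensorProduct.map_tmul, comul₂_posEquiv,
    comul₂_negEquiv, Borel.negAct, straighten_apply]
  exact crossAux_map (fun y x => pairing_apply D x y) (antipode_negEquiv D) x _

end Cross

section Multiplication

/-- The multiplication map from the tensor product of the Borel subalgebras. -/
def doubleMul : geq D ⊗[Krs] leq D →ₗ[Krs] U D :=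
  LinearMap.mul' Krs (U D) ∘ₗ TensorProduct.map (geq D).val.toLinearMap (leq D).val.toLinearMap

@[simp] theorem doubleMul_tmul (x : geq D) (y : leq D) :
    doubleMul D (x ⊗ₜ y) = (x : U D) * (y : U D) := rfl

theorem doubleMul_map (z : Borel (borelDatum D) ⊗[Krs] Borel (borelDatum D).transpose) :
    doubleMul D (TensorProduct.map (posEquiv D).toLinearMap (negEquiv D).toLinearMap z) =
      mulMap D z := by
  induction z with
  | zero => simp
  | tmul x y => rfl
  | add p q hp hq => simp only [map_add, hp, hq]

theorem doubleMul_bijective : Function.Bijective (doubleMul D) := by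
  let E := TensorProduct.congr (posEquiv D).toLinearEquiv (negEquiv D).toLinearEquiv
  have h : doubleMul D ∘ E = mulMap D := funext (doubleMul_map D)
  exact (Function.Bijective.of_comp_iff _ E.bijective).1 (h ▸ mulMap_bijective D)

theorem doubleMul_cross (x : geq D) (y : leq D) :
    doubleMul D (DrinfeldDouble.cross (pairing D) (y ⊗ₜ x)) = (y : U D) * (x : U D) := by
  obtain ⟨x, rfl⟩ := (posEquiv D).surjective x
  obtain ⟨y, rfl⟩ := (negEquiv D).surjective y
  rw [cross_pairing, doubleMul_map, ← negHom_mul_posHom]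
  rfl

theorem doubleMul_map_mul (x : geq D) (y : leq D) (z : geq D ⊗[Krs] leq D) :
    doubleMul D (TensorProduct.map (LinearMap.mulLeft Krs x) (LinearMap.mulRight Krs y) z) =
      x * doubleMul D z * y := by
  induction z with
  | zero => simp
  | tmul p q => simp [mul_assoc]
  | add p q hp hq => simp only [map_add, mul_add, add_mul, hp, hq]

/-- The outer factors are only multiplied from the two sides, so everything reduces to the inner
product y x', which is the straightening rule `doubleMul_cross`. -/
theorem doubleMul_mulLin (u v : geq D ⊗[Krs] leq D) :
    doubleMul D (DrinfeldDouble.mulLin (pairing D) (u ⊗ₜ v)) = doubleMul D u * doubleMul D v := by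
  induction u with
  | zero => simp
  | add p q hp hq => simp only [TensorProduct.add_tmul, map_add, add_mul, hp, hq]
  | tmul x y =>
    induction v with
    | zero => simp
    | add p q hp hq => simp only [TensorProduct.tmul_add, map_add, mul_add, hp, hq]
    | tmul x' y' =>
      rw [DrinfeldDouble.mulLin_tmul, doubleMul_map_mul, doubleMul_cross, doubleMul_tmul,
        doubleMul_tmul]
      simp only [mul_assoc]

theorem counit_doubleMul (u : geq D ⊗[Krs] leq D) :
    Coalgebra.counit (R := Krs) (doubleMul D u) = Coalgebra.counit (R := Krs) u := by
  induction u with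
  | zero => simp
  | add p q hp hq => simp only [map_add, hp, hq]
  | tmul x y =>
    rw [doubleMul_tmul, Bialgebra.counit_mul, TensorProduct.counit_tmul, smul_eq_mul, mul_comm]
    rfl

theorem comul_doubleMul (u : geq D ⊗[Krs] leq D) :
    Coalgebra.comul (R := Krs) (doubleMul D u) =
      TensorProduct.map (doubleMul D) (doubleMul D) (Coalgebra.comul (R := Krs) u) :=
  comul_mul_map (fun x => (inclTensor_comul_geq D x).symm)
    (fun y => (inclTensor_comul_leq D y).symm) u

/-- The antipode of `U D` reverses products, S(xy) = S(y) S(x), and the antipode of the double is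
the product in that same order. -/
theorem antipode_doubleMul (u : DrinfeldDouble (pairing D)) :
    doubleMul D (DrinfeldDouble.antipode (pairing D) u) =
      HopfAlgebra.antipode Krs (doubleMul D u) := by
  suffices h : doubleMul D ∘ₗ DrinfeldDouble.antipode (pairing D) =
      HopfAlgebra.antipode Krs ∘ₗ doubleMul D from LinearMap.congr_fun h u
  refine TensorProduct.ext' fun x y => ?_
  refine (doubleMul_mulLin D (1 ⊗ₜ HopfAlgebra.antipode Krs y)
    (HopfAlgebra.antipode Krs x ⊗ₜ 1)).trans ?_
  rw [LinearMap.comp_apply]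
  simp only [doubleMul_tmul, OneMemClass.coe_one, one_mul, mul_one, antipode_mul]
  rfl

/-- The multiplication map, as an isomorphism of coalgebras from the Drinfeld double. -/
def doubleEquiv : DrinfeldDouble (pairing D) ≃ₗc[Krs] U D :=
  CoalgEquiv.ofBijective (f :=
    ({ doubleMul D with
      counit_comp := LinearMap.ext (counit_doubleMul D)
      map_comp_comul := LinearMap.ext fun u => (comul_doubleMul D u).symm } :
      DrinfeldDouble (pairing D) →ₗc[Krs] U D)) (doubleMul_bijective D)

end Multiplication

end U

/-! ### Pairings with group-like and skew-primitive elements -/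

namespace IsSkewPairing

variable {k : Type*} [Field k] {Y X : Type*} [Ring Y] [HopfAlgebra k Y] [Ring X] [HopfAlgebra k X]
  {φ : Y →ₗ[k] X →ₗ[k] k} (hφ : IsSkewPairing φ)

/-- Pairing with a group-like element of `X` is multiplicative. -/
def evalRight (x : X) (hx : IsGroupLikeElem k x) : Y →* k where
  toFun y := φ y x
  map_one' := by rw [hφ.one_left, hx.counit_eq_one]
  map_mul' y y' := by rw [hφ.mul_left, hx.comul_eq_tmul_self, tensorPairing_tmul]

/-- Pairing with a group-like element of `Y` is multiplicative. -/
def evalLeft (y : Y) (hy : IsGroupLikeElem k y) : X →* k where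
  toFun x := φ y x
  map_one' := by rw [hφ.one_right, hy.counit_eq_one]
  map_mul' x x' := by rw [hφ.mul_right, hy.comul_eq_tmul_self, tensorPairing_tmul, mul_comm]

/-- The units of `Y` that are orthogonal to a skew-primitive element of `X`. -/
def orthLeft (x w : X) (hw : IsGroupLikeElem k w)
    (hx : Coalgebra.comul (R := k) x = x ⊗ₜ 1 + w ⊗ₜ x) : Subgroup Yˣ where
  carrier := {u | φ u x = 0}
  one_mem' := by
    -- Expanding (1 · 1, x) gives ε(x) = ε(x) + ε(x), so ε(x) = 0.
    have h := hφ.mul_left 1 1 x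
    have h1 := hw.counit_eq_one
    rw [hx, map_add, tensorPairing_tmul, tensorPairing_tmul, mul_one, hφ.one_left, hφ.one_left,
      hφ.one_left, h1, Bialgebra.counit_one, mul_one, one_mul] at h
    change φ 1 x = 0
    rw [hφ.one_left]
    simpa using h
  mul_mem' {u v} hu hv := by
    change φ (u * v) x = 0
    rw [hφ.mul_left, hx, map_add, tensorPairing_tmul, tensorPairing_tmul, hu, hv, zero_mul,
      mul_zero, add_zero]
  inv_mem' {u} hu := by
    -- In 0 = (u⁻¹ u, x) the term containing (u, x) drops out, leaving (u⁻¹, x) ε(u); and ε(u) ≠ 0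
    -- because `u` is a unit.
    have h := hφ.mul_left ↑u⁻¹ ↑u x
    have h' := hφ.mul_left 1 1 x
    have h1 := hw.counit_eq_one
    rw [hx, map_add, tensorPairing_tmul, tensorPairing_tmul, mul_one, hφ.one_left, hφ.one_left,
      hφ.one_left, h1, Bialgebra.counit_one, mul_one, one_mul, left_eq_add] at h'
    rw [Units.inv_mul, hφ.one_left, h', hx, map_add, tensorPairing_tmul, tensorPairing_tmul, hu,
      mul_zero, add_zero, hφ.one_right] at h
    have h2 : Coalgebra.counit (R := k) (u : Y) ≠ 0 :=
      (u.isUnit.map (Bialgebra.counitAlgHom k Y)).ne_zero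
    exact (mul_eq_zero.1 h.symm).resolve_right h2

/-- The units of `X` that are orthogonal to a skew-primitive element of `Y`. -/
def orthRight (y w : Y) (hw : IsGroupLikeElem k w)
    (hy : Coalgebra.comul (R := k) y = 1 ⊗ₜ y + y ⊗ₜ w) : Subgroup Xˣ where
  carrier := {u | φ y u = 0}
  one_mem' := by
    have h := hφ.mul_right y 1 1
    have h1 := hw.counit_eq_one
    rw [hy, map_add, LinearMap.add_apply, tensorPairing_tmul, tensorPairing_tmul, mul_one,
      hφ.one_right, hφ.one_right, hφ.one_right, h1, Bialgebra.counit_one, mul_one, one_mul] at h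
    change φ y 1 = 0
    rw [hφ.one_right]
    simpa using h
  mul_mem' {u v} hu hv := by
    change φ y (u * v) = 0
    rw [hφ.mul_right, hy, map_add, LinearMap.add_apply, tensorPairing_tmul, tensorPairing_tmul,
      hu, hv, zero_mul, mul_zero, add_zero]
  inv_mem' {u} hu := by
    have h := hφ.mul_right y ↑u ↑u⁻¹
    have h' := hφ.mul_right y 1 1
    have h1 := hw.counit_eq_one
    rw [hy, map_add, LinearMap.add_apply, tensorPairing_tmul, tensorPairing_tmul, mul_one,
      hφ.one_right, hφ.one_right, hφ.one_right, h1, Bialgebra.counit_one, mul_one, one_mul,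
      left_eq_add] at h'
    rw [Units.mul_inv, hφ.one_right, h', hy, map_add, LinearMap.add_apply, tensorPairing_tmul,
      tensorPairing_tmul, hu, mul_zero, zero_add] at h
    -- Here the remaining factor is (w, u), nonzero because pairing with the group-like `w` is
    -- multiplicative and `u` is a unit.
    have h2 : φ w (u : X) ≠ 0 := (u.isUnit.map (hφ.evalLeft w hw)).ne_zero
    exact (mul_eq_zero.1 h.symm).resolve_right h2

end IsSkewPairing

theorem Units.val_map_listProd_zpow {ι M k : Type*} [Fintype ι] [LinearOrder ι] [Monoid M]
    [Field k] (g : M →* k) (u : ι → Mˣ) (μ : ι → ℤ) :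
    g ((((Finset.univ.sort (· ≤ ·)).map fun i => u i ^ μ i).prod : Mˣ) : M) =
      ∏ i, g (u i) ^ μ i := by
  rw [← Units.coe_map, map_list_prod, List.map_map]
  have h : (fun i => ((Units.map g (u i) ^ μ i : kˣ) : k)) = fun i => g (u i) ^ μ i := by
    ext i; simp
  rw [← h, ← Units.coe_prod, Finset.prod, ← Finset.sort_eq Finset.univ (· ≤ ·),
    Multiset.map_coe, Multiset.prod_coe]
  simp [Function.comp_def]

theorem prod_zpow_eq_zpow_sum {ι k : Type*} [Field k] {a : k} (ha : a ≠ 0) (t : Finset ι)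
    (n : ι → ℤ) : ∏ i ∈ t, a ^ n i = a ^ ∑ i ∈ t, n i := by
  induction t using Finset.cons_induction with
  | empty => simp
  | cons i t hi ih => rw [Finset.prod_cons, Finset.sum_cons, zpow_add₀ ha, ih]

theorem listProd_zpow_single {ι G : Type*} [Fintype ι] [LinearOrder ι] [Group G] (u : ι → G)
    (j : ι) (n : ℤ) : ((Finset.univ.sort (· ≤ ·)).map fun i =>
      u i ^ (Pi.single j n : ι → ℤ) i).prod = u j ^ n := by
  rw [List.prod_map_eq_pow_single j _ fun i hi _ => by
    rw [Pi.single_eq_of_ne hi, zpow_zero], Pi.single_eq_same, List.count_eq_one_of_mem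
      (Finset.sort_nodup _ _) ((Finset.mem_sort _).2 (Finset.mem_univ j)), pow_one]

/-! ### Values of the pairing on generators, and uniqueness -/

namespace U

variable {I : Type*} [Fintype I] [LinearOrder I] (D : CartanDatum I)

theorem posEquiv_e (i : I) : posEquiv D (Borel.gen _ (.e i)) = ⟨gen D (.e i), e_mem D i⟩ :=
  Subtype.ext (posHom_gen D _)

theorem posEquiv_w (i : I) : posEquiv D (Borel.gen _ (.w i)) = wUnit D i :=
  Subtype.ext (posHom_gen D _)

theorem posEquiv_winv (i : I) : posEquiv D (Borel.gen _ (.winv i)) = ↑(wUnit D i)⁻¹ :=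
  Subtype.ext (posHom_gen D _)

theorem negEquiv_e (i : I) : negEquiv D (Borel.gen _ (.e i)) = ⟨gen D (.f i), f_mem D i⟩ :=
  Subtype.ext (negHom_gen D _)

theorem negEquiv_w (i : I) : negEquiv D (Borel.gen _ (.w i)) = w'Unit D i :=
  Subtype.ext (negHom_gen D _)

theorem negEquiv_winv (i : I) : negEquiv D (Borel.gen _ (.winv i)) = ↑(w'Unit D i)⁻¹ :=
  Subtype.ext (negHom_gen D _)

theorem isGroupLikeElem_wUnit (i : I) : IsGroupLikeElem Krs (wUnit D i : geq D) where
  counit_eq_one := by rw [← posEquiv_w, counit_posEquiv, Borel.counit_gen]; rfl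
  comul_eq_tmul_self := by rw [← posEquiv_w, comul_posEquiv, Borel.comul_gen]; rfl

theorem isGroupLikeElem_w'Unit (i : I) : IsGroupLikeElem Krs (w'Unit D i : leq D) where
  counit_eq_one := by rw [← negEquiv_w, counit_negEquiv, Borel.counit_gen]; rfl
  comul_eq_tmul_self := by rw [← negEquiv_w, comul_negEquiv, Borel.comulCop_gen]; rfl

theorem isGroupLikeElem_wQ (μ : I → ℤ) : IsGroupLikeElem Krs (wQ D μ) := by
  let G : Subgroup (geq D)ˣ :=
    { (groupLikeSubmonoid Krs (geq D)).comap (Units.coeHom _) with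
      inv_mem' := fun {u} hu => isGroupLikeElem_unitsInv.2 hu }
  refine list_prod_mem (S := G) fun u hu => ?_
  obtain ⟨i, -, rfl⟩ := List.mem_map.1 hu
  exact zpow_mem (K := G) (isGroupLikeElem_wUnit D i) _

theorem comul_e (i : I) :
    Coalgebra.comul (R := Krs) (⟨gen D (.e i), e_mem D i⟩ : geq D) =
      ⟨gen D (.e i), e_mem D i⟩ ⊗ₜ 1 + (wUnit D i : geq D) ⊗ₜ ⟨gen D (.e i), e_mem D i⟩ := by
  rw [← posEquiv_e, comul_posEquiv, Borel.comul_gen, Borel.comulGen, map_add,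
    TensorProduct.map_tmul, TensorProduct.map_tmul]
  simp only [AlgEquiv.toLinearMap_apply, map_one, posEquiv_w]

theorem comul_f (i : I) :
    Coalgebra.comul (R := Krs) (⟨gen D (.f i), f_mem D i⟩ : leq D) =
      1 ⊗ₜ ⟨gen D (.f i), f_mem D i⟩ + ⟨gen D (.f i), f_mem D i⟩ ⊗ₜ (w'Unit D i : leq D) := by
  rw [← negEquiv_e, comul_negEquiv, Borel.comulCop_gen, map_add,
    TensorProduct.map_tmul, TensorProduct.map_tmul]
  simp only [AlgEquiv.toLinearMap_apply, map_one, negEquiv_w]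

theorem pairing_w'_w (i j : I) : pairing D (w'Unit D j) (wUnit D i) = chi D i j := by
  rw [← negEquiv_w, ← posEquiv_w, pairing_apply, Borel.dualHom_gen]
  exact Borel.wChar_gen _ _ _

theorem pairing_w'_e (i j : I) :
    pairing D (w'Unit D j) ⟨gen D (.e i), e_mem D i⟩ = 0 := by
  rw [← negEquiv_w, ← posEquiv_e, pairing_apply, Borel.dualHom_gen]
  exact Borel.wChar_gen _ _ _

theorem pairing_f_w (i j : I) :
    pairing D ⟨gen D (.f j), f_mem D j⟩ (wUnit D i) = 0 := by
  rw [← negEquiv_e, ← posEquiv_w, pairing_apply, Borel.dualHom_gen]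
  exact Borel.fFun_w _ _

theorem isBorelPairing_pairing : IsBorelPairing D (pairing D) where
  isSkewPairing := isSkewPairing_pairing D
  f_e i j := by
    rw [← negEquiv_e, ← posEquiv_e, pairing_apply, Borel.dualHom_gen]
    refine (Borel.fFun_e _ _).trans ?_
    simp only [eq_comm (a := j), pairCoeff]
  w'_w μ ν := by
    have hs := isSkewPairing_pairing D
    -- Pairing with a group-like element is multiplicative, so the value is expanded in μ and
    -- afterwards in ν, down to the pairs (ω'ⱼ, ωᵢ) = `chi D i j`; the exponents add up to the Euler
    -- form.
    have h1 := Units.val_map_listProd_zpow (hs.evalRight (wQ D ν) (isGroupLikeElem_wQ D ν))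
      (w'Unit D) μ
    have h2 := fun j => Units.val_map_listProd_zpow
      (hs.evalLeft (w'Unit D j) (isGroupLikeElem_w'Unit D j)) (wUnit D) ν
    refine h1.trans ?_
    have h3 : ∀ j, hs.evalRight (wQ D ν) (isGroupLikeElem_wQ D ν) (w'Unit D j) =
        r ^ (∑ i, ν i * D.euler j i) * s ^ (-∑ i, ν i * D.euler i j) := fun j => by
      refine (h2 j).trans ?_
      have h4 : ∀ i, hs.evalLeft (w'Unit D j) (isGroupLikeElem_w'Unit D j) (wUnit D i) =
        chi D i j := fun i => pairing_w'_w D i j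
      simp only [h4, chi, mul_zpow, Finset.prod_mul_distrib, ← zpow_mul]
      rw [← Finset.sum_neg_distrib, prod_zpow_eq_zpow_sum r_ne_zero, prod_zpow_eq_zpow_sum s_ne_zero]
      congr 2 <;> exact Finset.sum_congr rfl fun i _ => by ring
    simp only [h3, mul_zpow, Finset.prod_mul_distrib, ← zpow_mul]
    rw [prod_zpow_eq_zpow_sum r_ne_zero, prod_zpow_eq_zpow_sum s_ne_zero]
    congr 2
    · exact Finset.sum_congr rfl fun j _ => by
        rw [Finset.sum_mul]; exact Finset.sum_congr rfl fun i _ => by ring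
    · rw [CartanDatum.eulerQ, Finset.sum_comm, ← Finset.sum_neg_distrib]
      exact Finset.sum_congr rfl fun j _ => by
        rw [neg_mul, Finset.sum_mul]
        exact congrArg _ (Finset.sum_congr rfl fun i _ => by ring)
  w'_e μ i := by
    -- The units orthogonal to eᵢ form a subgroup, so it suffices that each ω'ⱼ lies in it.
    let G := (isSkewPairing_pairing D).orthLeft _ _ (isGroupLikeElem_wUnit D i) (comul_e D i)
    refine list_prod_mem (S := G) fun u hu => ?_
    obtain ⟨j, -, rfl⟩ := List.mem_map.1 hu
    exact zpow_mem (K := G) (pairing_w'_e D i j) _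
  f_w i μ := by
    let G := (isSkewPairing_pairing D).orthRight _ _ (isGroupLikeElem_w'Unit D i) (comul_f D i)
    refine list_prod_mem (S := G) fun u hu => ?_
    obtain ⟨j, -, rfl⟩ := List.mem_map.1 hu
    exact zpow_mem (K := G) (pairing_f_w D j i) _

/-- For a generator `y` the coproduct involves only generators and 1, so the axiom for (y, x x')
carries an induction on `x`. The axiom for (y y', x) then carries an induction on `y`. -/
theorem IsSkewPairing.ext_of_gen {φ ψ : leq D →ₗ[Krs] geq D →ₗ[Krs] Krs} (hφ : IsSkewPairing φ)
    (hψ : IsSkewPairing ψ)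
    (h : ∀ p q, φ (negEquiv D (Borel.gen _ p)) (posEquiv D (Borel.gen _ q)) =
      ψ (negEquiv D (Borel.gen _ p)) (posEquiv D (Borel.gen _ q))) : φ = ψ := by
  -- All negative generators are treated together, since the coproduct of fⱼ also involves ω'ⱼ.
  have h1 : ∀ x p, φ (negEquiv D (Borel.gen _ p)) (posEquiv D x) =
      ψ (negEquiv D (Borel.gen _ p)) (posEquiv D x) := by
    intro x
    induction x using Borel.induction with
    | gen q => exact fun p => h p q
    | algebraMap c =>
      intro p
      rw [AlgEquiv.commutes, Algebra.algebraMap_eq_smul_one, map_smul, map_smul, hφ.one_right,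
        hψ.one_right]
    | add x y hx hy => intro p; simp only [map_add, hx p, hy p]
    | mul x y hx hy =>
      intro p
      rw [map_mul, hφ.mul_right, hψ.mul_right, comul_negEquiv, Borel.comulCop_gen]
      cases p <;> simp only [map_add, map_one, LinearMap.add_apply, TensorProduct.map_tmul,
        AlgEquiv.toLinearMap_apply, tensorPairing_tmul, hx, hy, hφ.one_left, hψ.one_left]
  refine LinearMap.ext fun y => ?_
  obtain ⟨y, rfl⟩ := (negEquiv D).surjective y
  induction y using Borel.induction with
  | gen p =>
    refine LinearMap.ext fun x => ?_
    obtain ⟨x, rfl⟩ := (posEquiv D).surjective x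
    exact h1 x p
  | algebraMap c =>
    refine LinearMap.ext fun x => ?_
    rw [AlgEquiv.commutes, Algebra.algebraMap_eq_smul_one, map_smul, map_smul,
      LinearMap.smul_apply, LinearMap.smul_apply, hφ.one_left, hψ.one_left]
  | add x y hx hy => simp only [map_add, hx, hy]
  | mul y y' hy hy' =>
    refine LinearMap.ext fun x => ?_
    rw [map_mul, hφ.mul_left, hψ.mul_left]
    generalize Coalgebra.comul (R := Krs) x = z
    induction z with
    | zero => simp
    | add p q hp hq => simp only [map_add, hp, hq]
    | tmul p q => rw [tensorPairing_tmul, tensorPairing_tmul, hy, hy']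

theorem wQ_single (j : I) (n : ℤ) : wQ D (Pi.single j n) = ↑(wUnit D j ^ n) :=
  congrArg Units.val (listProd_zpow_single (wUnit D) j n)

theorem w'Q_single (j : I) (n : ℤ) : w'Q D (Pi.single j n) = ↑(w'Unit D j ^ n) :=
  congrArg Units.val (listProd_zpow_single (w'Unit D) j n)

theorem posEquiv_w_eq_wQ (j : I) : posEquiv D (Borel.gen _ (.w j)) = wQ D (Pi.single j 1) := by
  rw [posEquiv_w, wQ_single, zpow_one]

theorem posEquiv_winv_eq_wQ (j : I) :
    posEquiv D (Borel.gen _ (.winv j)) = wQ D (Pi.single j (-1)) := by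
  rw [posEquiv_winv, wQ_single, zpow_neg_one]

theorem negEquiv_w_eq_w'Q (j : I) : negEquiv D (Borel.gen _ (.w j)) = w'Q D (Pi.single j 1) := by
  rw [negEquiv_w, w'Q_single, zpow_one]

theorem negEquiv_winv_eq_w'Q (j : I) :
    negEquiv D (Borel.gen _ (.winv j)) = w'Q D (Pi.single j (-1)) := by
  rw [negEquiv_winv, w'Q_single, zpow_neg_one]

/-- Every generator is an eᵢ or fᵢ, or some ω_μ or ω'_μ with μ = ±αⱼ, so the prescribed values cover
all pairs of generators. -/
theorem IsBorelPairing.unique {φ ψ : leq D →ₗ[Krs] geq D →ₗ[Krs] Krs} (hφ : IsBorelPairing D φ)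
    (hψ : IsBorelPairing D ψ) : φ = ψ := by
  refine IsSkewPairing.ext_of_gen D hφ.isSkewPairing hψ.isSkewPairing fun p q => ?_
  cases p <;> cases q <;>
    simp only [negEquiv_e, posEquiv_e, negEquiv_w_eq_w'Q, negEquiv_winv_eq_w'Q, posEquiv_w_eq_wQ,
      posEquiv_winv_eq_wQ, hφ.f_e, hψ.f_e, hφ.w'_w, hψ.w'_w, hφ.w'_e, hψ.w'_e, hφ.f_w, hψ.f_w]

end U

end TwoParam

end

/-! ### The Drinfeld double theorem -/

theorem corollary2p5 {I : Type*} [Fintype I] [LinearOrder I] (D : TwoParam.CartanDatum I) :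
    ∃ φ : TwoParam.U.leq D →ₗ[TwoParam.Krs] TwoParam.U.geq D →ₗ[TwoParam.Krs] TwoParam.Krs,
      TwoParam.U.IsBorelPairing D φ ∧
      (∀ ψ : TwoParam.U.leq D →ₗ[TwoParam.Krs] TwoParam.U.geq D →ₗ[TwoParam.Krs] TwoParam.Krs,
        TwoParam.U.IsBorelPairing D ψ → ψ = φ) ∧
      ∃ Ψ : TwoParam.DrinfeldDouble φ ≃ₗc[TwoParam.Krs] TwoParam.U D,
        (∀ (x : TwoParam.U.geq D) (y : TwoParam.U.leq D),
          Ψ (TwoParam.DrinfeldDouble.tmul φ x y) = (x : TwoParam.U D) * (y : TwoParam.U D)) ∧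
        Ψ 1 = 1 ∧
        (∀ u v : TwoParam.DrinfeldDouble φ, Ψ (u * v) = Ψ u * Ψ v) ∧
        (∀ u : TwoParam.DrinfeldDouble φ,
          Ψ (TwoParam.DrinfeldDouble.antipode φ u) =
            HopfAlgebra.antipode TwoParam.Krs (Ψ u)) :=
  ⟨TwoParam.U.pairing D, TwoParam.U.isBorelPairing_pairing D,
    fun _ hψ => TwoParam.U.IsBorelPairing.unique D hψ (TwoParam.U.isBorelPairing_pairing D),
    TwoParam.U.doubleEquiv D, TwoParam.U.doubleMul_tmul D,
    (TwoParam.U.doubleMul_tmul D 1 1).trans (mul_one 1), TwoParam.U.doubleMul_mulLin D,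
    TwoParam.U.antipode_doubleMul D⟩
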